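/- **Setting.** Fix $p\in(2,3)$, put $\alpha=1/p$, $q=p/2$, and let $\alpha<\nu\le\frac12$. Let $T^2_1(\mathbb R^m)=1\oplus\mathbb R^m\oplus(\mathbb R^m\otimes\mathbb R^m)$ with product $(1,g^1,g^2)\otimes(1,h^1,h^2)=(1,g^1+h^1,g^1\otimes h^1+g^2+h^2)$; $\mathbb R^m\otimes\mathbb R^m$ carries the projective tensor norm and linear maps carry operator norms. Let $\Omega=\mathscr C_0^{0,\alpha}(\mathbb R,T^2_1(\mathbb R^m))$ be the space of paths $\omega=(1,x,\mathbb X)$ with $\omega_0=1$ that on every compact interval are $\alpha$-Hölder rough paths and limits of smooth paths in the $\alpha$-Hölder rough path metric, with the $\sigma$-algebra generated by the evaluations. Write $\omega_s^{-1}\otimes\omega_t=(1,x_{s,t},\mathbb X_{s,t})$ and let $(\theta_t\omega)_s=\omega_t^{-1}\otimes\omega_{t+s}$ be the Wiener-type shift. Let $\mathbb P$ be a probability measure on $\Omega$, invariant under all $\theta_t$, such that for every $T>0$ there is a constant $C_{T,\nu}$ with $\mathbb E(\|x_{s,t}\|^p+\|\mathbb X_{s,t}\|^q)\le C_{T,\nu}|t-s|^{p\nu}$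 for $0\le s\le t\le T$. Let $f:\mathbb R^d\to\mathbb R^d$ be $C^1$ with $L_f:=\|Df\|_\infty<\infty$, let $g\in C^3_b(\mathbb R^d,L(\mathbb R^m,\mathbb R^d))$, and $$L_g=\max\Big\{\|Dg\|_\infty,\ \|D^2g\|_\infty,\ \big[\|g\|_\infty(\|Dg\|_\infty\vee\|D^2g\|_\infty\vee\|D^3g\|_\infty)\big]^{1/2},\ \big(\|g\|_\infty^2\|D^3g\|_\infty\big)^{1/3}\Big\}.$$ For $0<\Delta\le1$, $t_k=k\Delta$, $\Pi=\{t_k:k\in\mathbb N\}$, consider the scheme $$y^\Delta_{t_{k+1}}=y^\Delta_{t_k}+f(y^\Delta_{t_k})\Delta+g(y^\Delta_{t_k})x_{t_k,t_{k+1}}+Dg(y^\Delta_{t_k})g(y^\Delta_{t_k})\mathbb X_{t_k,t_{k+1}}.$$ Assume that $\theta_\Delta$ is ergodic for $\mathbb P$. A stationary solution is a random variable $\mathfrak a^\Delta:\Omega\to\mathbb R^d$ such that almost surely $(\mathfrak a^\Delta(\theta_{t_k}\omega))_{k\in\mathbb N}$ is the solution of the scheme starting from $\mathfrak a^\Delta(\omega)$.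 It is *almost surely exponentially stable* if * for every $\varepsilon>0$ there is a positive random variable $r$ such that for a.e. $\omega$, $\|y_0-\mathfrak a^\Delta(\omega)\|<r(\omega)$ implies $\sup_{t\in\Pi}\|y^\Delta_t-\mathfrak a^\Delta(\theta_t\omega)\|<\varepsilon$ for the solution $y^\Delta$ starting from $y_0$; and * there are positive random variables $r,A$ and a constant $\mu>0$ such that for a.e. $\omega$, $\|y_0-\mathfrak a^\Delta(\omega)\|<r(\omega)$ implies $\|y^\Delta_t-\mathfrak a^\Delta(\theta_t\omega)\|\le A(\omega)e^{-\mu t}$ for all $t\in\Pi$. Put $\ell(f,y)=\lim_{r\to0}\sup_{0<\|z-y\|<r}\frac{\langle z-y,f(z)-f(y)\rangle}{\|z-y\|^2}$ $(=\sup_{\|h\|=1}\langle h,Df(y)h\rangle)$. For a nonnegative functional $c_{s,t}$, a level $\gamma>0$ and $I=[a,b]$ set $\tau^*_0=a$, $\tau^*_{i+1}=\inf\{t>\tau^*_i: c_{\tau^*_i,t}\ge\gamma\}\wedge b$ and $N^*=\sup\{i:\tau^*_i<b\}+1$. Let $N^*(\gamma,\mathbf x,I)$ be this number for $c_{s,t}=|||\mathbf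 x|||_{p\text{-var},[s,t]}=\big(|||x|||^p_{p\text{-var},[s,t]}+|||\mathbb X|||^q_{q\text{-var},[s,t]}\big)^{1/p}$. For constants $C_p>1$, $\lambda>0$ let $N^*(\lambda,\mathcal S,I)$ be this number at level $\lambda$ for $$c_{s,t}=L_f(t-s)+(4C_p+1)L_g|||x|||_{p\text{-var},\Pi\cap[s,t]}+(4C_p+1)^2L_g^2|||\mathbb X|||_{q\text{-var},\Pi\cap[s,t]}+2\lambda\sup_{u\in\Pi\cap[s,t]}\|f(\mathfrak a^\Delta(\theta_u\omega))\|\,(t-s),$$ that is, $c=\sum_{\mathbf w\in\mathcal S}\mathbf w^{\beta_{\mathbf w}}$ for the controls $\mathbf w^{(1)}=L_f(t-s)$, $\mathbf w^{(2)}=(4C_p+1)^pL_g^p|||x|||^p_{p\text{-var},\Pi\cap[s,t]}$, $\mathbf w^{(3)}=(4C_p+1)^pL_g^p|||\mathbb X|||^q_{q\text{-var},\Pi\cap[s,t]}$, $\mathbf w^{(4)}=2\lambda\|f(\mathfrak a^\Delta)\|_{\infty,\Pi\cap[s,t]}(t-s)$ with exponents $1,\frac1p,\frac1q,1$. Let $$K=5(1+\lambda)(1+2C_p)^2e^{12\lambda+2\lambda^2}\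 \vee\ \tfrac32e^{6L_f\Delta}.$$ **Theorem.** For every $p\in(2,3)$ there is $C_0>1$ depending only on $p$ such that every $C_p\ge C_0$ has the following two properties. 1. $C_p$ is an admissible constant in the rough integral estimate $$\Big\|\int_a^b y\,dx-y_ax_{a,b}-y'_a\mathbb X_{a,b}\Big\|\le C_p\Big(|||x|||_{p\text{-var},[a,b]}|||R^y|||_{q\text{-var},[a,b]}+|||y'|||_{p\text{-var},[a,b]}|||\mathbb X|||_{q\text{-var},[a,b]}\Big),\qquad R^y_{s,t}=y_{s,t}-y'_sx_{s,t},$$ in all dimensions, for all $\frac1p$-Hölder rough paths $(x,\mathbb X)$ and all controlled paths $(y,y')$ with exponent $\frac1p$ for which the compensated Darboux sums converge to $\int_a^by\,dx$ as the mesh tends to $0$. 2. In the setting above, for all $m,d,\nu,f,g,\Delta,\mathbb P$, let $\mathfrak a^\Delta\in L^p$ be a stationary solution of the scheme with $$-\eta:=\mathbb E\,\ell(f,\mathfrak a^\Delta(\cdot))+\tfrac12L_f^2\Delta<0.$$ If for some $\lambda\in(0,\frac12)$ and $\gamma^*\in(0,1)$ $$\eta>KL_g\gamma^*\Big[\mathbb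 E N^*(\gamma^*,\mathbf x(\cdot),[0,1])+2\,\mathbb E N^*(\lambda,\mathcal S,[0,1])\Big],$$ then $\mathfrak a^\Delta$ is almost surely exponentially stable. -/

import Mathlib

open MeasureTheory Filter Topology Set
open scoped ENNReal

noncomputable section

/-- Euclidean space `ℝⁿ`. -/
abbrev Vec (n : ℕ) : Type := EuclideanSpace ℝ (Fin n)

/-- The projective tensor norm on `ℝᵐ ⊗ ℝᵐ` (2-tensors given by their coefficient arrays).  It is the
norm for which `L(ℝᵐ, L(ℝᵐ, W)) = L(ℝᵐ ⊗ ℝᵐ, W)` isometrically. -/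
def tensorNorm {m : ℕ} (A : Fin m → Fin m → ℝ) : ℝ :=
  sInf {c : ℝ | ∃ (n : ℕ) (a b : Fin n → Vec m),
    (∀ i j, A i j = ∑ k, a k i * b k j) ∧ c = ∑ k, ‖a k‖ * ‖b k‖}

/-- Action of a bilinear map `B ∈ L(ℝᵐ, L(ℝᵐ, W))` on a 2-tensor: the linear extension of
`a ⊗ b ↦ B a b`. -/
def tensorApply {m n : ℕ} (B : Vec m →L[ℝ] Vec m →L[ℝ] Vec n) (A : Fin m → Fin m → ℝ) : Vec n :=
  ∑ i, ∑ j, A i j • B (EuclideanSpace.single i 1) (EuclideanSpace.single j 1)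

/-- The group `T²₁(ℝᵐ) = 1 ⊕ ℝᵐ ⊕ (ℝᵐ ⊗ ℝᵐ)`. -/
@[ext]
structure T2 (m : ℕ) where
  vec : Vec m
  area : Fin m → Fin m → ℝ

namespace T2

variable {m : ℕ}

instance : One (T2 m) := ⟨⟨0, 0⟩⟩
instance : Mul (T2 m) :=
  ⟨fun g h => ⟨g.vec + h.vec, fun i j => g.vec i * h.vec j + g.area i j + h.area i j⟩⟩
instance : Inv (T2 m) := ⟨fun g => ⟨-g.vec, fun i j => g.vec i * g.vec j - g.area i j⟩⟩

@[simp] theorem one_vec : (1 : T2 m).vec = 0 := rfl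
@[simp] theorem one_area (i j : Fin m) : (1 : T2 m).area i j = 0 := rfl
@[simp] theorem mul_vec (g h : T2 m) : (g * h).vec = g.vec + h.vec := rfl
@[simp] theorem mul_area (g h : T2 m) (i j : Fin m) :
    (g * h).area i j = g.vec i * h.vec j + g.area i j + h.area i j := rfl
@[simp] theorem inv_vec (g : T2 m) : (g⁻¹).vec = -g.vec := rfl
@[simp] theorem inv_area (g : T2 m) (i j : Fin m) :
    (g⁻¹).area i j = g.vec i * g.vec j - g.area i j := rfl

instance : Group (T2 m) :=
  Group.ofLeftAxioms
    (fun a b c => by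
      ext
      · simp; ring
      · simp; ring)
    (fun a => by ext <;> simp)
    (fun a => by
      ext
      · simp
      · simp; ring)

end T2

/-- The increment `ω_s⁻¹ ⊗ ω_t = (1, x_{s,t}, 𝕏_{s,t})` of a path in `T²₁(ℝᵐ)`. -/
def incr {m : ℕ} (ω : ℝ → T2 m) (s t : ℝ) : T2 m := (ω s)⁻¹ * ω t

/-- `ω = (1, x, 𝕏)` is an `α`-Hölder rough path on `[a, b]` (Chen's relation is automatic). -/
def IsHolderOn {m : ℕ} (α a b : ℝ) (ω : ℝ → T2 m) : Prop :=
  ∃ C : ℝ, ∀ s t : ℝ, a ≤ s → s < t → t ≤ b →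
    ‖(incr ω s t).vec‖ ≤ C * (t - s) ^ α ∧
    tensorNorm (incr ω s t).area ≤ C * (t - s) ^ (2 * α)

/-- A smooth path in `T²₁(ℝᵐ)`. -/
def IsSmoothPath {m : ℕ} (ω : ℝ → T2 m) : Prop :=
  ContDiff ℝ ((⊤ : ℕ∞) : WithTop ℕ∞) (fun t => (ω t).vec) ∧ ∀ i j, ContDiff ℝ ((⊤ : ℕ∞) : WithTop ℕ∞) (fun t => (ω t).area i j)

/-- On `[a, b]` the path lies in the closure of the smooth paths for the `α`-Hölder metric. -/
def IsSmoothLimitOn {m : ℕ} (α a b : ℝ) (ω : ℝ → T2 m) : Prop :=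
  ∀ ε : ℝ, 0 < ε → ∃ h : ℝ → T2 m, IsSmoothPath h ∧
    ∀ s t : ℝ, a ≤ s → s < t → t ≤ b →
      ‖(incr ω s t).vec - (incr h s t).vec‖ ≤ ε * (t - s) ^ α ∧
      tensorNorm (fun i j => (incr ω s t).area i j - (incr h s t).area i j)
        ≤ ε * (t - s) ^ (2 * α)

/-- The canonical space `𝒞₀^{0,α}(ℝ, T²₁(ℝᵐ))` of rough paths started at the unit. -/
def PathSpace (m : ℕ) (α : ℝ) : Type :=
  {ω : ℝ → T2 m // ω 0 = 1 ∧
    ∀ T : ℝ, 0 < T → IsHolderOn α (-T) T ω ∧ IsSmoothLimitOn α (-T) T ω}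

/-- The `σ`-algebra on the canonical space generated by the evaluations. -/
instance (m : ℕ) (α : ℝ) : MeasurableSpace (PathSpace m α) :=
  MeasurableSpace.comap
    (fun (ω : PathSpace m α) (t : ℝ) => ((ω.1 t).vec, (ω.1 t).area)) inferInstance

theorem incr_shift {m : ℕ} (ω : ℝ → T2 m) (t s u : ℝ) :
    incr (fun r => (ω t)⁻¹ * ω (t + r)) s u = incr ω (t + s) (t + u) := by
  unfold incr
  group

/-- The Wiener-type shift `(θ_t ω)_s = ω_t⁻¹ ⊗ ω_{t+s}`. -/
def shift {m : ℕ} {α : ℝ} (t : ℝ) (ω : PathSpace m α) : PathSpace m α :=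
  ⟨fun s => (ω.1 t)⁻¹ * ω.1 (t + s), by simp, by
    intro T hT
    have h1 : t ≤ |t| := le_abs_self t
    have h2 : -|t| ≤ t := neg_abs_le t
    have hT' : 0 < T + |t| := by have := abs_nonneg t; linarith
    obtain ⟨⟨C, hC⟩, hS⟩ := ω.2.2 (T + |t|) hT'
    refine ⟨⟨C, fun s u hs hsu hu => ?_⟩, fun ε hε => ?_⟩
    · have := hC (t + s) (t + u) (by linarith) (by linarith) (by linarith)
      rw [incr_shift]
      rwa [show t + u - (t + s) = u - s by ring] at this
    · obtain ⟨h, ⟨hv, ha⟩, hh⟩ := hS ε hε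
      refine ⟨fun s => h (t + s),
        ⟨hv.comp (contDiff_const.add contDiff_id),
          fun i j => (ha i j).comp (contDiff_const.add contDiff_id)⟩, fun s u hs hsu hu => ?_⟩
      have := hh (t + s) (t + u) (by linarith) (by linarith) (by linarith)
      rw [incr_shift]
      rwa [show t + u - (t + s) = u - s by ring] at this⟩

/-- `sup ∑ᵢ F(uᵢ, uᵢ₊₁)^r` over all finite nondecreasing sequences in `S`: the `r`-th power of the
`r`-variation of `F` on `S` (for `S = [a,b]`, or `S` a part of a grid). -/
def varPow (r : ℝ) (S : Set ℝ) (F : ℝ → ℝ → ℝ) : ℝ≥0∞ :=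
  ⨆ (n : ℕ) (u : ℕ → ℝ) (_ : Monotone u ∧ ∀ i, u i ∈ S),
    ∑ i ∈ Finset.range n, ENNReal.ofReal (F (u i) (u (i + 1)) ^ r)

/-- `|||x|||_{p-var,S}^p`. -/
def xVarPow {m : ℕ} (p : ℝ) (S : Set ℝ) (ω : ℝ → T2 m) : ℝ≥0∞ :=
  varPow p S (fun s t => ‖(incr ω s t).vec‖)

/-- `|||𝕏|||_{q-var,S}^q` with `q = p/2`. -/
def areaVarPow {m : ℕ} (p : ℝ) (S : Set ℝ) (ω : ℝ → T2 m) : ℝ≥0∞ :=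
  varPow (p / 2) S (fun s t => tensorNorm (incr ω s t).area)

/-- `|||𝐱|||_{p-var,[s,t]} = (|||x|||_{p-var}^p + |||𝕏|||_{q-var}^q)^{1/p}`. -/
def roughVar {m : ℕ} (p : ℝ) (ω : ℝ → T2 m) (s t : ℝ) : ℝ≥0∞ :=
  (xVarPow p (Icc s t) ω + areaVarPow p (Icc s t) ω) ^ (1 / p)

/-- `I` is the rough integral `∫_a^b y dx`: the limit of the compensated Darboux sums along
partitions of `[a, b]` with mesh tending to `0`. -/
def IsRoughIntegral {m n : ℕ} (ω : ℝ → T2 m) (y : ℝ → Vec m →L[ℝ] Vec n)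
    (y' : ℝ → Vec m →L[ℝ] Vec m →L[ℝ] Vec n) (a b : ℝ) (I : Vec n) : Prop :=
  ∀ ε : ℝ, 0 < ε → ∃ δ : ℝ, 0 < δ ∧ ∀ (N : ℕ) (u : ℕ → ℝ), Monotone u → u 0 = a → u N = b →
    (∀ i < N, u (i + 1) - u i < δ) →
    ‖∑ i ∈ Finset.range N, (y (u i) (incr ω (u i) (u (i + 1))).vec
        + tensorApply (y' (u i)) (incr ω (u i) (u (i + 1))).area) - I‖ < ε

/-- The remainder `R^y_{s,t} = y_{s,t} - y'_s x_{s,t}` of a controlled path. -/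
def remainder {m n : ℕ} (ω : ℝ → T2 m) (y : ℝ → Vec m →L[ℝ] Vec n)
    (y' : ℝ → Vec m →L[ℝ] Vec m →L[ℝ] Vec n) (s t : ℝ) : Vec m →L[ℝ] Vec n :=
  y t - y s - y' s (incr ω s t).vec

/-- `(y, y')` is controlled by the path component of `ω` on `[a, b]`, with exponent `α`. -/
def IsControlled {m n : ℕ} (α : ℝ) (ω : ℝ → T2 m) (y : ℝ → Vec m →L[ℝ] Vec n)
    (y' : ℝ → Vec m →L[ℝ] Vec m →L[ℝ] Vec n) (a b : ℝ) : Prop :=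
  ∃ C : ℝ, ∀ s t : ℝ, a ≤ s → s < t → t ≤ b →
    ‖y t - y s‖ ≤ C * (t - s) ^ α ∧ ‖y' t - y' s‖ ≤ C * (t - s) ^ α ∧
    ‖remainder ω y y' s t‖ ≤ C * (t - s) ^ (2 * α)

/-- `C` is an admissible constant in the rough integral estimate
`‖∫_a^b y dx - y_a x_{a,b} - y'_a 𝕏_{a,b}‖
  ≤ C (|||x|||_{p-var} |||R^y|||_{q-var} + |||y'|||_{p-var} |||𝕏|||_{q-var})`,
uniformly over all `1/p`-Hölder rough paths and all controlled paths. -/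
def IsRoughIntegralConstant (p C : ℝ) : Prop :=
  ∀ (m n : ℕ) (ω : ℝ → T2 m) (y : ℝ → Vec m →L[ℝ] Vec n)
    (y' : ℝ → Vec m →L[ℝ] Vec m →L[ℝ] Vec n) (a b : ℝ) (I : Vec n),
    a ≤ b → IsHolderOn (1 / p) a b ω → IsControlled (1 / p) ω y y' a b →
    IsRoughIntegral ω y y' a b I →
    ENNReal.ofReal ‖I - y a (incr ω a b).vec - tensorApply (y' a) (incr ω a b).area‖
      ≤ ENNReal.ofReal C *
        (xVarPow p (Icc a b) ω ^ (1 / p)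
            * varPow (p / 2) (Icc a b) (fun s t => ‖remainder ω y y' s t‖) ^ (2 / p)
          + varPow p (Icc a b) (fun s t => ‖y' t - y' s‖) ^ (1 / p)
            * areaVarPow p (Icc a b) ω ^ (2 / p))

/-- Greedy stopping times on `[a, b]` at level `γ` for a functional `c s t` of the interval `[s, t]`:
`τ₀ = a`, `τᵢ₊₁ = inf {t > τᵢ : c τᵢ t ≥ γ} ∧ b`.  For `c` continuous in `t` this is the first
time at which `c τᵢ t = γ`; with `≥` it also makes sense for functionals sampled on a grid, which
may jump over the level. -/
def greedyTime (c : ℝ → ℝ → ℝ≥0∞) (γ a b : ℝ) : ℕ → ℝ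
  | 0 => a
  | i + 1 => sInf ({t : ℝ | greedyTime c γ a b i < t ∧
      ENNReal.ofReal γ ≤ c (greedyTime c γ a b i) t} ∪ {b})

/-- `N* = sup {i : τᵢ < b} + 1`. -/
def greedyCount (c : ℝ → ℝ → ℝ≥0∞) (γ a b : ℝ) : ℝ≥0∞ :=
  ⨆ (i : ℕ) (_ : greedyTime c γ a b i < b), ((i : ℝ≥0∞) + 1)

/-- The regular grid `Π = {kΔ : k ∈ ℕ}`. -/
def grid (Δ : ℝ) : Set ℝ := Set.range (fun k : ℕ => (k : ℝ) * Δ)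

/-- `‖D^k F‖_∞`. -/
def supDeriv {d : ℕ} {W : Type*} [NormedAddCommGroup W] [NormedSpace ℝ W] (k : ℕ)
    (F : Vec d → W) : ℝ :=
  ⨆ y, ‖iteratedFDeriv ℝ k F y‖

/-- `F ∈ C³_b`. -/
def IsC3b {d : ℕ} {W : Type*} [NormedAddCommGroup W] [NormedSpace ℝ W] (F : Vec d → W) : Prop :=
  ContDiff ℝ 3 F ∧ ∀ k ≤ 3, BddAbove (Set.range fun y => ‖iteratedFDeriv ℝ k F y‖)

/-- `L_f = ‖Df‖_∞`. -/
def Lf {d : ℕ} (f : Vec d → Vec d) : ℝ := ⨆ y, ‖fderiv ℝ f y‖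

/-- The size `L_g` of the diffusion coefficient. -/
def Lg {d m : ℕ} (g : Vec d → Vec m →L[ℝ] Vec d) : ℝ :=
  max (max (supDeriv 1 g) (supDeriv 2 g))
    (max ((supDeriv 0 g * max (supDeriv 1 g) (max (supDeriv 2 g) (supDeriv 3 g))) ^ (1 / 2 : ℝ))
      ((supDeriv 0 g ^ 2 * supDeriv 3 g) ^ (1 / 3 : ℝ)))

/-- `ℓ(f, y, r) = sup_{0 < ‖z - y‖ < r} ⟨(z - y)/‖z - y‖, (f z - f y)/‖z - y‖⟩`. -/
def ellRadius {d : ℕ} (f : Vec d → Vec d) (y : Vec d) (r : ℝ) : ℝ :=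
  ⨆ z : {z : Vec d // 0 < ‖z - y‖ ∧ ‖z - y‖ < r},
    inner ℝ (‖z.1 - y‖⁻¹ • (z.1 - y)) (‖z.1 - y‖⁻¹ • (f z.1 - f y))

/-- The local one-sided Lipschitz constant `ℓ(f, y) = lim_{r ↓ 0} ℓ(f, y, r)`. -/
def ell {d : ℕ} (f : Vec d → Vec d) (y : Vec d) : ℝ :=
  limUnder (𝓝[>] (0 : ℝ)) (ellRadius f y)

/-- The solution of the discretization scheme started at `y₀`; the value at `k` is `y^Δ_{kΔ}`:
`y_{k+1} = y_k + f(y_k) Δ + g(y_k) x_{t_k,t_{k+1}} + Dg(y_k) g(y_k) 𝕏_{t_k,t_{k+1}}`. -/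
def scheme {d m : ℕ} (f : Vec d → Vec d) (g : Vec d → Vec m →L[ℝ] Vec d) (Δ : ℝ)
    (ω : ℝ → T2 m) (y₀ : Vec d) : ℕ → Vec d
  | 0 => y₀
  | k + 1 =>
    let y := scheme f g Δ ω y₀ k
    let e := incr ω ((k : ℝ) * Δ) (((k + 1 : ℕ) : ℝ) * Δ)
    y + Δ • f y + g y e.vec + tensorApply ((fderiv ℝ g y).comp (g y)) e.area

/-- The assumption on the driving noise, for its law `P` on the canonical space: stationary
increments (invariance under the shift) and the moment condition with exponents `p` and `q = p/2`. -/
structure IsNoiseLaw {m : ℕ} {α : ℝ} (p ν : ℝ) (P : Measure (PathSpace m α)) : Prop where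
  isProbability : IsProbabilityMeasure P
  stationary : ∀ t : ℝ, MeasurePreserving (shift t) P P
  moments : ∀ T : ℝ, 0 < T → ∃ C : ℝ, ∀ s t : ℝ, 0 ≤ s → s ≤ t → t ≤ T →
    ∫⁻ ω, ENNReal.ofReal
        (‖(incr ω.1 s t).vec‖ ^ p + tensorNorm (incr ω.1 s t).area ^ (p / 2)) ∂P
      ≤ ENNReal.ofReal (C * (t - s) ^ (p * ν))

/-- A random point `a` whose orbit `a(θ_t ω)`, `t ∈ Π`, solves the scheme. -/
def IsStationarySolution {d m : ℕ} {α : ℝ} (P : Measure (PathSpace m α)) (f : Vec d → Vec d)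
    (g : Vec d → Vec m →L[ℝ] Vec d) (Δ : ℝ) (a : PathSpace m α → Vec d) : Prop :=
  Measurable a ∧
    ∀ᵐ ω ∂P, ∀ k : ℕ, a (shift ((k : ℝ) * Δ) ω) = scheme f g Δ ω.1 (a ω) k

/-- Lyapunov stability of the stationary solution, almost surely, on the time set `Π`. -/
def IsStable {d m : ℕ} {α : ℝ} (P : Measure (PathSpace m α)) (f : Vec d → Vec d)
    (g : Vec d → Vec m →L[ℝ] Vec d) (Δ : ℝ) (a : PathSpace m α → Vec d) : Prop :=
  ∀ ε : ℝ, 0 < ε → ∃ r : PathSpace m α → ℝ, Measurable r ∧ (∀ ω, 0 < r ω) ∧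
    ∀ᵐ ω ∂P, ∀ y₀ : Vec d, ‖y₀ - a ω‖ < r ω →
      (⨆ k : ℕ, ENNReal.ofReal ‖scheme f g Δ ω.1 y₀ k - a (shift ((k : ℝ) * Δ) ω)‖)
        < ENNReal.ofReal ε

/-- Exponential stability of the stationary solution, almost surely, on the time set `Π`. -/
def IsExponentiallyStable {d m : ℕ} {α : ℝ} (P : Measure (PathSpace m α)) (f : Vec d → Vec d)
    (g : Vec d → Vec m →L[ℝ] Vec d) (Δ : ℝ) (a : PathSpace m α → Vec d) : Prop :=
  IsStable P f g Δ a ∧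
  ∃ r A : PathSpace m α → ℝ, ∃ μ : ℝ,
    Measurable r ∧ (∀ ω, 0 < r ω) ∧ Measurable A ∧ (∀ ω, 0 < A ω) ∧ 0 < μ ∧
    ∀ᵐ ω ∂P, ∀ y₀ : Vec d, ‖y₀ - a ω‖ < r ω → ∀ k : ℕ,
      ‖scheme f g Δ ω.1 y₀ k - a (shift ((k : ℝ) * Δ) ω)‖
        ≤ A ω * Real.exp (-μ * ((k : ℝ) * Δ))

/-- The functional `∑_{w ∈ 𝒮} w_{s,t}^{β_w}` of the family `𝒮 = {w⁽¹⁾, w⁽²⁾, w⁽³⁾, w⁽⁴⁾}`, with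
`w⁽¹⁾ = L_f (t-s)`, `β₁ = 1`;
`w⁽²⁾ = (4C_p+1)^p L_g^p |||x|||^p_{p-var,Π[s,t]}`, `β₂ = 1/p`;
`w⁽³⁾ = (4C_p+1)^p L_g^p |||𝕏|||^q_{q-var,Π[s,t]}`, `β₃ = 1/q = 2/p`;
`w⁽⁴⁾ = 2 lam ‖f(a)‖_{∞,Π[s,t]} (t-s)`, `β₄ = 1`. -/
def controlSum {d m : ℕ} {α : ℝ} (p Cp lam : ℝ) (f : Vec d → Vec d)
    (g : Vec d → Vec m →L[ℝ] Vec d) (Δ : ℝ) (a : PathSpace m α → Vec d) (ω : PathSpace m α)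
    (s t : ℝ) : ℝ≥0∞ :=
  let grd : Set ℝ := grid Δ ∩ Icc s t
  let κ : ℝ≥0∞ := ENNReal.ofReal ((4 * Cp + 1) ^ p * Lg g ^ p)
  ENNReal.ofReal (Lf f * (t - s))
    + (κ * xVarPow p grd ω.1) ^ (1 / p)
    + (κ * areaVarPow p grd ω.1) ^ (2 / p)
    + ENNReal.ofReal (2 * lam) * (⨆ u ∈ grd, ENNReal.ofReal ‖f (a (shift u ω))‖)
        * ENNReal.ofReal (t - s)

/-- `K = 5 (1+lam) (1+2C_p)² e^{12 lam + 2 lam²} ∨ (3/2) e^{6 L_f Δ}`. -/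
def Kconst (Cp lam L Δ : ℝ) : ℝ :=
  max (5 * (1 + lam) * (1 + 2 * Cp) ^ 2 * Real.exp (12 * lam + 2 * lam ^ 2))
    (3 / 2 * Real.exp (6 * L * Δ))

end

/-! ### Discrete sewing -/

noncomputable section

/-! Everything rests on a discrete sewing lemma: a two-index family whose defect over a triple is at
most A·V^θ, with V superadditive and θ > 1, differs from the sum of its one-step values by at most a
constant times A·V^θ. Applied to the compensated germ y·x + y'·𝕏, whose defect has exponent 3/p by
Chen's relation, it gives the rough integral estimate uniformly over partitions.

For stability, let z be the difference of an orbit and the stationary orbit. On a stretch of the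
grid where both the control sum and the rough variation stay below their levels, the noise scaled by
`Lg g` has small size κ ≤ `Lg g` γ. Sewing the equations for the stationary orbit and for z
(`remainder_le_of_scheme`, `scheme_sub_le`) shows that z moves with the drift up to an error
O(κ)‖z₀‖. A drift step expands z by at most the exponential of Δ·ℓ + L_f²Δ²/2, by expanding the
square of the norm; thus a stretch contributes its drift rates plus O(`Lg g` γ) to the exponent
(`good_block_le`).

Time is cut into blocks of M steps, of length between 1/2 and 1, and each block into such stretches.
The single step at which a level is crossed need not be small, but its size is at most γ(2n+1) if it
contains n non-overlapping intervals of variation at least γ. Every cut is thus charged to bad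
intervals (`block_le`). The number of bad intervals is at most the greedy count and, with end points
in a countable set, measurable. As K is at least four times the cost of a bad interval, the mean
cost per block is below η/2, while the mean drift over a block is at most -η/2 up to an error that
vanishes with the radius of linearisation.

So the growth exponent of a block has negative mean. Only the shift by Δ is ergodic, not its M-th
power, so the block bounds are averaged geometrically over all M offsets (`le_mul_exp_average`).
Birkhoff sums of negative mean are almost surely bounded above, and remain so after a small linear
term is added. This gives exponential decay, and an induction on time keeps the orbit inside the
radius where the local estimates hold (`orbit_decay`). -/

theorem exists_switch {P : ℕ → Prop} {j M : ℕ} (hj : P j) (hjM : j ≤ M) :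
    P M ∨ ∃ k, j ≤ k ∧ k < M ∧ P k ∧ ¬ P (k + 1) := by
  induction M, hjM using Nat.le_induction with
  | base => exact Or.inl hj
  | succ M hM ih =>
    rcases ih with h | ⟨k, h1, h2, h3, h4⟩
    · by_cases h' : P (M + 1)
      · exact Or.inl h'
      · exact Or.inr ⟨M, hM, by omega, h, h'⟩
    · exact Or.inr ⟨k, h1, by omega, h3, h4⟩

/-- The constant of the discrete sewing lemma. -/
def sewConst (θ : ℝ) : ℝ := 2 / (1 - 2 ^ (1 - θ))

theorem two_rpow_one_sub_lt {θ : ℝ} (hθ : 1 < θ) : (2 : ℝ) ^ (1 - θ) < 1 :=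
  Real.rpow_lt_one_of_one_lt_of_neg (by norm_num) (by linarith)

theorem sewConst_pos {θ : ℝ} (hθ : 1 < θ) : 0 < sewConst θ :=
  div_pos two_pos (by linarith [two_rpow_one_sub_lt hθ])

/-- The constant is the fixed point of C = 2 + 2^(1-θ) C: an interval is split at the cost of two
defects, and each of the two remaining parts carries at most half of the control. -/
theorem sewConst_eq {θ : ℝ} (hθ : 1 < θ) :
    2 + sewConst θ * 2 ^ (1 - θ) = sewConst θ := by
  have h := two_rpow_one_sub_lt hθ
  have : (1 - (2 : ℝ) ^ (1 - θ)) ≠ 0 := by linarith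
  unfold sewConst
  field_simp
  ring

theorem two_le_sewConst {θ : ℝ} (hθ : 1 < θ) : 2 ≤ sewConst θ := by
  have h1 := sewConst_eq hθ
  have h2 : 0 ≤ sewConst θ * 2 ^ (1 - θ) :=
    mul_nonneg (sewConst_pos hθ).le (Real.rpow_nonneg (by norm_num) _)
  linarith

/-- The discrete sewing lemma. -/
theorem discrete_sewing {E : Type*} [NormedAddCommGroup E] {θ A : ℝ} (hθ : 1 < θ) (hA : 0 ≤ A)
    {Ξ : ℕ → ℕ → E} {V : ℕ → ℕ → ℝ} {n : ℕ} (hV : ∀ i j, 0 ≤ V i j)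
    (hsup : ∀ i j k, i ≤ j → j ≤ k → k ≤ n → V i j + V j k ≤ V i k)
    (hΞ : ∀ i, i ≤ n → Ξ i i = 0)
    (hδ : ∀ i j k, i ≤ j → j < k → k ≤ n → ‖Ξ i k - Ξ i j - Ξ j k‖ ≤ A * V i k ^ θ) :
    ∀ j k, j ≤ k → k ≤ n →
      ‖Ξ j k - ∑ i ∈ Finset.Ico j k, Ξ i (i + 1)‖ ≤ sewConst θ * (A * V j k ^ θ) := by
  intro j k hjk hkn
  induction hN : k - j using Nat.strong_induction_on generalizing j k with
  | _ N ih =>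
  have hC := two_le_sewConst hθ
  have hVθ : 0 ≤ A * V j k ^ θ := mul_nonneg hA (Real.rpow_nonneg (hV _ _) _)
  have hdiag : ∀ i, i ≤ n → V i i = 0 := fun i hi => by
    have := hsup i i i le_rfl le_rfl hi
    linarith [hV i i]
  rcases hjk.eq_or_lt with rfl | hlt
  · simp only [Finset.Ico_self, Finset.sum_empty, sub_zero, hΞ j hkn, norm_zero]
    nlinarith
  -- The step from m to m+1 crosses the midpoint of the control; superadditivity bounds what remains
  -- to its right. If no step before k crosses it, m = k - 1 works because V vanishes on the
  -- diagonal.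
  · obtain ⟨m, hjm, hmk, hm1, hm2⟩ : ∃ m, j ≤ m ∧ m < k ∧ V j m ≤ V j k / 2 ∧
        V (m + 1) k ≤ V j k / 2 := by
      have h0 : V j j ≤ V j k / 2 := by
        rw [hdiag j (by omega)]; linarith [hV j k]
      rcases exists_switch (P := fun m => V j m ≤ V j k / 2) (M := k - 1) h0 (by omega) with
        h | ⟨m, h1, h2, h3, h4⟩
      · refine ⟨k - 1, by omega, by omega, h, ?_⟩
        rw [Nat.sub_add_cancel (by omega), hdiag k hkn]; linarith [hV j k]
      · refine ⟨m, h1, by omega, h3, ?_⟩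
        have := hsup j (m + 1) k (by omega) (by omega) hkn
        simp only [not_le] at h4
        linarith
    have e1 := hδ j m k hjm hmk hkn
    have e2 : ‖Ξ m k - Ξ m (m + 1) - Ξ (m + 1) k‖ ≤ A * V m k ^ θ := by
      -- The defect hypothesis excludes an empty right part, so m + 1 = k is treated separately.
      rcases (show m + 1 ≤ k from hmk).eq_or_lt with h | h
      · rw [← h, sub_self, hΞ _ (by omega), sub_zero, norm_zero]
        exact mul_nonneg hA (Real.rpow_nonneg (hV _ _) _)
      · exact hδ m (m + 1) k (by omega) h hkn
    have e3 := ih (m - j) (by omega) j m hjm (by omega) rfl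
    have e4 := ih (k - (m + 1)) (by omega) (m + 1) k (by omega) hkn rfl
    have hmono : V m k ≤ V j k := by
      have := hsup j m k hjm hmk.le hkn
      linarith [hV j m]
    have hθ0 : 0 ≤ θ := by linarith
    have e2' : A * V m k ^ θ ≤ A * V j k ^ θ :=
      mul_le_mul_of_nonneg_left (Real.rpow_le_rpow (hV _ _) hmono hθ0) hA
    have hhalf : ∀ v, 0 ≤ v → v ≤ V j k / 2 →
        sewConst θ * (A * v ^ θ) ≤ sewConst θ * 2 ^ (1 - θ) / 2 * (A * V j k ^ θ) := by
      intro v hv hle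
      have h1 : v ^ θ ≤ 2 ^ (1 - θ) / 2 * V j k ^ θ := by
        calc v ^ θ ≤ (V j k / 2) ^ θ := Real.rpow_le_rpow hv hle hθ0
          _ = V j k ^ θ / 2 ^ θ := Real.div_rpow (hV _ _) (by norm_num) _
          _ = 2 ^ (1 - θ) / 2 * V j k ^ θ := by
            rw [Real.rpow_sub two_pos, Real.rpow_one]
            field_simp
      calc sewConst θ * (A * v ^ θ) ≤ sewConst θ * (A * (2 ^ (1 - θ) / 2 * V j k ^ θ)) := by
            gcongr
        _ = _ := by ring
    have e3' := e3.trans (hhalf _ (hV _ _) hm1)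
    have e4' := e4.trans (hhalf _ (hV _ _) hm2)
    have hsum : ∑ i ∈ Finset.Ico j k, Ξ i (i + 1) = ∑ i ∈ Finset.Ico j m, Ξ i (i + 1) +
        (Ξ m (m + 1) + ∑ i ∈ Finset.Ico (m + 1) k, Ξ i (i + 1)) := by
      rw [← Finset.sum_Ico_consecutive _ hjm hmk.le,
        Finset.sum_eq_sum_Ico_succ_bot hmk fun i => Ξ i (i + 1)]
    have hid : Ξ j k - ∑ i ∈ Finset.Ico j k, Ξ i (i + 1) =
        ((Ξ j k - Ξ j m - Ξ m k) + (Ξ m k - Ξ m (m + 1) - Ξ (m + 1) k)) +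
        ((Ξ j m - ∑ i ∈ Finset.Ico j m, Ξ i (i + 1)) +
          (Ξ (m + 1) k - ∑ i ∈ Finset.Ico (m + 1) k, Ξ i (i + 1))) := by
      rw [hsum]; abel
    rw [hid]
    have hC' := sewConst_eq hθ
    calc _ ≤ (A * V j k ^ θ + A * V j k ^ θ) +
          (sewConst θ * 2 ^ (1 - θ) / 2 * (A * V j k ^ θ) +
            sewConst θ * 2 ^ (1 - θ) / 2 * (A * V j k ^ θ)) :=
          norm_add_le_of_le (norm_add_le_of_le e1 (e2.trans e2')) (norm_add_le_of_le e3' e4')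
      _ = (2 + sewConst θ * 2 ^ (1 - θ)) * (A * V j k ^ θ) := by ring
      _ = _ := by rw [hC']

/-! ### The projective tensor norm and its pairing with bilinear maps -/

section Tensor

variable {m n : ℕ}

theorem tensorNorm_le_of_decomposition {ι : Type*} [Fintype ι] (A : Fin m → Fin m → ℝ)
    (a b : ι → Vec m) (h : ∀ i j, A i j = ∑ k, a k i * b k j) :
    tensorNorm A ≤ ∑ k, ‖a k‖ * ‖b k‖ := by
  refine csInf_le ⟨0, ?_⟩ ?_
  · rintro c ⟨n, a, b, -, rfl⟩
    positivity
  · let e := (Fintype.equivFin ι).symm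
    refine ⟨Fintype.card ι, a ∘ e, b ∘ e, fun i j => ?_, ?_⟩
    · rw [h, ← e.sum_comp]; rfl
    · rw [← e.sum_comp]; rfl

theorem basis_decomposition (A : Fin m → Fin m → ℝ) (i j : Fin m) :
    A i j = ∑ k : Fin m × Fin m, (EuclideanSpace.single k.1 (A k.1 k.2) : Vec m) i *
      (EuclideanSpace.single k.2 1 : Vec m) j := by
  rw [Fintype.sum_prod_type, Finset.sum_eq_single i, Finset.sum_eq_single j]
  · simp
  · intro b _ hb; simp [hb.symm]
  · simp
  · intro b _ hb; simp [hb.symm]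
  · simp

theorem tensorNorm_le_sum (A : Fin m → Fin m → ℝ) : tensorNorm A ≤ ∑ i, ∑ j, |A i j| := by
  refine (tensorNorm_le_of_decomposition A _ _ (basis_decomposition A)).trans ?_
  rw [Fintype.sum_prod_type]
  simp

theorem tensorNorm_nonneg (A : Fin m → Fin m → ℝ) : 0 ≤ tensorNorm A := by
  refine Real.sInf_nonneg ?_
  rintro c ⟨n, a, b, -, rfl⟩
  positivity

theorem exists_decomposition_lt (A : Fin m → Fin m → ℝ) {ε : ℝ} (hε : 0 < ε) :
    ∃ (n : ℕ) (a b : Fin n → Vec m), (∀ i j, A i j = ∑ k, a k i * b k j) ∧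
      ∑ k, ‖a k‖ * ‖b k‖ < tensorNorm A + ε := by
  have hne : {c : ℝ | ∃ (n : ℕ) (a b : Fin n → Vec m),
      (∀ i j, A i j = ∑ k, a k i * b k j) ∧ c = ∑ k, ‖a k‖ * ‖b k‖}.Nonempty := by
    let e := (Fintype.equivFin (Fin m × Fin m)).symm
    refine ⟨_, Fintype.card (Fin m × Fin m), fun k => EuclideanSpace.single (e k).1 (A (e k).1 (e k).2),
      fun k => EuclideanSpace.single (e k).2 1, fun i j => ?_, rfl⟩
    · rw [basis_decomposition A i j, ← e.sum_comp]
  obtain ⟨c, ⟨n, a, b, h, rfl⟩, hc⟩ := exists_lt_of_csInf_lt hne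
    (lt_add_of_pos_right (tensorNorm A) hε)
  exact ⟨n, a, b, h, hc⟩

theorem tensorNorm_zero : tensorNorm (0 : Fin m → Fin m → ℝ) = 0 :=
  le_antisymm ((tensorNorm_le_sum 0).trans (by simp)) (tensorNorm_nonneg _)

theorem tensorNorm_add_le (A B : Fin m → Fin m → ℝ) :
    tensorNorm (A + B) ≤ tensorNorm A + tensorNorm B := by
  refine le_of_forall_pos_le_add fun ε hε => ?_
  obtain ⟨k, a, b, h, hc⟩ := exists_decomposition_lt A (half_pos hε)
  obtain ⟨k', a', b', h', hc'⟩ := exists_decomposition_lt B (half_pos hε)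
  have := tensorNorm_le_of_decomposition (A + B) (Sum.elim a a') (Sum.elim b b') (fun i j => by
    simp [h, h'])
  simp only [Fintype.sum_sum_type, Sum.elim_inl, Sum.elim_inr] at this
  linarith

theorem tensorNorm_smul_le (c : ℝ) (A : Fin m → Fin m → ℝ) :
    tensorNorm (c • A) ≤ |c| * tensorNorm A := by
  refine le_of_forall_pos_le_add fun ε hε => ?_
  have hε' : 0 < ε / (|c| + 1) := by positivity
  obtain ⟨k, a, b, h, hc⟩ := exists_decomposition_lt A hε'
  have := tensorNorm_le_of_decomposition (c • A) (fun k => c • a k) b (fun i j => by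
    simp [h, Finset.mul_sum, mul_assoc])
  refine this.trans ?_
  simp only [norm_smul, Real.norm_eq_abs, mul_assoc, ← Finset.mul_sum]
  calc |c| * ∑ k, ‖a k‖ * ‖b k‖ ≤ |c| * (tensorNorm A + ε / (|c| + 1)) := by gcongr
    _ = |c| * tensorNorm A + |c| * (ε / (|c| + 1)) := by ring
    _ ≤ |c| * tensorNorm A + (|c| + 1) * (ε / (|c| + 1)) := by gcongr; linarith
    _ = _ := by rw [mul_div_cancel₀]; positivity

theorem tensorNorm_outer_le (x y : Vec m) : tensorNorm (fun i j => x i * y j) ≤ ‖x‖ * ‖y‖ := by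
  have := tensorNorm_le_of_decomposition (fun i j => x i * y j) (fun _ : Unit => x)
    (fun _ => y) (fun i j => by simp)
  simpa using this

/-- Subadditivity reduces continuity to a bound by the sum of the absolute coefficients. It serves
the measurability of the area variation. -/
theorem continuous_tensorNorm : Continuous (tensorNorm : (Fin m → Fin m → ℝ) → ℝ) := by
  have h0 : ∀ A B : Fin m → Fin m → ℝ,
      tensorNorm A - tensorNorm B ≤ ∑ i, ∑ j, |A i j - B i j| := fun A B => by
    have h1 := tensorNorm_add_le (A - B) B
    rw [sub_add_cancel] at h1
    have h2 := tensorNorm_le_sum (A - B)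
    simp only [Pi.sub_apply] at h2
    linarith
  refine continuous_iff_continuousAt.2 fun B => ?_
  have hlim : Tendsto (fun A : Fin m → Fin m → ℝ => ∑ i, ∑ j, |A i j - B i j|) (𝓝 B) (𝓝 0) := by
    have hc : Continuous fun A : Fin m → Fin m → ℝ => ∑ i, ∑ j, |A i j - B i j| := by fun_prop
    simpa using hc.tendsto B
  refine tendsto_iff_dist_tendsto_zero.2 (squeeze_zero (fun _ => dist_nonneg) (fun A => ?_) hlim)
  rw [Real.dist_eq, abs_le]
  have h1 := h0 A B
  have h2 := h0 B A
  simp only [abs_sub_comm (B _ _)] at h2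
  constructor <;> linarith

theorem tensorApply_eq_sum (B : Vec m →L[ℝ] Vec m →L[ℝ] Vec n) {ι : Type*} [Fintype ι]
    {A : Fin m → Fin m → ℝ} {a b : ι → Vec m} (h : ∀ i j, A i j = ∑ k, a k i * b k j) :
    tensorApply B A = ∑ k, B (a k) (b k) := by
  have hB : ∀ x y : Vec m, B x y = ∑ i, ∑ j, (x i * y j) •
      B (EuclideanSpace.single i 1) (EuclideanSpace.single j 1) := by
    intro x y
    have hx : ∀ x : Vec m, x = ∑ i, x i • (EuclideanSpace.single i 1 : Vec m) := fun x => by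
      ext i
      simp [Finset.sum_apply, Pi.single_apply]
    conv_lhs => rw [hx x, hx y]
    simp only [map_sum, map_smul, sum_apply, smul_apply,
      Finset.smul_sum, smul_smul]
    rw [Finset.sum_comm]
    simp only [mul_comm]
  rw [Finset.sum_congr rfl fun k _ => hB (a k) (b k)]
  simp only [tensorApply, h, Finset.sum_smul]
  rw [Finset.sum_comm (s := (Finset.univ : Finset ι))]
  refine Finset.sum_congr rfl fun i _ => ?_
  rw [Finset.sum_comm]

/-- The bound is immediate for each decomposition into elementary tensors, and the projective norm
is the infimum over these. -/
theorem norm_tensorApply_le (B : Vec m →L[ℝ] Vec m →L[ℝ] Vec n) (A : Fin m → Fin m → ℝ) :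
    ‖tensorApply B A‖ ≤ ‖B‖ * tensorNorm A := by
  refine le_of_forall_pos_le_add fun ε hε => ?_
  have hε' : 0 < ε / (‖B‖ + 1) := by positivity
  obtain ⟨k, a, b, h, hc⟩ := exists_decomposition_lt A hε'
  rw [tensorApply_eq_sum B h]
  calc ‖∑ k, B (a k) (b k)‖ ≤ ∑ k, ‖B‖ * (‖a k‖ * ‖b k‖) :=
        norm_sum_le_of_le _ fun k _ => (B.le_opNorm₂ _ _).trans_eq (mul_assoc _ _ _)
    _ = ‖B‖ * ∑ k, ‖a k‖ * ‖b k‖ := by rw [Finset.mul_sum]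
    _ ≤ ‖B‖ * (tensorNorm A + ε / (‖B‖ + 1)) := by gcongr
    _ = ‖B‖ * tensorNorm A + ‖B‖ * (ε / (‖B‖ + 1)) := by ring
    _ ≤ ‖B‖ * tensorNorm A + (‖B‖ + 1) * (ε / (‖B‖ + 1)) := by gcongr; linarith
    _ = _ := by rw [mul_div_cancel₀]; positivity

theorem tensorApply_add (B : Vec m →L[ℝ] Vec m →L[ℝ] Vec n) (A A' : Fin m → Fin m → ℝ) :
    tensorApply B (A + A') = tensorApply B A + tensorApply B A' := by
  simp [tensorApply, add_smul, Finset.sum_add_distrib]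

theorem tensorApply_smul (B : Vec m →L[ℝ] Vec m →L[ℝ] Vec n) (c : ℝ) (A : Fin m → Fin m → ℝ) :
    tensorApply B (c • A) = c • tensorApply B A := by
  simp [tensorApply, Finset.smul_sum, smul_smul]

theorem tensorApply_sub_left (B B' : Vec m →L[ℝ] Vec m →L[ℝ] Vec n) (A : Fin m → Fin m → ℝ) :
    tensorApply (B - B') A = tensorApply B A - tensorApply B' A := by
  simp [tensorApply, smul_sub, Finset.sum_sub_distrib]

theorem tensorApply_smul_left (B : Vec m →L[ℝ] Vec m →L[ℝ] Vec n) (c : ℝ)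
    (A : Fin m → Fin m → ℝ) : tensorApply (c • B) A = c • tensorApply B A := by
  simp only [tensorApply, Finset.smul_sum, smul_apply]
  simp only [smul_comm c]

theorem tensorApply_outer (B : Vec m →L[ℝ] Vec m →L[ℝ] Vec n) (x y : Vec m) :
    tensorApply B (fun i j => x i * y j) = B x y := by
  rw [tensorApply_eq_sum (ι := Unit) B (a := fun _ => x) (b := fun _ => y) (by simp)]
  simp

end Tensor

/-- The cross term x ⊗ x' in Chen's relation is what turns the increment B' - B into the remainder
B' - B - D x, which is of second order. Hence the defect has order three in the noise. -/
theorem germ_defect_eq {m n : ℕ} (B B' : Vec m →L[ℝ] Vec n) (D D' : Vec m →L[ℝ] Vec m →L[ℝ] Vec n)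
    (x x' : Vec m) (A A' : Fin m → Fin m → ℝ) :
    (B (x + x') + tensorApply D ((fun i j => x i * x' j) + A + A')) - (B x + tensorApply D A) -
      (B' x' + tensorApply D' A') = -(B' - B - D x) x' - tensorApply (D' - D) A' := by
  simp only [tensorApply_add, tensorApply_outer, tensorApply_sub_left, map_add, sub_apply]
  abel

theorem tensorApply_zero {m n : ℕ} (D : Vec m →L[ℝ] Vec m →L[ℝ] Vec n) :
    tensorApply D (0 : Fin m → Fin m → ℝ) = 0 := by
  simp [tensorApply]

/-! ### Chen's relation -/

section Increments

variable {m : ℕ}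

theorem incr_mul_incr (ω : ℝ → T2 m) (s t u : ℝ) : incr ω s t * incr ω t u = incr ω s u := by
  unfold incr; group

theorem incr_self (ω : ℝ → T2 m) (s : ℝ) : incr ω s s = 1 := by
  unfold incr; group

theorem incr_vec_chen (ω : ℝ → T2 m) (s t u : ℝ) :
    (incr ω s u).vec = (incr ω s t).vec + (incr ω t u).vec := by
  rw [← incr_mul_incr ω s t u]; rfl

theorem incr_area_chen (ω : ℝ → T2 m) (s t u : ℝ) :
    (incr ω s u).area = (fun i j => (incr ω s t).vec i * (incr ω t u).vec j)
      + (incr ω s t).area + (incr ω t u).area := by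
  rw [← incr_mul_incr ω s t u]; rfl

end Increments

/-! ### Variation functionals: superadditivity, finiteness, measurability -/

section Variation

variable {r : ℝ} {S S₁ S₂ : Set ℝ} {F : ℝ → ℝ → ℝ}

theorem sum_le_varPow {u : ℕ → ℝ} (hu : Monotone u) (hS : ∀ i, u i ∈ S) (n : ℕ) :
    ∑ i ∈ Finset.range n, ENNReal.ofReal (F (u i) (u (i + 1)) ^ r) ≤ varPow r S F :=
  le_iSup_of_le n (le_iSup_of_le u (le_iSup_of_le ⟨hu, hS⟩ le_rfl))

theorem varPow_le {c : ℝ≥0∞} (h : ∀ (n : ℕ) (u : ℕ → ℝ), Monotone u → (∀ i, u i ∈ S) →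
    ∑ i ∈ Finset.range n, ENNReal.ofReal (F (u i) (u (i + 1)) ^ r) ≤ c) : varPow r S F ≤ c :=
  iSup_le fun n => iSup_le fun u => iSup_le fun hu => h n u hu.1 hu.2

theorem varPow_mono (h : S₁ ⊆ S) : varPow r S₁ F ≤ varPow r S F :=
  varPow_le fun n _ hu hS => sum_le_varPow hu (fun i => h (hS i)) n

theorem ofReal_rpow_le_varPow {s t : ℝ} (hs : s ∈ S) (ht : t ∈ S) (hst : s ≤ t) :
    ENNReal.ofReal (F s t ^ r) ≤ varPow r S F := by
  have := sum_le_varPow (r := r) (S := S) (F := F) (u := fun i => if i = 0 then s else t)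
    (monotone_nat_of_le_succ fun i => by by_cases h : i = 0 <;> simp [h, hst])
    (fun i => by by_cases h : i = 0 <;> simp [h, hs, ht]) 1
  simpa using this

theorem varPow_add_le (h₁ : S₁ ⊆ S) (h₂ : S₂ ⊆ S) (h : ∀ x ∈ S₁, ∀ y ∈ S₂, x ≤ y) :
    varPow r S₁ F + varPow r S₂ F ≤ varPow r S F := by
  have hempty : varPow r ∅ F = 0 :=
    le_antisymm (varPow_le fun n u _ hS => absurd (hS 0) (notMem_empty _)) bot_le
  rcases S₁.eq_empty_or_nonempty with rfl | ⟨a, ha⟩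
  · rw [hempty, zero_add]; exact varPow_mono h₂
  rcases S₂.eq_empty_or_nonempty with rfl | ⟨b, hb⟩
  · rw [hempty, add_zero]; exact varPow_mono h₁
  have hprod : ∀ S : Set ℝ, varPow r S F = ⨆ (x : ℕ × (ℕ → ℝ)) (_ : Monotone x.2 ∧ ∀ i, x.2 i ∈ S),
      ∑ i ∈ Finset.range x.1, ENNReal.ofReal (F (x.2 i) (x.2 (i + 1)) ^ r) := fun S => by
    rw [iSup_prod]; rfl
  rw [hprod S₁, hprod S₂]
  refine ENNReal.biSup_add_biSup_le' ⟨(0, fun _ => a), monotone_const, fun _ => ha⟩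
    ⟨(0, fun _ => b), monotone_const, fun _ => hb⟩ ?_
  rintro ⟨n, u⟩ ⟨hu, huS⟩ ⟨k, v⟩ ⟨hv, hvS⟩
  -- The sequence follows u up to index n and then v; its n-th term is the gap between them, which
  -- is nonnegative and is dropped.
  have key := sum_le_varPow (r := r) (S := S) (F := F)
    (u := fun i => if i ≤ n then u i else v (i - (n + 1)))
    (monotone_nat_of_le_succ fun i => by
      rcases lt_trichotomy i n with hi | rfl | hi
      · rw [if_pos hi.le, if_pos (by omega)]; exact hu (by omega)
      · rw [if_pos le_rfl, if_neg (by omega)]; exact h _ (huS _) _ (hvS _)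
      · rw [if_neg (by omega), if_neg (by omega)]; exact hv (by omega))
    (fun i => by
      split_ifs
      · exact h₁ (huS _)
      · exact h₂ (hvS _)) (n + 1 + k)
  refine le_trans ?_ key
  rw [Finset.sum_range_add, Finset.sum_range_succ]
  refine add_le_add (le_add_of_le_of_nonneg (Finset.sum_le_sum fun i hi => ?_) bot_le)
    (Finset.sum_le_sum fun i hi => ?_)
  · have := Finset.mem_range.1 hi
    rw [if_pos (by omega), if_pos (by omega)]
  · rw [if_neg (by omega), if_neg (by omega)]
    have e1 : n + 1 + i - (n + 1) = i := by omega
    have e2 : n + 1 + i + 1 - (n + 1) = i + 1 := by omega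
    rw [e1, e2]

theorem varPow_inter_Icc_add_le {s t u : ℝ} (hst : s ≤ t) (htu : t ≤ u) :
    varPow r (S ∩ Icc s t) F + varPow r (S ∩ Icc t u) F ≤ varPow r (S ∩ Icc s u) F :=
  varPow_add_le (inter_subset_inter_right _ (Icc_subset_Icc_right htu))
    (inter_subset_inter_right _ (Icc_subset_Icc_left hst)) fun _ hx _ hy => hx.2.2.trans hy.2.1

theorem varPow_lt_top_of_le {a b C : ℝ} (hS : S ⊆ Icc a b)
    (hF : ∀ s t, a ≤ s → s ≤ t → t ≤ b → F s t ^ r ≤ C * (t - s)) : varPow r S F < ⊤ := by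
  refine lt_of_le_of_lt (b := ENNReal.ofReal (|C| * (b - a))) ?_ ENNReal.ofReal_lt_top
  refine varPow_le fun n u hu hu' => ?_
  calc ∑ i ∈ Finset.range n, ENNReal.ofReal (F (u i) (u (i + 1)) ^ r)
      ≤ ∑ i ∈ Finset.range n, ENNReal.ofReal (|C| * (u (i + 1) - u i)) :=
        Finset.sum_le_sum fun i _ => ENNReal.ofReal_le_ofReal
          ((hF _ _ (hS (hu' i)).1 (hu i.le_succ) (hS (hu' (i + 1))).2).trans
            (mul_le_mul_of_nonneg_right (le_abs_self C) (sub_nonneg.2 (hu i.le_succ))))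
    _ = ENNReal.ofReal (|C| * (u n - u 0)) := by
        rw [← ENNReal.ofReal_sum_of_nonneg fun i _ => mul_nonneg (abs_nonneg C)
          (sub_nonneg.2 (hu i.le_succ)), ← Finset.mul_sum, Finset.sum_range_sub]
    _ ≤ _ := ENNReal.ofReal_le_ofReal (mul_le_mul_of_nonneg_left
          (sub_le_sub (hS (hu' n)).2 (hS (hu' 0)).1) (abs_nonneg C))

theorem le_varPow_rpow {s t : ℝ} (hr : 0 < r) (hF : 0 ≤ F s t) (hs : s ∈ S) (ht : t ∈ S)
    (hst : s ≤ t) (hfin : varPow r S F ≠ ⊤) : F s t ≤ (varPow r S F).toReal ^ (1 / r) := by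
  have h := (ENNReal.ofReal_le_iff_le_toReal hfin).1 (ofReal_rpow_le_varPow (r := r) hs ht hst)
  calc F s t = (F s t ^ r) ^ (1 / r) := by
        rw [← Real.rpow_mul hF, mul_one_div_cancel hr.ne', Real.rpow_one]
    _ ≤ _ := Real.rpow_le_rpow (Real.rpow_nonneg hF _) h (by positivity)

/-- Only the first n + 1 points of a sequence enter the n-th sum, so over a countable set the
supremum is countable. A finite monotone family is extended to a sequence by its last value. -/
theorem measurable_varPow {Ω : Type*} [MeasurableSpace Ω] {G : Ω → ℝ → ℝ → ℝ} (hS : S.Countable)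
    (hG : ∀ s t, Measurable fun ω => G ω s t) : Measurable fun ω => varPow r S (G ω) := by
  have := hS.to_subtype
  have heq : (fun ω => varPow r S (G ω)) = fun ω => ⨆ (n : ℕ) (v : Fin (n + 1) → S)
      (_ : Monotone v), ∑ i : Fin n,
        ENNReal.ofReal (G ω (v i.castSucc) (v i.succ) ^ r) := by
    funext ω
    refine le_antisymm (varPow_le fun n u hu huS => ?_) ?_
    · refine le_iSup_of_le n (le_iSup_of_le (fun i => ⟨u i, huS i⟩) (le_iSup_of_le
        (fun i j hij => hu hij) ?_))
      rw [Finset.sum_range]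
      simp
    · refine iSup_le fun n => iSup_le fun v => iSup_le fun hv => ?_
      refine le_trans ?_ (sum_le_varPow (r := r) (F := G ω)
        (u := fun i => (v ⟨min i n, by omega⟩ : ℝ)) (fun i j hij => hv (by
          simp only [Fin.mk_le_mk]; omega)) (fun i => (v _).2) n)
      rw [Finset.sum_range]
      refine Finset.sum_le_sum fun i _ => le_of_eq ?_
      have e1 : (⟨min (i : ℕ) n, by omega⟩ : Fin (n + 1)) = i.castSucc := by
        ext; simp
      have e2 : (⟨min ((i : ℕ) + 1) n, by omega⟩ : Fin (n + 1)) = i.succ := by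
        ext; simp
      rw [e1, e2]
  rw [heq]
  refine Measurable.iSup fun n => Measurable.iSup fun v => Measurable.iSup_Prop _ ?_
  exact Finset.measurable_sum _ fun i _ => ((hG _ _).pow_const r).ennreal_ofReal

end Variation

/-! ### The rough integral estimate -/

section RoughIntegral

variable {m n : ℕ} {p : ℝ}

theorem xVarPow_lt_top {ω : ℝ → T2 m} {a b : ℝ} {S : Set ℝ} (hp : 0 < p)
    (hω : IsHolderOn (1 / p) a b ω) (hS : S ⊆ Icc a b) : xVarPow p S ω < ⊤ := by
  obtain ⟨C, hC⟩ := hω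
  refine varPow_lt_top_of_le (C := |C| ^ p) hS fun s t hs hst ht => ?_
  rcases hst.eq_or_lt with rfl | hlt
  · simp [incr_self, hp.ne']
  · have h0 : 0 ≤ t - s := by linarith
    calc ‖(incr ω s t).vec‖ ^ p ≤ (|C| * (t - s) ^ (1 / p)) ^ p := by
          refine Real.rpow_le_rpow (norm_nonneg _) ((hC s t hs hlt ht).1.trans ?_) hp.le
          gcongr
          exact le_abs_self C
      _ = |C| ^ p * (t - s) := by
          rw [Real.mul_rpow (abs_nonneg _) (by positivity), ← Real.rpow_mul h0,
            one_div_mul_cancel hp.ne', Real.rpow_one]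

theorem rpow_half_le_of_le {p x C h : ℝ} (hp : 0 < p) (hx : 0 ≤ x) (hh : 0 ≤ h)
    (hxC : x ≤ C * h ^ (2 * (1 / p))) : x ^ (p / 2) ≤ |C| ^ (p / 2) * h := by
  calc x ^ (p / 2) ≤ (|C| * h ^ (2 * (1 / p))) ^ (p / 2) := by
        refine Real.rpow_le_rpow hx (hxC.trans ?_) (by positivity)
        gcongr
        exact le_abs_self C
    _ = |C| ^ (p / 2) * h := by
        rw [Real.mul_rpow (abs_nonneg _) (by positivity), ← Real.rpow_mul hh]
        have : 2 * (1 / p) * (p / 2) = 1 := by field_simp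
        rw [this, Real.rpow_one]

theorem areaVarPow_lt_top {ω : ℝ → T2 m} {a b : ℝ} {S : Set ℝ} (hp : 0 < p)
    (hω : IsHolderOn (1 / p) a b ω) (hS : S ⊆ Icc a b) : areaVarPow p S ω < ⊤ := by
  obtain ⟨C, hC⟩ := hω
  refine varPow_lt_top_of_le (C := |C| ^ (p / 2)) hS fun s t hs hst ht => ?_
  rcases hst.eq_or_lt with rfl | hlt
  · have h0 : (incr ω s s).area = 0 := by rw [incr_self]; rfl
    rw [h0, tensorNorm_zero, Real.zero_rpow (by positivity)]
    simp
  · exact rpow_half_le_of_le hp (tensorNorm_nonneg _) (by linarith) (hC s t hs hlt ht).2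

theorem exists_uniform_partition {a b δ : ℝ} (hab : a ≤ b) (hδ : 0 < δ) :
    ∃ (N : ℕ) (u : ℕ → ℝ), Monotone u ∧ u 0 = a ∧ u N = b ∧ ∀ i < N, u (i + 1) - u i < δ := by
  obtain ⟨N, hN⟩ := exists_nat_gt ((b - a) / δ)
  have hN0 : (0 : ℝ) < N := lt_of_le_of_lt (div_nonneg (by linarith) hδ.le) hN
  refine ⟨N, fun i => a + (b - a) / N * i, fun i j hij => ?_, by simp, ?_, fun i _ => ?_⟩
  · have : (i : ℝ) ≤ j := by exact_mod_cast hij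
    have h0 : 0 ≤ (b - a) / N := div_nonneg (by linarith) hN0.le
    dsimp only
    nlinarith
  · field_simp; ring
  · push_cast
    rw [div_lt_iff₀ hδ] at hN
    have : (b - a) / N < δ := by rw [div_lt_iff₀ hN0]; linarith
    linarith

theorem div_le_one_mul {x y : ℝ} (hx : 0 ≤ x) (hxy : x ≤ y) : x = y * (x / y) := by
  rcases eq_or_ne y 0 with rfl | hy
  · simp; linarith
  · field_simp

/-- The normalised control attached to a variation functional, along a partition. -/
theorem exists_normalized_control {a b : ℝ} {N : ℕ} {u : ℕ → ℝ} (hu : Monotone u) (hu0 : u 0 = a)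
    (huN : u N = b) (r : ℝ) (F : ℝ → ℝ → ℝ) (hr : 0 < r) (hF : ∀ s t, 0 ≤ F s t)
    (hfin : varPow r (Icc a b) F ≠ ⊤) : ∃ W : ℕ → ℕ → ℝ, (∀ i j, 0 ≤ W i j) ∧
      (∀ i j k, i ≤ j → j ≤ k → k ≤ N → W i j + W j k ≤ W i k) ∧ W 0 N ≤ 1 ∧
      ∀ i j, i ≤ j → j ≤ N → F (u i) (u j) ≤
        (varPow r (Icc a b) F).toReal ^ (1 / r) * W i j ^ (1 / r) := by
  have hsub : ∀ i j, j ≤ N → Icc (u i) (u j) ⊆ Icc a b := fun i j hj =>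
    Icc_subset_Icc (hu0 ▸ hu (Nat.zero_le i)) (huN ▸ hu hj)
  have hle : ∀ i j, j ≤ N → varPow r (Icc (u i) (u j)) F ≤ varPow r (Icc a b) F :=
    fun i j hj => varPow_mono (hsub i j hj)
  have hfin' : ∀ i j, j ≤ N → varPow r (Icc (u i) (u j)) F ≠ ⊤ :=
    fun i j hj => ne_top_of_le_ne_top hfin (hle i j hj)
  -- Dividing by the total variation puts different functionals on a common scale. If the total is 0
  -- the quotient is 0 by convention, and `div_le_one_mul` remains true.
  refine ⟨fun i j => (varPow r (Icc (u i) (u j)) F).toReal / (varPow r (Icc a b) F).toReal,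
    fun i j => by positivity, fun i j k hij hjk hk => ?_, ?_, fun i j hij hj => ?_⟩
  · rw [← add_div]
    refine div_le_div_of_nonneg_right ?_ ENNReal.toReal_nonneg
    rw [← ENNReal.toReal_add (hfin' _ _ (hjk.trans hk)) (hfin' _ _ hk)]
    refine ENNReal.toReal_mono (hfin' _ _ hk) ?_
    have := varPow_inter_Icc_add_le (r := r) (S := univ) (F := F) (hu hij) (hu hjk)
    simpa only [univ_inter] using this
  · dsimp only
    rw [hu0, huN]
    exact div_self_le_one _
  · have h := le_varPow_rpow hr (hF (u i) (u j)) (left_mem_Icc.2 (hu hij))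
      (right_mem_Icc.2 (hu hij)) (hu hij) (hfin' i j hj)
    rw [div_le_one_mul ENNReal.toReal_nonneg (ENNReal.toReal_mono hfin (hle i j hj)),
      Real.mul_rpow ENNReal.toReal_nonneg (by positivity)] at h
    exact h

/-- Normalising the four controls before adding them keeps the estimate homogeneous in each
variation norm separately. The products have exponent 1/p + 2/p = 3/p > 1, as sewing requires. -/
theorem sewing_of_varPow {E : Type*} [NormedAddCommGroup E] (hp2 : 2 < p) (hp3 : p < 3)
    {F₁ F₂ F₃ F₄ : ℝ → ℝ → ℝ} {a b : ℝ} (hF₁ : ∀ s t, 0 ≤ F₁ s t) (hF₂ : ∀ s t, 0 ≤ F₂ s t)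
    (hF₃ : ∀ s t, 0 ≤ F₃ s t) (hF₄ : ∀ s t, 0 ≤ F₄ s t) (h1 : varPow p (Icc a b) F₁ ≠ ⊤)
    (h2 : varPow (p / 2) (Icc a b) F₂ ≠ ⊤) (h3 : varPow p (Icc a b) F₃ ≠ ⊤)
    (h4 : varPow (p / 2) (Icc a b) F₄ ≠ ⊤) {N : ℕ} {u : ℕ → ℝ} (hu : Monotone u) (hu0 : u 0 = a)
    (huN : u N = b) {Ξ : ℕ → ℕ → E}
    (hΞ0 : ∀ i, Ξ i i = 0) (hΞ : ∀ i j k, i ≤ j → j ≤ k → k ≤ N → ‖Ξ i k - Ξ i j - Ξ j k‖ ≤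
      F₂ (u i) (u j) * F₁ (u j) (u k) + F₃ (u i) (u j) * F₄ (u j) (u k)) :
    ‖Ξ 0 N - ∑ i ∈ Finset.range N, Ξ i (i + 1)‖ ≤
      sewConst (3 / p) * 8 * ((varPow p (Icc a b) F₁).toReal ^ (1 / p) *
        (varPow (p / 2) (Icc a b) F₂).toReal ^ (2 / p) +
        (varPow p (Icc a b) F₃).toReal ^ (1 / p) *
        (varPow (p / 2) (Icc a b) F₄).toReal ^ (2 / p)) := by
  have hp : 0 < p := by linarith
  have hθ : 1 < 3 / p := by rw [lt_div_iff₀ hp]; linarith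
  have ctrl := exists_normalized_control hu hu0 huN
  obtain ⟨W1, p1, s1, t1, b1⟩ := ctrl p F₁ hp hF₁ h1
  obtain ⟨W2, p2, s2, t2, b2⟩ := ctrl (p / 2) F₂ (by positivity) hF₂ h2
  obtain ⟨W3, p3, s3, t3, b3⟩ := ctrl p F₃ hp hF₃ h3
  obtain ⟨W4, p4, s4, t4, b4⟩ := ctrl (p / 2) F₄ (by positivity) hF₄ h4
  have hinv : 1 / (p / 2) = 2 / p := by field_simp
  rw [hinv] at b2 b4
  set X1 := (varPow p (Icc a b) F₁).toReal ^ (1 / p)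
  set X2 := (varPow (p / 2) (Icc a b) F₂).toReal ^ (2 / p)
  set X3 := (varPow p (Icc a b) F₃).toReal ^ (1 / p)
  set X4 := (varPow (p / 2) (Icc a b) F₄).toReal ^ (2 / p)
  have q1 : 0 ≤ X1 := by positivity
  have q2 : 0 ≤ X2 := by positivity
  have q3 : 0 ≤ X3 := by positivity
  have q4 : 0 ≤ X4 := by positivity
  let V : ℕ → ℕ → ℝ := fun i j => W1 i j + W2 i j + (W3 i j + W4 i j)
  have hV0 : ∀ i j, 0 ≤ V i j := fun i j =>
    add_nonneg (add_nonneg (p1 i j) (p2 i j)) (add_nonneg (p3 i j) (p4 i j))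
  have hVs : ∀ i j k, i ≤ j → j ≤ k → k ≤ N → V i j + V j k ≤ V i k := by
    intro i j k hij hjk hk
    have := s1 i j k hij hjk hk
    have := s2 i j k hij hjk hk
    have := s3 i j k hij hjk hk
    have := s4 i j k hij hjk hk
    simp only [V]; linarith
  have hpow : ∀ v : ℝ, 0 ≤ v → v ^ (1 / p) * v ^ (2 / p) = v ^ (3 / p) := fun v hv => by
    rw [← Real.rpow_add_of_nonneg hv (by positivity) (by positivity)]
    congr 1; ring
  have hδ : ∀ i j k, i ≤ j → j < k → k ≤ N →
      ‖Ξ i k - Ξ i j - Ξ j k‖ ≤ (X1 * X2 + X3 * X4) * V i k ^ (3 / p) := by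
    intro i j k hij hjk hk
    replace hjk := hjk.le
    refine (hΞ i j k hij hjk hk).trans ?_
    have hjV : ∀ {W : ℕ → ℕ → ℝ}, (∀ i j, 0 ≤ W i j) →
        (∀ i j k, i ≤ j → j ≤ k → k ≤ N → W i j + W j k ≤ W i k) →
        W j k ≤ W i k ∧ W i j ≤ W i k := fun h h' =>
      ⟨by linarith [h' i j k hij hjk hk, h i j], by linarith [h' i j k hij hjk hk, h j k]⟩
    have hW1 : W1 j k ≤ V i k := by
      have := (hjV p1 s1).1; have := p2 i k; have := p3 i k; have := p4 i k
      simp only [V]; linarith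
    have hW2 : W2 i j ≤ V i k := by
      have := (hjV p2 s2).2; have := p1 i k; have := p3 i k; have := p4 i k
      simp only [V]; linarith
    have hW3 : W3 i j ≤ V i k := by
      have := (hjV p3 s3).2; have := p1 i k; have := p2 i k; have := p4 i k
      simp only [V]; linarith
    have hW4 : W4 j k ≤ V i k := by
      have := (hjV p4 s4).1; have := p1 i k; have := p2 i k; have := p3 i k
      simp only [V]; linarith
    have mono1 : ∀ {v : ℝ}, 0 ≤ v → v ≤ V i k → v ^ (1 / p) ≤ V i k ^ (1 / p) :=
      fun h h' => Real.rpow_le_rpow h h' (by positivity)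
    have mono2 : ∀ {v : ℝ}, 0 ≤ v → v ≤ V i k → v ^ (2 / p) ≤ V i k ^ (2 / p) :=
      fun h h' => Real.rpow_le_rpow h h' (by positivity)
    have c1 : F₁ (u j) (u k) ≤ X1 * V i k ^ (1 / p) :=
      (b1 j k hjk hk).trans (mul_le_mul_of_nonneg_left (mono1 (p1 _ _) hW1) q1)
    have c2 : F₂ (u i) (u j) ≤ X2 * V i k ^ (2 / p) :=
      (b2 i j hij (hjk.trans hk)).trans (mul_le_mul_of_nonneg_left (mono2 (p2 _ _) hW2) q2)
    have c3 : F₃ (u i) (u j) ≤ X3 * V i k ^ (1 / p) :=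
      (b3 i j hij (hjk.trans hk)).trans (mul_le_mul_of_nonneg_left (mono1 (p3 _ _) hW3) q3)
    have c4 : F₄ (u j) (u k) ≤ X4 * V i k ^ (2 / p) :=
      (b4 j k hjk hk).trans (mul_le_mul_of_nonneg_left (mono2 (p4 _ _) hW4) q4)
    calc F₂ (u i) (u j) * F₁ (u j) (u k) + F₃ (u i) (u j) * F₄ (u j) (u k)
        ≤ (X2 * V i k ^ (2 / p)) * (X1 * V i k ^ (1 / p)) +
          (X3 * V i k ^ (1 / p)) * (X4 * V i k ^ (2 / p)) := by
          have := hV0 i k; have := hF₁ (u j) (u k); have := hF₃ (u i) (u j); have := hF₄ (u j) (u k)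
          gcongr
      _ = (X1 * X2 + X3 * X4) * (V i k ^ (1 / p) * V i k ^ (2 / p)) := by ring
      _ = _ := by rw [hpow _ (hV0 i k)]
  have hmain := discrete_sewing hθ (by positivity) hV0 hVs (fun i _ => hΞ0 i) hδ 0 N (Nat.zero_le _) le_rfl
  rw [Nat.Ico_zero_eq_range] at hmain
  -- Each of the four normalised controls is at most 1, and 3/p < 3/2, so the power is at most
  -- 4^(3/2).
  have hV8 : V 0 N ^ (3 / p) ≤ 8 := by
    have h4 : V 0 N ≤ 4 := by simp only [V]; linarith
    calc V 0 N ^ (3 / p) ≤ 4 ^ (3 / p) := Real.rpow_le_rpow (hV0 _ _) h4 (by positivity)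
      _ ≤ 4 ^ (3 / 2 : ℝ) := Real.rpow_le_rpow_of_exponent_le (by norm_num) (by
          rw [div_le_div_iff₀ hp two_pos]; linarith)
      _ = 8 := by
          rw [show (4 : ℝ) = 2 ^ (2 : ℝ) by norm_num, ← Real.rpow_mul (by norm_num)]
          norm_num
  refine hmain.trans ?_
  have := sewConst_pos hθ
  calc _ ≤ sewConst (3 / p) * ((X1 * X2 + X3 * X4) * 8) := by gcongr
    _ = _ := by ring

theorem norm_germ_defect_le (ω : ℝ → T2 m) (y : ℝ → Vec m →L[ℝ] Vec n)
    (y' : ℝ → Vec m →L[ℝ] Vec m →L[ℝ] Vec n) (s t v : ℝ) :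
    ‖(y s (incr ω s v).vec + tensorApply (y' s) (incr ω s v).area) -
      (y s (incr ω s t).vec + tensorApply (y' s) (incr ω s t).area) -
      (y t (incr ω t v).vec + tensorApply (y' t) (incr ω t v).area)‖ ≤
      ‖remainder ω y y' s t‖ * ‖(incr ω t v).vec‖ +
        ‖y' t - y' s‖ * tensorNorm (incr ω t v).area := by
  have hid : (y s (incr ω s v).vec + tensorApply (y' s) (incr ω s v).area) -
      (y s (incr ω s t).vec + tensorApply (y' s) (incr ω s t).area) -
      (y t (incr ω t v).vec + tensorApply (y' t) (incr ω t v).area) =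
      -(remainder ω y y' s t) (incr ω t v).vec
        - tensorApply (y' t - y' s) (incr ω t v).area := by
    rw [incr_vec_chen ω s t v, incr_area_chen ω s t v]
    exact germ_defect_eq _ _ _ _ _ _ _ _
  rw [hid]
  refine (norm_sub_le _ _).trans (add_le_add ?_ (norm_tensorApply_le _ _))
  rw [norm_neg]; exact ContinuousLinearMap.le_opNorm _ _

theorem rough_sum_estimate (hp2 : 2 < p) (hp3 : p < 3) (ω : ℝ → T2 m)
    (y : ℝ → Vec m →L[ℝ] Vec n) (y' : ℝ → Vec m →L[ℝ] Vec m →L[ℝ] Vec n) {a b : ℝ}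
    (h1 : xVarPow p (Icc a b) ω ≠ ⊤)
    (h2 : varPow (p / 2) (Icc a b) (fun s t => ‖remainder ω y y' s t‖) ≠ ⊤)
    (h3 : varPow p (Icc a b) (fun s t => ‖y' t - y' s‖) ≠ ⊤)
    (h4 : areaVarPow p (Icc a b) ω ≠ ⊤)
    {N : ℕ} {u : ℕ → ℝ} (hu : Monotone u) (hu0 : u 0 = a) (huN : u N = b) :
    ‖(y a (incr ω a b).vec + tensorApply (y' a) (incr ω a b).area) -
        ∑ i ∈ Finset.range N, (y (u i) (incr ω (u i) (u (i + 1))).vec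
        + tensorApply (y' (u i)) (incr ω (u i) (u (i + 1))).area)‖ ≤
      sewConst (3 / p) * 8 * ((xVarPow p (Icc a b) ω).toReal ^ (1 / p) *
        (varPow (p / 2) (Icc a b) (fun s t => ‖remainder ω y y' s t‖)).toReal ^ (2 / p) +
        (varPow p (Icc a b) (fun s t => ‖y' t - y' s‖)).toReal ^ (1 / p) *
        (areaVarPow p (Icc a b) ω).toReal ^ (2 / p)) := by
  have hnn : ∀ i j k, i ≤ j → j ≤ k → k ≤ N → _ ≤
      ‖remainder ω y y' (u i) (u j)‖ * ‖(incr ω (u j) (u k)).vec‖ +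
          ‖y' (u j) - y' (u i)‖ * tensorNorm (incr ω (u j) (u k)).area :=
    fun i j k _ _ _ => norm_germ_defect_le ω y y' (u i) (u j) (u k)
  have := sewing_of_varPow hp2 hp3 (F₁ := fun s t => ‖(incr ω s t).vec‖)
    (F₂ := fun s t => ‖remainder ω y y' s t‖) (F₃ := fun s t => ‖y' t - y' s‖)
    (F₄ := fun s t => tensorNorm (incr ω s t).area) (fun s t => norm_nonneg _)
    (fun s t => norm_nonneg _) (fun s t => norm_nonneg (y' t - y' s))
    (fun s t => tensorNorm_nonneg _) h1 h2 h3 h4 hu hu0 huN (Ξ := fun i j =>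
      y (u i) (incr ω (u i) (u j)).vec + tensorApply (y' (u i)) (incr ω (u i) (u j)).area)
    (fun i => by
      have h0 : (1 : T2 m).area = 0 := rfl
      simp [incr_self, h0, tensorApply_zero]) hnn
  rw [hu0, huN] at this
  exact this

/-- The estimate for Darboux sums does not depend on the partition, so it passes to the limit along
uniform partitions. Hölder regularity makes all four variations finite, which allows the computation
to be done in ℝ. -/
theorem isRoughIntegralConstant_of_le (hp2 : 2 < p) (hp3 : p < 3) {C : ℝ}
    (hC : sewConst (3 / p) * 8 ≤ C) : IsRoughIntegralConstant p C := by
  intro m n ω y y' a b I hab hω hy hI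
  have hp : 0 < p := by linarith
  have h1 : xVarPow p (Icc a b) ω ≠ ⊤ := (xVarPow_lt_top hp hω subset_rfl).ne
  have h4 : areaVarPow p (Icc a b) ω ≠ ⊤ := (areaVarPow_lt_top hp hω subset_rfl).ne
  obtain ⟨c, hc⟩ := hy
  have h2 : varPow (p / 2) (Icc a b) (fun s t => ‖remainder ω y y' s t‖) ≠ ⊤ := by
    refine (varPow_lt_top_of_le (C := |c| ^ (p / 2)) subset_rfl fun s t hs hst ht => ?_).ne
    rcases hst.eq_or_lt with rfl | hlt
    · simp [remainder, incr_self, hp.ne']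
    · exact rpow_half_le_of_le hp (norm_nonneg _) (by linarith) (hc s t hs hlt ht).2.2
  have h3 : varPow p (Icc a b) (fun s t => ‖y' t - y' s‖) ≠ ⊤ := by
    refine (varPow_lt_top_of_le (C := |c| ^ p) subset_rfl fun s t hs hst ht => ?_).ne
    rcases hst.eq_or_lt with rfl | hlt
    · rw [sub_self (y' s), norm_zero (E := Vec m →L[ℝ] Vec m →L[ℝ] Vec n), Real.zero_rpow hp.ne']
      simp
    · have h0 : 0 ≤ t - s := by linarith
      calc ‖y' t - y' s‖ ^ p ≤ (|c| * (t - s) ^ (1 / p)) ^ p := by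
            refine Real.rpow_le_rpow (norm_nonneg (y' t - y' s)) ((hc s t hs hlt ht).2.1.trans ?_) hp.le
            gcongr
            exact le_abs_self c
        _ = |c| ^ p * (t - s) := by
            rw [Real.mul_rpow (abs_nonneg _) (by positivity), ← Real.rpow_mul h0,
              one_div_mul_cancel hp.ne', Real.rpow_one]
  have hest := fun N u hu h0 hN =>
    rough_sum_estimate hp2 hp3 ω y y' h1 h2 h3 h4 (N := N) (u := u) hu h0 hN
  set X1 := xVarPow p (Icc a b) ω
  set X2 := varPow (p / 2) (Icc a b) (fun s t => ‖remainder ω y y' s t‖)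
  set X3 := varPow p (Icc a b) (fun s t => ‖y' t - y' s‖)
  set X4 := areaVarPow p (Icc a b) ω
  have hpow : ∀ (X : ℝ≥0∞) (r : ℝ), X ≠ ⊤ → 0 ≤ r → X ^ r = ENNReal.ofReal (X.toReal ^ r) := by
    intro X r hX hr
    rw [← ENNReal.ofReal_rpow_of_nonneg ENNReal.toReal_nonneg hr, ENNReal.ofReal_toReal hX]
  rw [hpow X1 _ h1 (by positivity), hpow X2 _ h2 (by positivity), hpow X3 _ h3 (by positivity),
    hpow X4 _ h4 (by positivity), ← ENNReal.ofReal_mul (by positivity),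
    ← ENNReal.ofReal_mul (by positivity), ← ENNReal.ofReal_add (by positivity) (by positivity),
    ← ENNReal.ofReal_mul' (by positivity)]
  refine ENNReal.ofReal_le_ofReal (le_trans ?_ (mul_le_mul_of_nonneg_right hC (by positivity)))
  refine le_of_forall_pos_le_add fun ε hε => ?_
  obtain ⟨δ, hδ, hI⟩ := hI ε hε
  obtain ⟨N, u, hu, hu0, huN, hmesh⟩ := exists_uniform_partition hab hδ
  have e1 := hI N u hu hu0 huN hmesh
  have e2 := hest N u hu hu0 huN
  rw [sub_sub, norm_sub_rev, ← sub_add_sub_cancel]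
  exact (norm_add_le _ _).trans (add_le_add e2 e1.le)

end RoughIntegral

/-- The estimates on a diffusion coefficient `g` and on `H = Dg · g` used by the a priori bounds for
rough difference equations, in normalised form. -/
structure NormalizedCoeff {d m : ℕ} (g : Vec d → Vec m →L[ℝ] Vec d)
    (H : Vec d → Vec m →L[ℝ] Vec m →L[ℝ] Vec d) : Prop where
  norm_le : ∀ u, ‖g u‖ ≤ 1
  lip : ∀ u v, ‖g u - g v‖ ≤ ‖u - v‖
  second : ∀ u v s, ‖(g (u + s) - g u) - (g (v + s) - g v)‖ ≤ ‖s‖ * ‖u - v‖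
  H_norm_le : ∀ u, ‖H u‖ ≤ 1
  H_lip : ∀ u v, ‖H u - H v‖ ≤ 2 * ‖u - v‖
  H_second : ∀ u v s, ‖(H (u + s) - H u) - (H (v + s) - H v)‖ ≤ 4 * (‖s‖ * ‖u - v‖)
  taylor : ∀ u ξ, ‖g (u + g u ξ) - g u - H u ξ‖ ≤ ‖ξ‖ ^ 2
  taylor_lip : ∀ u v ξ, ‖(g (u + g u ξ) - g u - H u ξ) - (g (v + g v ξ) - g v - H v ξ)‖ ≤
    2 * ‖ξ‖ ^ 2 * ‖u - v‖

/-- A discrete rough path of size `κ` with respect to the control `V`. -/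
structure IsDiscreteRough {m : ℕ} (p κ : ℝ) (n : ℕ) (x : ℕ → ℕ → Vec m)
    (X : ℕ → ℕ → Fin m → Fin m → ℝ) (V : ℕ → ℕ → ℝ) : Prop where
  nonneg : ∀ i j, 0 ≤ V i j
  superadd : ∀ i j k, i ≤ j → j ≤ k → k ≤ n → V i j + V j k ≤ V i k
  le_two : V 0 n ≤ 2
  vec_chen : ∀ i j k, i ≤ j → j ≤ k → k ≤ n → x i k = x i j + x j k
  area_chen : ∀ i j k, i ≤ j → j ≤ k → k ≤ n →
    X i k = (fun a b => x i j a * x j k b) + X i j + X j k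
  vec_le : ∀ i j, i ≤ j → j ≤ n → ‖x i j‖ ≤ κ * V i j ^ (1 / p)
  area_le : ∀ i j, i ≤ j → j ≤ n → tensorNorm (X i j) ≤ κ * V i j ^ (2 / p)

theorem sum_Ico_le_of_superadd {V : ℕ → ℕ → ℝ} {n : ℕ} (hV : ∀ i j, 0 ≤ V i j)
    (hsup : ∀ i j k, i ≤ j → j ≤ k → k ≤ n → V i j + V j k ≤ V i k) {j k : ℕ} (hjk : j ≤ k)
    (hk : k ≤ n) : ∑ i ∈ Finset.Ico j k, V i (i + 1) ≤ V j k := by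
  induction k, hjk using Nat.le_induction with
  | base => simpa using hV j j
  | succ k hjk ih =>
    rw [Finset.sum_Ico_succ_top hjk]
    linarith [ih (by omega), hsup j k (k + 1) hjk (by omega) hk]

theorem sum_Ico_sub_eq {E : Type*} [AddCommGroup E] (a : ℕ → E) {j k : ℕ} (hjk : j ≤ k) :
    ∑ i ∈ Finset.Ico j k, (a (i + 1) - a i) = a k - a j := by
  induction k, hjk using Nat.le_induction with
  | base => simp
  | succ k hjk ih => rw [Finset.sum_Ico_succ_top hjk, ih]; abel

theorem norm_add_three_le {E : Type*} [SeminormedAddCommGroup E] {u v w : E} {r₁ r₂ r₃ : ℝ}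
    (hu : ‖u‖ ≤ r₁) (hv : ‖v‖ ≤ r₂) (hw : ‖w‖ ≤ r₃) : ‖u + v + w‖ ≤ r₁ + r₂ + r₃ :=
  norm_add_le_of_le (norm_add_le_of_le hu hv) hw

theorem sub_sub_sub_comm_three {E : Type*} [AddCommGroup E] (a b c a' b' c' : E) :
    (a - a') - (b - b') - (c - c') = (a - b - c) - (a' - b' - c') := by abel

/-! ### A priori bounds for rough difference equations -/

section Core

variable {d m : ℕ} {g : Vec d → Vec m →L[ℝ] Vec d} {H : Vec d → Vec m →L[ℝ] Vec m →L[ℝ] Vec d}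

/-- The point a + g(a)ξ is inserted: a' differs from it by the remainder, and the rest is a Taylor
error. -/
theorem NormalizedCoeff.increment_le (hg : NormalizedCoeff g H) (a a' : Vec d) (ξ : Vec m) :
    ‖g a' - g a - H a ξ‖ ≤ ‖a' - a - g a ξ‖ + ‖ξ‖ ^ 2 := by
  have h1 := hg.lip a' (a + g a ξ)
  have h2 := hg.taylor a ξ
  have e : g a' - g a - H a ξ = (g a' - g (a + g a ξ)) + (g (a + g a ξ) - g a - H a ξ) := by abel
  rw [← sub_sub] at h1
  rw [e]
  exact norm_add_le_of_le h1 h2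

/-- With s the remainder of a, the point P + s is inserted. The three resulting terms are the
difference of the remainders, a second difference of g under the common shift s, and the difference
of the Taylor errors. -/
theorem NormalizedCoeff.increment_sub_le (hg : NormalizedCoeff g H) (a a' y y' : Vec d) (ξ : Vec m)
    (hξ : ‖ξ‖ ≤ 1) :
    ‖(g y' - g y - H y ξ) - (g a' - g a - H a ξ)‖ ≤
      ‖(y' - y - g y ξ) - (a' - a - g a ξ)‖ + ‖a' - a - g a ξ‖ * (2 * ‖y - a‖)
        + 2 * ‖ξ‖ ^ 2 * ‖y - a‖ := by
  set P := y + g y ξ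
  set Q := a + g a ξ
  have hPQ : ‖P - Q‖ ≤ 2 * ‖y - a‖ := by
    have e : P - Q = (y - a) + (g y - g a) ξ := by simp only [P, Q, sub_apply]; abel
    have h1 : ‖(g y - g a) ξ‖ ≤ ‖y - a‖ * 1 :=
      (ContinuousLinearMap.le_opNorm _ _).trans (by gcongr; exact hg.lip y a)
    rw [e]
    linarith [norm_add_le (y - a) ((g y - g a) ξ)]
  set s := a' - a - g a ξ
  have h1 : ‖g y' - g (P + s)‖ ≤ ‖(y' - y - g y ξ) - s‖ := by
    refine (hg.lip _ _).trans_eq ?_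
    congr 1; simp only [P]; abel
  have h2 : ‖(g (P + s) - g P) - (g (Q + s) - g Q)‖ ≤ ‖s‖ * (2 * ‖y - a‖) :=
    (hg.second P Q s).trans (by gcongr)
  have h3 := hg.taylor_lip y a ξ
  have hQ : Q + s = a' := by simp only [Q, s]; abel
  rw [hQ] at h2
  have e : (g y' - g y - H y ξ) - (g a' - g a - H a ξ) = (g y' - g (P + s)) +
      ((g (P + s) - g P) - (g a' - g Q)) +
      ((g P - g y - H y ξ) - (g Q - g a - H a ξ)) := by abel
  rw [e]
  exact norm_add_three_le h1 h2 h3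

theorem NormalizedCoeff.H_increment_sub_le (hg : NormalizedCoeff g H) (a a' y y' : Vec d) :
    ‖(H y' - H y) - (H a' - H a)‖ ≤ 2 * ‖(y' - a') - (y - a)‖ + 4 * (‖a' - a‖ * ‖y - a‖) := by
  have h1 := hg.H_lip y' (y + (a' - a))
  have h2 := hg.H_second y a (a' - a)
  have e1 : y' - (y + (a' - a)) = (y' - a') - (y - a) := by abel
  rw [add_sub_cancel] at h2
  rw [e1] at h1
  have e : (H y' - H y) - (H a' - H a) = (H y' - H (y + (a' - a))) +
      ((H (y + (a' - a)) - H y) - (H a' - H a)) := by abel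
  rw [e]
  exact (norm_add_le (E := Vec m →L[ℝ] Vec m →L[ℝ] Vec d) _ _).trans (add_le_add h1 h2)

variable {p κ : ℝ} {n : ℕ} {x : ℕ → ℕ → Vec m} {X : ℕ → ℕ → Fin m → Fin m → ℝ}
  {V : ℕ → ℕ → ℝ}

/-- Facts about `ρ = V ^ (1/p)` on a discrete rough path. -/
theorem IsDiscreteRough.rate (hB : IsDiscreteRough p κ n x X V) (hp2 : 2 < p) {i j : ℕ}
    (hij : i ≤ j) (hj : j ≤ n) :
    0 ≤ V i j ^ (1 / p) ∧ V i j ^ (1 / p) ≤ 2 ∧ V i j ^ (2 / p) = (V i j ^ (1 / p)) ^ 2 ∧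
      V i j ^ (3 / p) = (V i j ^ (1 / p)) ^ 3 ∧ V i j ≤ 2 * (V i j ^ (1 / p)) ^ 2 := by
  have h0 := hB.nonneg i j
  have hp : 0 < p := by linarith
  have h2 : V i j ≤ 2 := by
    have e1 := hB.superadd 0 i j (Nat.zero_le _) hij hj
    have e2 := hB.superadd 0 j n (Nat.zero_le _) hj le_rfl
    linarith [hB.nonneg 0 i, hB.nonneg j n, hB.le_two]
  have e2 : V i j ^ (2 / p) = (V i j ^ (1 / p)) ^ 2 := by
    rw [← Real.rpow_natCast, ← Real.rpow_mul h0]; congr 1; push_cast; ring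
  have e3 : V i j ^ (3 / p) = (V i j ^ (1 / p)) ^ 3 := by
    rw [← Real.rpow_natCast, ← Real.rpow_mul h0]; congr 1; push_cast; ring
  have htwo : ∀ r : ℝ, 0 ≤ r → r ≤ 1 → V i j ^ r ≤ 2 := fun r hr0 hr1 =>
    calc V i j ^ r ≤ 2 ^ r := Real.rpow_le_rpow h0 h2 hr0
      _ ≤ 2 ^ (1 : ℝ) := Real.rpow_le_rpow_of_exponent_le (by norm_num) hr1
      _ = 2 := Real.rpow_one 2
  have hle1 : 2 / p ≤ 1 := by rw [div_le_one hp]; linarith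
  refine ⟨by positivity, htwo _ (by positivity) (by rw [div_le_one hp]; linarith), e2, e3, ?_⟩
  -- Since V ≤ 2 and 2/p ≤ 1, a drift of size V is of order ρ² for ρ = V^(1/p), hence can be
  -- absorbed into the remainder.
  rw [← e2]
  calc V i j = V i j ^ (1 - 2 / p) * V i j ^ (2 / p) := by
        rw [← Real.rpow_add_of_nonneg h0 (by linarith) (by positivity), sub_add_cancel,
          Real.rpow_one]
    _ ≤ 2 * V i j ^ (2 / p) := by
        gcongr
        exact htwo _ (by linarith) (by linarith [show (0 : ℝ) ≤ 2 / p by positivity])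

theorem IsDiscreteRough.rate_mono (hB : IsDiscreteRough p κ n x X V) (hp2 : 2 < p) {i j k l : ℕ}
    (hij : i ≤ j) (hjk : j ≤ k) (hkl : k ≤ l) (hl : l ≤ n) : V j k ^ (1 / p) ≤ V i l ^ (1 / p) := by
  have hp : 0 < p := by linarith
  refine Real.rpow_le_rpow (hB.nonneg _ _) ?_ (by positivity)
  have e1 := hB.superadd i j l hij (by omega) hl
  have e2 := hB.superadd j k l hjk hkl hl
  linarith [hB.nonneg i j, hB.nonneg k l]

theorem IsDiscreteRough.diag (hB : IsDiscreteRough p κ n x X V) {i : ℕ} (hi : i ≤ n) :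
    x i i = 0 ∧ X i i = 0 := by
  have h1 := hB.vec_chen i i i le_rfl le_rfl hi
  have h2 := hB.area_chen i i i le_rfl le_rfl hi
  have h0 : x i i = 0 := by simpa using h1
  refine ⟨h0, ?_⟩
  have h3 : (fun a b => x i i a * x i i b) = (0 : Fin m → Fin m → ℝ) := by
    rw [h0]; ext; simp
  rw [h3, zero_add] at h2
  simpa using h2

theorem IsDiscreteRough.kappa_small {p κ : ℝ} (hp2 : 2 < p) (hp3 : p < 3)
    (hκs : κ * (2000 * sewConst (3 / p)) ≤ 1) (hκ : 0 ≤ κ) :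
    1 < 3 / p ∧ 2 ≤ sewConst (3 / p) ∧ κ ≤ 1 / 4000 := by
  have hp : 0 < p := by linarith
  have hθ : 1 < 3 / p := by rw [lt_div_iff₀ hp]; linarith
  have := two_le_sewConst hθ
  exact ⟨hθ, this, by nlinarith⟩

/-- A priori bound for the remainder of a solution of a rough difference equation. -/
theorem remainder_le_of_scheme (hp2 : 2 < p) (hp3 : p < 3) (hg : NormalizedCoeff g H)
    (hB : IsDiscreteRough p κ n x X V) (hκ : 0 ≤ κ) (hκs : κ * (2000 * sewConst (3 / p)) ≤ 1)
    {a φ : ℕ → Vec d} (ha : ∀ i < n, a (i + 1) = a i + φ i + g (a i) (x i (i + 1))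
      + tensorApply (H (a i)) (X i (i + 1))) (hφ : ∀ i < n, ‖φ i‖ ≤ V i (i + 1)) :
    ∀ k ≤ n, ∀ j ≤ k, ‖a k - a j - g (a j) (x j k)‖ ≤ 4 * (V j k ^ (1 / p)) ^ 2 := by
  obtain ⟨hθ, hC2, hκ1⟩ := IsDiscreteRough.kappa_small hp2 hp3 hκs hκ
  intro k
  induction k using Nat.strong_induction_on with
  | _ k ih =>
  intro hk j hjk
  let Ξ : ℕ → ℕ → Vec d := fun i j => g (a i) (x i j) + tensorApply (H (a i)) (X i j)
  -- The middle index satisfies j < k, so the induction hypothesis covers the remainder between i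
  -- and j. This is why sewing asks for the defect only with j < l. The constant is 23 = 5 + 18,
  -- from the remainder of g and the increment of H.
  have hδ : ∀ i j l, i ≤ j → j < l → l ≤ k →
      ‖Ξ i l - Ξ i j - Ξ j l‖ ≤ 23 * κ * V i l ^ (3 / p) := by
    intro i j l hij hjl hl
    obtain ⟨r0, r2, -, e3, -⟩ := hB.rate hp2 (hij.trans hjl.le) (hl.trans hk)
    rw [e3]
    set ρ := V i l ^ (1 / p)
    have m1 : V i j ^ (1 / p) ≤ ρ := hB.rate_mono hp2 le_rfl hij hjl.le (hl.trans hk)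
    have m2 : V j l ^ (1 / p) ≤ ρ := hB.rate_mono hp2 hij hjl.le le_rfl (hl.trans hk)
    have z1 := (hB.rate hp2 hij (by omega)).1
    have z2 := (hB.rate hp2 hjl.le (by omega)).1
    have hR : ‖a j - a i - g (a i) (x i j)‖ ≤ 4 * ρ ^ 2 :=
      (ih j (by omega) (by omega) i hij).trans (by gcongr)
    have hx1 : ‖x i j‖ ≤ κ * ρ := (hB.vec_le i j hij (by omega)).trans (by gcongr)
    have hx2 : ‖x j l‖ ≤ κ * ρ := (hB.vec_le j l hjl.le (by omega)).trans (by gcongr)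
    have hX2 : tensorNorm (X j l) ≤ κ * ρ ^ 2 := by
      refine (hB.area_le j l hjl.le (by omega)).trans ?_
      rw [(hB.rate hp2 hjl.le (by omega)).2.2.1]
      gcongr
    have hxx : ‖x i j‖ ≤ ρ := by nlinarith
    have hinc : ‖g (a j) - g (a i) - H (a i) (x i j)‖ ≤ 5 * ρ ^ 2 := by
      have := hg.increment_le (a i) (a j) (x i j)
      nlinarith [norm_nonneg (x i j)]
    have haa : ‖a j - a i‖ ≤ 9 * ρ := by
      have h1 : ‖g (a i) (x i j)‖ ≤ 1 * ρ :=
        (ContinuousLinearMap.le_opNorm _ _).trans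
          (mul_le_mul (hg.norm_le _) hxx (norm_nonneg _) zero_le_one)
      have h2 := norm_add_le (a j - a i - g (a i) (x i j)) (g (a i) (x i j))
      rw [sub_add_cancel] at h2
      nlinarith
    have hH : ‖H (a j) - H (a i)‖ ≤ 18 * ρ := by
      linarith [hg.H_lip (a j) (a i)]
    have hid := germ_defect_eq (g (a i)) (g (a j)) (H (a i)) (H (a j)) (x i j) (x j l) (X i j)
      (X j l)
    rw [← hB.vec_chen i j l hij hjl.le (by omega), ← hB.area_chen i j l hij hjl.le (by omega)] at hid
    change ‖_ - _ - _‖ ≤ _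
    rw [hid]
    calc _ ≤ ‖g (a j) - g (a i) - H (a i) (x i j)‖ * ‖x j l‖ +
          ‖H (a j) - H (a i)‖ * tensorNorm (X j l) := by
          refine (norm_sub_le _ _).trans (add_le_add ?_ (norm_tensorApply_le _ _))
          rw [norm_neg]; exact ContinuousLinearMap.le_opNorm _ _
      _ ≤ (5 * ρ ^ 2) * (κ * ρ) + (18 * ρ) * (κ * ρ ^ 2) := by
          have := tensorNorm_nonneg (X j l)
          gcongr
      _ = 23 * κ * ρ ^ 3 := by ring
  have hsew := discrete_sewing hθ (by positivity) hB.nonneg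
    (fun i j l h1 h2 h3 => hB.superadd i j l h1 h2 (h3.trans hk))
    (fun i hi => by
      have := hB.diag (hi.trans hk)
      simp [Ξ, this.1, this.2, tensorApply_zero]) hδ j k hjk le_rfl
  obtain ⟨r0, r2, e2, e3, e1⟩ := hB.rate hp2 hjk hk
  rw [e3] at hsew
  set ρ := V j k ^ (1 / p)
  have hdrift : ‖∑ i ∈ Finset.Ico j k, φ i‖ ≤ 2 * ρ ^ 2 := by
    refine (norm_sum_le _ _).trans ((Finset.sum_le_sum fun i hi => hφ i ?_).trans
      ((sum_Ico_le_of_superadd hB.nonneg hB.superadd hjk hk).trans e1))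
    have := (Finset.mem_Ico.1 hi).2; omega
  have hHX : ‖tensorApply (H (a j)) (X j k)‖ ≤ κ * ρ ^ 2 := by
    have h1 := hB.area_le j k hjk hk
    rw [e2] at h1
    refine (norm_tensorApply_le _ _).trans ((mul_le_mul (hg.H_norm_le _) h1
      (tensorNorm_nonneg _) zero_le_one).trans_eq (one_mul _))
  have hsum : a k - a j = ∑ i ∈ Finset.Ico j k, φ i + ∑ i ∈ Finset.Ico j k, Ξ i (i + 1) := by
    rw [← sum_Ico_sub_eq a hjk, ← Finset.sum_add_distrib]
    refine Finset.sum_congr rfl fun i hi => ?_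
    have := (Finset.mem_Ico.1 hi).2
    rw [ha i (by omega)]
    simp only [Ξ]; abel
  have hid : a k - a j - g (a j) (x j k) = ∑ i ∈ Finset.Ico j k, φ i +
      -(Ξ j k - ∑ i ∈ Finset.Ico j k, Ξ i (i + 1)) + tensorApply (H (a j)) (X j k) := by
    rw [hsum]; simp only [Ξ]; abel
  rw [hid]
  refine (norm_add_three_le hdrift ((norm_neg _).trans_le hsew) hHX).trans ?_
  -- The drift contributes 2ρ², sewing at most 46/2000 of ρ², and the area term at most ρ²/4000; the
  -- total stays below 4ρ².
  have h3 : ρ ^ 3 ≤ 2 * ρ ^ 2 := by nlinarith [sq_nonneg ρ]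
  have h4 : sewConst (3 / p) * (23 * κ * ρ ^ 3) ≤ sewConst (3 / p) * (23 * κ * (2 * ρ ^ 2)) := by
    gcongr
  have h5 : κ * (2000 * sewConst (3 / p)) * ρ ^ 2 ≤ 1 * ρ ^ 2 := by gcongr
  have h6 : κ * ρ ^ 2 ≤ 1 / 4000 * ρ ^ 2 := by gcongr
  nlinarith [sq_nonneg ρ]

set_option maxHeartbeats 1600000 in
/-- A priori bound for the difference of two solutions of a rough difference equation. -/
theorem scheme_sub_le (hp2 : 2 < p) (hp3 : p < 3) (hg : NormalizedCoeff g H)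
    (hB : IsDiscreteRough p κ n x X V) (hκ : 0 ≤ κ) (hκs : κ * (2000 * sewConst (3 / p)) ≤ 1)
    {a φ y ψ : ℕ → Vec d} (ha : ∀ i < n, a (i + 1) = a i + φ i + g (a i) (x i (i + 1))
      + tensorApply (H (a i)) (X i (i + 1))) (hφ : ∀ i < n, ‖φ i‖ ≤ V i (i + 1))
    (hy : ∀ i < n, y (i + 1) = y i + ψ i + g (y i) (x i (i + 1))
      + tensorApply (H (y i)) (X i (i + 1))) {θ : ℝ} (hθV : ∀ i < n, θ ≤ V i (i + 1))
    (hθn : n * θ ≤ 1 / 2) (hθ0 : 0 ≤ θ) (hψ : ∀ i < n, ‖ψ i - φ i‖ ≤ θ * ‖y i - a i‖) :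
    ∀ k ≤ n, ‖y k - a k‖ ≤ 4 * ‖y 0 - a 0‖ ∧
      ‖(y k - a k) - (y 0 - a 0) - ∑ i ∈ Finset.range k, (ψ i - φ i)‖ ≤
        κ * (2000 * sewConst (3 / p)) * ‖y 0 - a 0‖ := by
  obtain ⟨hθ, hC2, hκ1⟩ := IsDiscreteRough.kappa_small hp2 hp3 hκs hκ
  have hRa := remainder_le_of_scheme hp2 hp3 hg hB hκ hκs ha hφ
  set Z := ‖y 0 - a 0‖ with hZdef
  have hZ : 0 ≤ Z := norm_nonneg _
  -- The induction also carries a bound on the difference of the two remainders: the sewing defect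
  -- at stage k needs it, together with the size bound, at indices below k.
  suffices h : ∀ k ≤ n, ‖y k - a k‖ ≤ 4 * Z ∧
      ‖(y k - a k) - (y 0 - a 0) - ∑ i ∈ Finset.range k, (ψ i - φ i)‖ ≤
        κ * (2000 * sewConst (3 / p)) * Z ∧
      ∀ j ≤ k, ‖(y k - y j - g (y j) (x j k)) - (a k - a j - g (a j) (x j k))‖ ≤
        10 * Z * (V j k ^ (1 / p)) ^ 2 from fun k hk => ⟨(h k hk).1, (h k hk).2.1⟩
  intro k
  induction k using Nat.strong_induction_on with
  | _ k ih =>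
  intro hk
  let Ξ : ℕ → ℕ → Vec d := fun i j => (g (y i) (x i j) + tensorApply (H (y i)) (X i j)) -
    (g (a i) (x i j) + tensorApply (H (a i)) (X i j))
  have hδ : ∀ i j l, i ≤ j → j < l → l ≤ k →
      ‖Ξ i l - Ξ i j - Ξ j l‖ ≤ 242 * κ * Z * V i l ^ (3 / p) := by
    intro i j l hij hjl hl
    obtain ⟨r0, r2, -, e3, -⟩ := hB.rate hp2 (hij.trans hjl.le) (hl.trans hk)
    rw [e3]
    set ρ := V i l ^ (1 / p)
    have m1 : V i j ^ (1 / p) ≤ ρ := hB.rate_mono hp2 le_rfl hij hjl.le (hl.trans hk)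
    have m2 : V j l ^ (1 / p) ≤ ρ := hB.rate_mono hp2 hij hjl.le le_rfl (hl.trans hk)
    have z1 := (hB.rate hp2 hij (by omega)).1
    have z2 := (hB.rate hp2 hjl.le (by omega)).1
    have hR : ‖a j - a i - g (a i) (x i j)‖ ≤ 4 * ρ ^ 2 :=
      (hRa j (by omega) i hij).trans (by gcongr)
    have hRz : ‖(y j - y i - g (y i) (x i j)) - (a j - a i - g (a i) (x i j))‖ ≤
        10 * Z * ρ ^ 2 := ((ih j (by omega) (by omega)).2.2 i hij).trans (by gcongr)
    have hz : ‖y i - a i‖ ≤ 4 * Z := (ih i (by omega) (by omega)).1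
    have hx1 : ‖x i j‖ ≤ κ * ρ := (hB.vec_le i j hij (by omega)).trans (by gcongr)
    have hx2 : ‖x j l‖ ≤ κ * ρ := (hB.vec_le j l hjl.le (by omega)).trans (by gcongr)
    have hX2 : tensorNorm (X j l) ≤ κ * ρ ^ 2 := by
      refine (hB.area_le j l hjl.le (by omega)).trans ?_
      rw [(hB.rate hp2 hjl.le (by omega)).2.2.1]
      gcongr
    have hxx : ‖x i j‖ ≤ ρ := by nlinarith
    have hx1' : ‖x i j‖ ≤ 1 := by nlinarith
    have hinc : ‖(g (y j) - g (y i) - H (y i) (x i j)) - (g (a j) - g (a i) - H (a i) (x i j))‖ ≤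
        50 * Z * ρ ^ 2 := by
      refine (hg.increment_sub_le (a i) (a j) (y i) (y j) (x i j) hx1').trans ?_
      calc _ ≤ 10 * Z * ρ ^ 2 + 4 * ρ ^ 2 * (2 * (4 * Z)) + 2 * ρ ^ 2 * (4 * Z) := by gcongr
        _ = 50 * Z * ρ ^ 2 := by ring
    have haa : ‖a j - a i‖ ≤ 9 * ρ := by
      have h1 : ‖g (a i) (x i j)‖ ≤ 1 * ρ :=
        (ContinuousLinearMap.le_opNorm _ _).trans
          (mul_le_mul (hg.norm_le _) hxx (norm_nonneg _) zero_le_one)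
      have h2 := norm_add_le (a j - a i - g (a i) (x i j)) (g (a i) (x i j))
      rw [sub_add_cancel] at h2
      nlinarith
    have hzz : ‖(y j - a j) - (y i - a i)‖ ≤ 24 * Z * ρ := by
      have h1 : ‖(g (y i) - g (a i)) (x i j)‖ ≤ (4 * Z) * ρ :=
        (ContinuousLinearMap.le_opNorm _ _).trans
          (mul_le_mul ((hg.lip _ _).trans hz) hxx (norm_nonneg _) (by positivity))
      have e : (y j - a j) - (y i - a i) = ((y j - y i - g (y i) (x i j)) -
          (a j - a i - g (a i) (x i j))) + (g (y i) - g (a i)) (x i j) := by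
        simp only [sub_apply]; abel
      rw [e]
      refine (norm_add_le_of_le hRz h1).trans ?_
      have : Z * ρ ^ 2 ≤ Z * (2 * ρ) := by
        gcongr; nlinarith
      nlinarith
    have hH : ‖(H (y j) - H (y i)) - (H (a j) - H (a i))‖ ≤ 192 * Z * ρ := by
      refine (hg.H_increment_sub_le (a i) (a j) (y i) (y j)).trans ?_
      calc _ ≤ 2 * (24 * Z * ρ) + 4 * ((9 * ρ) * (4 * Z)) := by gcongr
        _ = 192 * Z * ρ := by ring
    have hid1 := germ_defect_eq (g (y i)) (g (y j)) (H (y i)) (H (y j)) (x i j) (x j l) (X i j)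
      (X j l)
    have hid2 := germ_defect_eq (g (a i)) (g (a j)) (H (a i)) (H (a j)) (x i j) (x j l) (X i j)
      (X j l)
    rw [← hB.vec_chen i j l hij hjl.le (by omega),
      ← hB.area_chen i j l hij hjl.le (by omega)] at hid1 hid2
    have hid : Ξ i l - Ξ i j - Ξ j l =
        -((g (y j) - g (y i) - H (y i) (x i j)) - (g (a j) - g (a i) - H (a i) (x i j))) (x j l) -
        tensorApply ((H (y j) - H (y i)) - (H (a j) - H (a i))) (X j l) := by
      calc Ξ i l - Ξ i j - Ξ j l = _ := (sub_sub_sub_comm_three _ _ _ _ _ _)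
        _ = _ := congrArg₂ (· - ·) hid1 hid2
        _ = _ := by
          simp only [tensorApply_sub_left, sub_apply]; abel
    rw [hid]
    calc _ ≤ ‖(g (y j) - g (y i) - H (y i) (x i j)) - (g (a j) - g (a i) - H (a i) (x i j))‖ *
          ‖x j l‖ + ‖(H (y j) - H (y i)) - (H (a j) - H (a i))‖ * tensorNorm (X j l) := by
          refine (norm_sub_le _ _).trans (add_le_add ?_ (norm_tensorApply_le _ _))
          rw [norm_neg]; exact ContinuousLinearMap.le_opNorm _ _
      _ ≤ (50 * Z * ρ ^ 2) * (κ * ρ) + (192 * Z * ρ) * (κ * ρ ^ 2) := by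
          have := tensorNorm_nonneg (X j l)
          gcongr
      _ = 242 * κ * Z * ρ ^ 3 := by ring
  have hsew := discrete_sewing hθ (by positivity) hB.nonneg
    (fun i j l h1 h2 h3 => hB.superadd i j l h1 h2 (h3.trans hk))
    (fun i hi => by
      have := hB.diag (hi.trans hk)
      simp [Ξ, this.1, this.2, tensorApply_zero]) hδ
  have hsum : ∀ j ≤ k, (y k - a k) - (y j - a j) =
      ∑ i ∈ Finset.Ico j k, (ψ i - φ i) + ∑ i ∈ Finset.Ico j k, Ξ i (i + 1) := by
    intro j hjk
    rw [← sum_Ico_sub_eq (fun i => y i - a i) hjk, ← Finset.sum_add_distrib]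
    refine Finset.sum_congr rfl fun i hi => ?_
    have := (Finset.mem_Ico.1 hi).2
    rw [ha i (by omega), hy i (by omega)]
    simp only [Ξ]; abel
  have hdrift : ∀ j ≤ k, ‖∑ i ∈ Finset.Ico j k, (ψ i - φ i)‖ ≤
      ∑ i ∈ Finset.Ico j k, θ * (4 * Z) := by
    intro j hjk
    refine norm_sum_le_of_le _ fun i hi => ?_
    have := (Finset.mem_Ico.1 hi).2
    exact (hψ i (by omega)).trans (by gcongr; exact (ih i this (by omega)).1)
  have hzbound : ∀ j < k, ‖y j - a j‖ ≤ 4 * Z := fun j hj => (ih j hj (by omega)).1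
  have hgerm : ∀ j ≤ k, ‖Ξ j k - ∑ i ∈ Finset.Ico j k, Ξ i (i + 1)‖ ≤
      484 * sewConst (3 / p) * κ * Z * (V j k ^ (1 / p)) ^ 2 := by
    intro j hjk
    obtain ⟨r0, r2, e2, e3, e1⟩ := hB.rate hp2 hjk hk
    have h := hsew j k hjk le_rfl
    rw [e3] at h
    refine h.trans ?_
    have h3 : (V j k ^ (1 / p)) ^ 3 ≤ 2 * (V j k ^ (1 / p)) ^ 2 := by
      nlinarith [sq_nonneg (V j k ^ (1 / p))]
    calc _ ≤ sewConst (3 / p) * (242 * κ * Z * (2 * (V j k ^ (1 / p)) ^ 2)) := by gcongr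
      _ = _ := by ring
  have hnoise : ‖(y k - a k) - (y 0 - a 0) - ∑ i ∈ Finset.range k, (ψ i - φ i)‖ ≤
      κ * (2000 * sewConst (3 / p)) * Z := by
    obtain ⟨r0, r2, e2, e3, e1⟩ := hB.rate hp2 (Nat.zero_le k) hk
    have h1 : ‖(g (y 0) - g (a 0)) (x 0 k)‖ ≤ Z * (κ * 2) :=
      (ContinuousLinearMap.le_opNorm _ _).trans
        (mul_le_mul (hg.lip _ _) ((hB.vec_le 0 k (Nat.zero_le k) hk).trans (by gcongr))
          (norm_nonneg _) hZ)
    have h2 : ‖tensorApply (H (y 0) - H (a 0)) (X 0 k)‖ ≤ (2 * Z) * (κ * 4) := by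
      refine (norm_tensorApply_le _ _).trans (mul_le_mul (hg.H_lip _ _)
        ((hB.area_le 0 k (Nat.zero_le k) hk).trans ?_) (tensorNorm_nonneg _) (by positivity))
      rw [e2]
      gcongr
      nlinarith
    have h3 := hgerm 0 (Nat.zero_le k)
    have hid : (y k - a k) - (y 0 - a 0) - ∑ i ∈ Finset.range k, (ψ i - φ i) =
        (g (y 0) - g (a 0)) (x 0 k) + tensorApply (H (y 0) - H (a 0)) (X 0 k) +
        -(Ξ 0 k - ∑ i ∈ Finset.Ico 0 k, Ξ i (i + 1)) := by
      rw [hsum 0 (Nat.zero_le k), Nat.Ico_zero_eq_range]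
      simp only [Ξ, tensorApply_sub_left, sub_apply]; abel
    rw [hid]
    refine (norm_add_three_le h1 h2 ((norm_neg _).trans_le h3)).trans ?_
    -- The three noise terms add up to (10 + 1936 C)κZ with C = `sewConst (3 / p)`, and 10 ≤ 64 C
    -- because C ≥ 2.
    have h4 : (V 0 k ^ (1 / p)) ^ 2 ≤ 4 := by nlinarith
    calc _ ≤ Z * (κ * 2) + 2 * Z * (κ * 4) + 484 * sewConst (3 / p) * κ * Z * 4 := by gcongr
      _ = (10 + 1936 * sewConst (3 / p)) * (κ * Z) := by ring
      _ ≤ (2000 * sewConst (3 / p)) * (κ * Z) := by gcongr; linarith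
      _ = _ := by ring
  refine ⟨?_, hnoise, fun j hjk => ?_⟩
  -- The factor 4 reproduces itself: Z from the start, 2Z from the drift since nθ ≤ 1/2, and at most
  -- Z from the noise.
  · have h1 := hdrift 0 (Nat.zero_le k)
    rw [Nat.Ico_zero_eq_range] at h1
    rw [Finset.sum_const, Finset.card_range, nsmul_eq_mul] at h1
    have h2 : (k : ℝ) * (θ * (4 * Z)) ≤ 2 * Z := by
      have : (k : ℝ) ≤ n := by exact_mod_cast hk
      calc (k : ℝ) * (θ * (4 * Z)) ≤ n * (θ * (4 * Z)) := by gcongr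
        _ = (n * θ) * (4 * Z) := by ring
        _ ≤ 1 / 2 * (4 * Z) := by gcongr
        _ = 2 * Z := by ring
    have h3 : κ * (2000 * sewConst (3 / p)) * Z ≤ Z := by nlinarith
    have e : y k - a k = (y 0 - a 0) + ∑ i ∈ Finset.range k, (ψ i - φ i) +
      ((y k - a k) - (y 0 - a 0) - ∑ i ∈ Finset.range k, (ψ i - φ i)) := by abel
    rw [e]
    refine (norm_add_three_le hZdef.ge h1 hnoise).trans ?_
    linarith
  · obtain ⟨r0, r2, e2, e3, e1⟩ := hB.rate hp2 hjk hk
    rcases hjk.eq_or_lt with rfl | hlt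
    · have := hB.diag hk
      simp only [this.1, map_zero, sub_self, norm_zero]
      positivity
    · have h1 : ‖∑ i ∈ Finset.Ico j k, (ψ i - φ i)‖ ≤ 8 * Z * (V j k ^ (1 / p)) ^ 2 := by
        refine (hdrift j hjk).trans ?_
        rw [← Finset.sum_mul]
        have h : ∑ i ∈ Finset.Ico j k, θ ≤ 2 * (V j k ^ (1 / p)) ^ 2 := by
          refine le_trans (Finset.sum_le_sum fun i hi => hθV i ?_)
            ((sum_Ico_le_of_superadd hB.nonneg hB.superadd hjk hk).trans e1)
          have := (Finset.mem_Ico.1 hi).2; omega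
        calc _ ≤ 2 * (V j k ^ (1 / p)) ^ 2 * (4 * Z) := by gcongr
          _ = _ := by ring
      have h2 : ‖tensorApply (H (y j) - H (a j)) (X j k)‖ ≤
          (2 * (4 * Z)) * (κ * (V j k ^ (1 / p)) ^ 2) := by
        refine (norm_tensorApply_le _ _).trans (mul_le_mul ((hg.H_lip _ _).trans ?_)
          ((hB.area_le j k hjk hk).trans_eq (by rw [e2])) (tensorNorm_nonneg _) (by positivity))
        gcongr
        exact hzbound j hlt
      have h3 := hgerm j hjk
      have hid : (y k - y j - g (y j) (x j k)) - (a k - a j - g (a j) (x j k)) =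
          ∑ i ∈ Finset.Ico j k, (ψ i - φ i) + tensorApply (H (y j) - H (a j)) (X j k) +
          -(Ξ j k - ∑ i ∈ Finset.Ico j k, Ξ i (i + 1)) := by
        have : (y k - y j - g (y j) (x j k)) - (a k - a j - g (a j) (x j k)) =
          ((y k - a k) - (y j - a j)) - (g (y j) (x j k) - g (a j) (x j k)) := by abel
        rw [this, hsum j hjk]
        simp only [Ξ, tensorApply_sub_left]; abel
      rw [hid]
      refine (norm_add_three_le h1 h2 ((norm_neg _).trans_le h3)).trans ?_
      set q := Z * (V j k ^ (1 / p)) ^ 2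
      have hq : 0 ≤ q := by positivity
      have : (484 * sewConst (3 / p) * κ) * q ≤ 1 * q := by
        gcongr
        nlinarith
      have : κ * q ≤ 1 / 4000 * q := by gcongr
      calc _ = 8 * q + 8 * (κ * q) + (484 * sewConst (3 / p) * κ) * q := by ring
        _ ≤ 10 * q := by linarith
        _ = _ := by ring

end Core

set_option maxSynthPendingDepth 3

/-! ### Taylor and second-difference estimates for smooth coefficients -/

section Smooth

variable {E F W : Type*} [NormedAddCommGroup E] [NormedSpace ℝ E] [NormedAddCommGroup F]
  [NormedSpace ℝ F] [NormedAddCommGroup W] [NormedSpace ℝ W]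

theorem norm_sub_le_of_hasFDerivAt {f : E → W} {f' : E → E →L[ℝ] W} {C : ℝ}
    (hf : ∀ u, HasFDerivAt f (f' u) u) (hC : ∀ u, ‖f' u‖ ≤ C) (u v : E) :
    ‖f u - f v‖ ≤ C * ‖u - v‖ :=
  convex_univ.norm_image_sub_le_of_norm_hasFDerivWithin_le
    (fun x _ => (hf x).hasFDerivWithinAt) (fun x _ => hC x) (mem_univ v) (mem_univ u)

/-- This is the mean value inequality for w ↦ f(w + s) - f(w). -/
theorem norm_second_difference_le {f : E → W} {f' : E → E →L[ℝ] W} {C : ℝ}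
    (hf : ∀ u, HasFDerivAt f (f' u) u) (hC : ∀ u v, ‖f' u - f' v‖ ≤ C * ‖u - v‖) (u v s : E) :
    ‖(f (u + s) - f u) - (f (v + s) - f v)‖ ≤ C * (‖s‖ * ‖u - v‖) := by
  have := norm_sub_le_of_hasFDerivAt (f := fun w => f (w + s) - f w)
    (f' := fun w => f' (w + s) - f' w) (C := C * ‖s‖)
    (fun w => (HasFDerivAt.comp w (hf (w + s)) ((hasFDerivAt_id w).add_const s)).sub (hf w))
    (fun w => (hC _ _).trans_eq (by rw [add_sub_cancel_left])) u v
  rwa [mul_assoc] at this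

theorem norm_taylor_le {f : E → W} {f' : E → E →L[ℝ] W} {C : ℝ} (hC0 : 0 ≤ C)
    (hf : ∀ u, HasFDerivAt f (f' u) u) (hC : ∀ u v, ‖f' u - f' v‖ ≤ C * ‖u - v‖) (u s : E) :
    ‖f (u + s) - f u - f' u s‖ ≤ C * ‖s‖ ^ 2 := by
  have := (convex_closedBall u ‖s‖).norm_image_sub_le_of_norm_hasFDerivWithin_le' (f := f)
    (φ := f' u) (C := C * ‖s‖) (fun x _ => (hf x).hasFDerivWithinAt)
    (fun x hx => (hC _ _).trans (by
      gcongr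
      exact mem_closedBall_iff_norm.1 hx)) (Metric.mem_closedBall_self (norm_nonneg s))
    (y := u + s) (by simp)
  rw [add_sub_cancel_left] at this
  rwa [pow_two, ← mul_assoc]

variable {g : E → F →L[ℝ] E} {G D : ℝ}

theorem comp_fderiv_hasFDerivAt (hg : ContDiff ℝ 3 g) (u : E) :
    HasFDerivAt (fun u => (fderiv ℝ g u).comp (g u))
      ((ContinuousLinearMap.compL ℝ F E (F →L[ℝ] E) (fderiv ℝ g u)).comp (fderiv ℝ g u) +
        ((ContinuousLinearMap.compL ℝ F E (F →L[ℝ] E)).flip (g u)).comp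
          (fderiv ℝ (fderiv ℝ g) u)) u := by
  have h1 : HasFDerivAt g (fderiv ℝ g u) u := (hg.differentiable (by norm_num) u).hasFDerivAt
  have h2 : HasFDerivAt (fderiv ℝ g) (fderiv ℝ (fderiv ℝ g) u) u :=
    ((hg.fderiv_right (m := 2) (by norm_num)).differentiable (by norm_num) u).hasFDerivAt
  exact h2.clm_comp h1

theorem norm_comp_fderiv_sub_le (h0 : ∀ u, ‖g u‖ ≤ 1) (h1 : ∀ u, ‖fderiv ℝ g u‖ ≤ 1)
    (l0 : ∀ u v, ‖g u - g v‖ ≤ 1 * ‖u - v‖)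
    (l1 : ∀ u v, ‖fderiv ℝ g u - fderiv ℝ g v‖ ≤ 1 * ‖u - v‖) (u v : E) :
    ‖(fderiv ℝ g u).comp (g u) - (fderiv ℝ g v).comp (g v)‖ ≤ 2 * ‖u - v‖ := by
  have e : (fderiv ℝ g u).comp (g u) - (fderiv ℝ g v).comp (g v) =
      (fderiv ℝ g u - fderiv ℝ g v).comp (g u) + (fderiv ℝ g v).comp (g u - g v) := by
    ext; simp
  rw [e]
  calc _ ≤ ‖fderiv ℝ g u - fderiv ℝ g v‖ * ‖g u‖ + ‖fderiv ℝ g v‖ * ‖g u - g v‖ :=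
        norm_add_le_of_le (ContinuousLinearMap.opNorm_comp_le _ _)
          (ContinuousLinearMap.opNorm_comp_le _ _)
    _ ≤ (1 * ‖u - v‖) * 1 + 1 * (1 * ‖u - v‖) := by
        gcongr
        exacts [l1 u v, h0 u, h1 v, l0 u v]
    _ = 2 * ‖u - v‖ := by ring

theorem norm_comp_fderiv_second_le (hg : ContDiff ℝ 3 g) (h0 : ∀ u, ‖g u‖ ≤ G)
    (h1 : ∀ u, ‖fderiv ℝ g u‖ ≤ 1) (h2 : ∀ u, ‖fderiv ℝ (fderiv ℝ g) u‖ ≤ 1)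
    (l0 : ∀ u v, ‖g u - g v‖ ≤ 1 * ‖u - v‖)
    (l1 : ∀ u v, ‖fderiv ℝ g u - fderiv ℝ g v‖ ≤ 1 * ‖u - v‖)
    (l2 : ∀ u v, ‖fderiv ℝ (fderiv ℝ g) u - fderiv ℝ (fderiv ℝ g) v‖ ≤ D * ‖u - v‖)
    (hD : 0 ≤ D) (hGD : G * D ≤ 1) (u v s : E) :
    ‖((fderiv ℝ g (u + s)).comp (g (u + s)) - (fderiv ℝ g u).comp (g u)) -
      ((fderiv ℝ g (v + s)).comp (g (v + s)) - (fderiv ℝ g v).comp (g v))‖ ≤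
      4 * (‖s‖ * ‖u - v‖) := by
  refine norm_second_difference_le (comp_fderiv_hasFDerivAt hg) (fun u v => ?_) u v s
  refine ContinuousLinearMap.opNorm_le_bound _ (by positivity) fun h => ?_
  simp only [sub_apply, add_apply, ContinuousLinearMap.comp_apply,
    ContinuousLinearMap.compL_apply, ContinuousLinearMap.flip_apply]
  have hG : 0 ≤ G := (norm_nonneg _).trans (h0 u)
  have e : (fderiv ℝ g u).comp (fderiv ℝ g u h) + (fderiv ℝ (fderiv ℝ g) u h).comp (g u) -
      ((fderiv ℝ g v).comp (fderiv ℝ g v h) + (fderiv ℝ (fderiv ℝ g) v h).comp (g v)) =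
      ((fderiv ℝ g u - fderiv ℝ g v).comp (fderiv ℝ g u h) +
        (fderiv ℝ g v).comp ((fderiv ℝ g u - fderiv ℝ g v) h)) +
      (((fderiv ℝ (fderiv ℝ g) u - fderiv ℝ (fderiv ℝ g) v) h).comp (g u) +
        (fderiv ℝ (fderiv ℝ g) v h).comp (g u - g v)) := by
    ext; simp; abel
  rw [e]
  have a1 : ‖fderiv ℝ g u h‖ ≤ 1 * ‖h‖ := ContinuousLinearMap.le_of_opNorm_le _ (h1 u) h
  have a2 : ‖(fderiv ℝ g u - fderiv ℝ g v) h‖ ≤ 1 * ‖u - v‖ * ‖h‖ :=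
    ContinuousLinearMap.le_of_opNorm_le _ (l1 u v) h
  have a3 : ‖(fderiv ℝ (fderiv ℝ g) u - fderiv ℝ (fderiv ℝ g) v) h‖ ≤ D * ‖u - v‖ * ‖h‖ :=
    ContinuousLinearMap.le_of_opNorm_le _ (l2 u v) h
  have a4 : ‖fderiv ℝ (fderiv ℝ g) v h‖ ≤ 1 * ‖h‖ :=
    ContinuousLinearMap.le_of_opNorm_le _ (h2 v) h
  calc _ ≤ (‖fderiv ℝ g u - fderiv ℝ g v‖ * ‖fderiv ℝ g u h‖ +
        ‖fderiv ℝ g v‖ * ‖(fderiv ℝ g u - fderiv ℝ g v) h‖) +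
      (‖(fderiv ℝ (fderiv ℝ g) u - fderiv ℝ (fderiv ℝ g) v) h‖ * ‖g u‖ +
        ‖fderiv ℝ (fderiv ℝ g) v h‖ * ‖g u - g v‖) :=
        norm_add_le_of_le
          (norm_add_le_of_le (ContinuousLinearMap.opNorm_comp_le _ _)
            (ContinuousLinearMap.opNorm_comp_le _ _))
          (norm_add_le_of_le (ContinuousLinearMap.opNorm_comp_le _ _)
            (ContinuousLinearMap.opNorm_comp_le _ _))
    _ ≤ ((1 * ‖u - v‖) * (1 * ‖h‖) + 1 * (1 * ‖u - v‖ * ‖h‖)) +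
        ((D * ‖u - v‖ * ‖h‖) * G + (1 * ‖h‖) * (1 * ‖u - v‖)) := by
        gcongr
        exacts [l1 u v, h1 v, h0 u, l0 u v]
    _ = (3 + G * D) * (‖u - v‖ * ‖h‖) := by ring
    _ ≤ (3 + 1) * (‖u - v‖ * ‖h‖) := by gcongr
    _ = 4 * ‖u - v‖ * ‖h‖ := by ring

/-- The Taylor error is differentiated in its base point w. With η = g(w)ξ, symmetry of D²g leaves
the Taylor error of Dg in direction η, of size D‖η‖², and an increment of Dg over η. As ‖η‖ ≤ G‖ξ‖,
the product bound GD ≤ 1 suffices: the third derivative itself may be large. -/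
theorem norm_taylor_sub_le (hg : ContDiff ℝ 3 g) (h0 : ∀ u, ‖g u‖ ≤ G) (hG1 : G ≤ 1)
    (h1 : ∀ u, ‖fderiv ℝ g u‖ ≤ 1)
    (l1 : ∀ u v, ‖fderiv ℝ g u - fderiv ℝ g v‖ ≤ 1 * ‖u - v‖)
    (l2 : ∀ u v, ‖fderiv ℝ (fderiv ℝ g) u - fderiv ℝ (fderiv ℝ g) v‖ ≤ D * ‖u - v‖)
    (hD : 0 ≤ D) (hGD : G * D ≤ 1) (u v : E) (ξ : F) :
    ‖(g (u + g u ξ) - g u - (fderiv ℝ g u).comp (g u) ξ) -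
      (g (v + g v ξ) - g v - (fderiv ℝ g v).comp (g v) ξ)‖ ≤ 2 * ‖ξ‖ ^ 2 * ‖u - v‖ := by
  have d1 : ∀ u, HasFDerivAt g (fderiv ℝ g u) u := fun u =>
    (hg.differentiable (by norm_num) u).hasFDerivAt
  have d2 : ∀ u, HasFDerivAt (fderiv ℝ g) (fderiv ℝ (fderiv ℝ g) u) u := fun u =>
    ((hg.fderiv_right (m := 2) (by norm_num)).differentiable (by norm_num) u).hasFDerivAt
  have hG : 0 ≤ G := (norm_nonneg _).trans (h0 u)
  have dξ : ∀ w, HasFDerivAt (fun w => g w ξ) ((ContinuousLinearMap.apply ℝ E ξ).comp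
      (fderiv ℝ g w)) w := fun w => (ContinuousLinearMap.apply ℝ E ξ).hasFDerivAt.comp w (d1 w)
  have dH : ∀ w, HasFDerivAt (fun w => (fderiv ℝ g w).comp (g w) ξ)
      ((ContinuousLinearMap.apply ℝ (F →L[ℝ] E) ξ).comp _) w := fun w =>
    (ContinuousLinearMap.apply ℝ (F →L[ℝ] E) ξ).hasFDerivAt.comp w (comp_fderiv_hasFDerivAt hg w)
  refine norm_sub_le_of_hasFDerivAt
    (f := fun w => g (w + g w ξ) - g w - (fderiv ℝ g w).comp (g w) ξ)
    (fun w => (((d1 (w + g w ξ)).comp w ((hasFDerivAt_id w).add (dξ w))).sub (d1 w)).sub (dH w))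
    (fun w => ?_) u v
  refine ContinuousLinearMap.opNorm_le_bound _ (by positivity) fun h => ?_
  have hsymm : fderiv ℝ (fderiv ℝ g) w h (g w ξ) = fderiv ℝ (fderiv ℝ g) w (g w ξ) h :=
    (hg.contDiffAt.isSymmSndFDerivAt (by simp; norm_num)) h (g w ξ)
  set η := g w ξ
  have hη : ‖η‖ ≤ G * ‖ξ‖ := ContinuousLinearMap.le_of_opNorm_le _ (h0 w) ξ
  have e : (fderiv ℝ g (w + η)) (h + (fderiv ℝ g w h) ξ) - fderiv ℝ g w h -
      ((fderiv ℝ g w) ((fderiv ℝ g w h) ξ) + (fderiv ℝ (fderiv ℝ g) w h) η) =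
      (fderiv ℝ g (w + η) - fderiv ℝ g w - fderiv ℝ (fderiv ℝ g) w η) h +
      (fderiv ℝ g (w + η) - fderiv ℝ g w) ((fderiv ℝ g w h) ξ) := by
    rw [hsymm]; simp only [map_add, sub_apply]; abel
  have e' : ((fderiv ℝ g (w + η)).comp (ContinuousLinearMap.id ℝ E +
      (ContinuousLinearMap.apply ℝ E ξ).comp (fderiv ℝ g w)) - fderiv ℝ g w -
      (ContinuousLinearMap.apply ℝ (F →L[ℝ] E) ξ).comp
        ((ContinuousLinearMap.compL ℝ F E (F →L[ℝ] E) (fderiv ℝ g w)).comp (fderiv ℝ g w) +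
        ((ContinuousLinearMap.compL ℝ F E (F →L[ℝ] E)).flip (g w)).comp
          (fderiv ℝ (fderiv ℝ g) w))) h =
      (fderiv ℝ g (w + η)) (h + (fderiv ℝ g w h) ξ) - fderiv ℝ g w h -
      ((fderiv ℝ g w) ((fderiv ℝ g w h) ξ) + (fderiv ℝ (fderiv ℝ g) w h) η) := by
    simp [η]
  have t1 := norm_taylor_le hD d2 l2 w η
  have t2 : ‖fderiv ℝ g (w + η) - fderiv ℝ g w‖ ≤ ‖η‖ := by
    have := l1 (w + η) w
    rwa [add_sub_cancel_left, one_mul] at this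
  have t3 : ‖fderiv ℝ g w h‖ ≤ 1 * ‖h‖ := ContinuousLinearMap.le_of_opNorm_le _ (h1 w) h
  have t4 : ‖(fderiv ℝ g w h) ξ‖ ≤ 1 * ‖h‖ * ‖ξ‖ := ContinuousLinearMap.le_of_opNorm_le _ t3 ξ
  refine (congrArg norm (e'.trans e)).trans_le ?_
  calc _ ≤ D * ‖η‖ ^ 2 * ‖h‖ + ‖η‖ * (1 * ‖h‖ * ‖ξ‖) := by
        refine norm_add_le_of_le (ContinuousLinearMap.le_of_opNorm_le _ t1 h) ?_
        exact (ContinuousLinearMap.le_of_opNorm_le _ t2 _).trans (by gcongr)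
    _ ≤ D * (G * ‖ξ‖) ^ 2 * ‖h‖ + (G * ‖ξ‖) * (1 * ‖h‖ * ‖ξ‖) := by gcongr
    _ = ((G * D) * G + G) * (‖ξ‖ ^ 2 * ‖h‖) := by ring
    _ ≤ (1 * 1 + 1) * (‖ξ‖ ^ 2 * ‖h‖) := by gcongr
    _ = 2 * ‖ξ‖ ^ 2 * ‖h‖ := by ring

end Smooth

theorem normalizedCoeff_of_bounds {d m : ℕ} {g : Vec d → Vec m →L[ℝ] Vec d} {G D : ℝ}
    (hg : ContDiff ℝ 3 g) (h0 : ∀ u, ‖g u‖ ≤ G) (hG1 : G ≤ 1) (h1 : ∀ u, ‖fderiv ℝ g u‖ ≤ 1)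
    (h2 : ∀ u, ‖fderiv ℝ (fderiv ℝ g) u‖ ≤ 1)
    (h3 : ∀ u, ‖fderiv ℝ (fderiv ℝ (fderiv ℝ g)) u‖ ≤ D) (hD : 0 ≤ D) (hGD : G * D ≤ 1) :
    NormalizedCoeff g (fun u => (fderiv ℝ g u).comp (g u)) := by
  have hg2 : ContDiff ℝ 2 (fderiv ℝ g) := hg.fderiv_right (by norm_num)
  have hg1 : ContDiff ℝ 1 (fderiv ℝ (fderiv ℝ g)) := hg2.fderiv_right (by norm_num)
  have d1 : ∀ u, HasFDerivAt g (fderiv ℝ g u) u := fun u =>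
    (hg.differentiable (by norm_num) u).hasFDerivAt
  have d2 : ∀ u, HasFDerivAt (fderiv ℝ g) (fderiv ℝ (fderiv ℝ g) u) u := fun u =>
    (hg2.differentiable (by norm_num) u).hasFDerivAt
  have d3 : ∀ u, HasFDerivAt (fderiv ℝ (fderiv ℝ g)) (fderiv ℝ (fderiv ℝ (fderiv ℝ g)) u) u :=
    fun u => (hg1.differentiable (by norm_num) u).hasFDerivAt
  have l0 := norm_sub_le_of_hasFDerivAt d1 h1
  have l1 := norm_sub_le_of_hasFDerivAt d2 h2
  have l2 := norm_sub_le_of_hasFDerivAt d3 h3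
  have h0' : ∀ u, ‖g u‖ ≤ 1 := fun u => (h0 u).trans hG1
  refine ⟨h0', fun u v => (l0 u v).trans_eq (one_mul _), fun u v s =>
    (norm_second_difference_le d1 l1 u v s).trans_eq (one_mul _), fun u => ?_,
    norm_comp_fderiv_sub_le h0' h1 l0 l1,
    norm_comp_fderiv_second_le hg h0 h1 h2 l0 l1 l2 hD hGD, fun u ξ => ?_,
    norm_taylor_sub_le hg h0 hG1 h1 l1 l2 hD hGD⟩
  · refine (ContinuousLinearMap.opNorm_comp_le _ _).trans ?_
    exact mul_le_one₀ (h1 u) (norm_nonneg _) (h0' u)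
  · have t := norm_taylor_le zero_le_one d1 l1 u (g u ξ)
    refine t.trans ?_
    have : ‖g u ξ‖ ≤ 1 * ‖ξ‖ := ContinuousLinearMap.le_of_opNorm_le _ (h0' u) ξ
    rw [one_mul] at this ⊢
    gcongr

/-! ### Reduction to normalised coefficients -/

section Scaling

variable {d m : ℕ} {g : Vec d → Vec m →L[ℝ] Vec d}

theorem le_sq_of_rpow_half_le {x L : ℝ} (hx : 0 ≤ x) (h : x ^ (1 / 2 : ℝ) ≤ L) : x ≤ L ^ 2 := by
  calc x = (x ^ (1 / 2 : ℝ)) ^ 2 := by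
        rw [← Real.rpow_natCast, ← Real.rpow_mul hx]; norm_num
    _ ≤ L ^ 2 := by gcongr

theorem le_cube_of_rpow_third_le {x L : ℝ} (hx : 0 ≤ x) (h : x ^ (1 / 3 : ℝ) ≤ L) : x ≤ L ^ 3 := by
  calc x = (x ^ (1 / 3 : ℝ)) ^ 3 := by
        rw [← Real.rpow_natCast, ← Real.rpow_mul hx]; norm_num
    _ ≤ L ^ 3 := by gcongr

theorem supDeriv_nonneg (k : ℕ) : 0 ≤ supDeriv k g := Real.iSup_nonneg fun _ => norm_nonneg _

theorem Lg_nonneg : 0 ≤ Lg g :=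
  (supDeriv_nonneg 1).trans ((le_max_left _ _).trans (le_max_left _ _))

theorem Lg_bounds : supDeriv 1 g ≤ Lg g ∧ supDeriv 2 g ≤ Lg g ∧
    supDeriv 0 g * supDeriv 1 g ≤ Lg g ^ 2 ∧
    supDeriv 0 g * supDeriv 2 g ≤ Lg g ^ 2 ∧ supDeriv 0 g * supDeriv 3 g ≤ Lg g ^ 2 ∧
    supDeriv 0 g ^ 2 * supDeriv 3 g ≤ Lg g ^ 3 := by
  have n0 := supDeriv_nonneg (g := g) 0
  have n1 := supDeriv_nonneg (g := g) 1
  have n3 := supDeriv_nonneg (g := g) 3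
  have hmax : 0 ≤ max (supDeriv 1 g) (max (supDeriv 2 g) (supDeriv 3 g)) :=
    n1.trans (le_max_left _ _)
  have h2 : supDeriv 0 g * max (supDeriv 1 g) (max (supDeriv 2 g) (supDeriv 3 g)) ≤ Lg g ^ 2 :=
    le_sq_of_rpow_half_le (mul_nonneg n0 hmax) ((le_max_left _ _).trans (le_max_right _ _))
  refine ⟨(le_max_left _ _).trans (le_max_left _ _), (le_max_right _ _).trans (le_max_left _ _),
    (mul_le_mul_of_nonneg_left (le_max_left _ _) n0).trans h2,
    (mul_le_mul_of_nonneg_left ((le_max_left _ _).trans (le_max_right _ _)) n0).trans h2,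
    (mul_le_mul_of_nonneg_left ((le_max_right _ _).trans (le_max_right _ _)) n0).trans h2,
    le_cube_of_rpow_third_le (by positivity) ((le_max_right _ _).trans (le_max_right _ _))⟩

theorem IsC3b.norm_le (hg : IsC3b g) (u : Vec d) : ‖g u‖ ≤ supDeriv 0 g ∧
    ‖fderiv ℝ g u‖ ≤ supDeriv 1 g ∧ ‖fderiv ℝ (fderiv ℝ g) u‖ ≤ supDeriv 2 g ∧
    ‖fderiv ℝ (fderiv ℝ (fderiv ℝ g)) u‖ ≤ supDeriv 3 g := by
  have h : ∀ k ≤ 3, ‖iteratedFDeriv ℝ k g u‖ ≤ supDeriv k g := fun k hk =>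
    le_ciSup (hg.2 k hk) u
  refine ⟨?_, ?_, ?_, ?_⟩
  · simpa using h 0 (by norm_num)
  · have := h 1 (by norm_num)
    rwa [← norm_iteratedFDeriv_fderiv, norm_iteratedFDeriv_zero] at this
  · have := h 2 (by norm_num)
    rwa [← norm_iteratedFDeriv_fderiv, ← norm_iteratedFDeriv_fderiv,
      norm_iteratedFDeriv_zero] at this
  · have := h 3 (by norm_num)
    rwa [← norm_iteratedFDeriv_fderiv, ← norm_iteratedFDeriv_fderiv, ← norm_iteratedFDeriv_fderiv,
      norm_iteratedFDeriv_zero] at this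

/-- The rescaled coefficient `u ↦ g (c u) / (L c)`. -/
def scaledCoeff (g : Vec d → Vec m →L[ℝ] Vec d) (L c : ℝ) (u : Vec d) : Vec m →L[ℝ] Vec d :=
  (L * c)⁻¹ • g (c • u)

theorem fderiv_const_smul_comp_smul {E W : Type*} [NormedAddCommGroup E] [NormedSpace ℝ E]
    [NormedAddCommGroup W] [NormedSpace ℝ W] {f : E → W} (hf : Differentiable ℝ f) (b c : ℝ) :
    fderiv ℝ (fun u => b • f (c • u)) = fun u => (b * c) • fderiv ℝ f (c • u) := by
  funext u
  have h : HasFDerivAt (fun u => f (c • u)) ((fderiv ℝ f (c • u)).comp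
      (c • ContinuousLinearMap.id ℝ E)) u :=
    (hf (c • u)).hasFDerivAt.comp u ((hasFDerivAt_id u).const_smul c)
  have h' : HasFDerivAt (fun u => b • f (c • u)) _ u := h.const_smul b
  rw [h'.fderiv]
  ext v
  simp [smul_smul]

theorem norm_smul_le_of_nonneg {W : Type*} [NormedAddCommGroup W] [NormedSpace ℝ W] {b r : ℝ}
    {v : W} (hb : 0 ≤ b) (hv : ‖v‖ ≤ r) : ‖b • v‖ ≤ b * r := by
  rw [norm_smul, Real.norm_of_nonneg hb]
  gcongr

theorem norm_fderiv_three_smul_le {E W : Type*} [NormedAddCommGroup E] [NormedSpace ℝ E]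
    [NormedAddCommGroup W] [NormedSpace ℝ W] {f : E → W} (hf : ContDiff ℝ 3 f) {D₁ D₂ D₃ b c : ℝ}
    (hb : 0 ≤ b) (hc : 0 ≤ c) (h1 : ∀ u, ‖fderiv ℝ f u‖ ≤ D₁)
    (h2 : ∀ u, ‖fderiv ℝ (fderiv ℝ f) u‖ ≤ D₂)
    (h3 : ∀ u, ‖fderiv ℝ (fderiv ℝ (fderiv ℝ f)) u‖ ≤ D₃) (u : E) :
    ‖fderiv ℝ (fun u => b • f (c • u)) u‖ ≤ b * c * D₁ ∧
    ‖fderiv ℝ (fderiv ℝ (fun u => b • f (c • u))) u‖ ≤ b * c * c * D₂ ∧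
    ‖fderiv ℝ (fderiv ℝ (fderiv ℝ (fun u => b • f (c • u)))) u‖ ≤ b * c * c * c * D₃ := by
  have hf2 : ContDiff ℝ 2 (fderiv ℝ f) := hf.fderiv_right (by norm_num)
  have hf1 : ContDiff ℝ 1 (fderiv ℝ (fderiv ℝ f)) := hf2.fderiv_right (by norm_num)
  have e1 := fderiv_const_smul_comp_smul (hf.differentiable (by norm_num)) b c
  have e2 := fderiv_const_smul_comp_smul (hf2.differentiable (by norm_num)) (b * c) c
  have e3 := fderiv_const_smul_comp_smul (hf1.differentiable (by norm_num)) (b * c * c) c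
  rw [e1, e2, e3]
  exact ⟨norm_smul_le_of_nonneg (by positivity) (h1 _),
    norm_smul_le_of_nonneg (by positivity) (h2 _), norm_smul_le_of_nonneg (by positivity) (h3 _)⟩

theorem fderiv_scaledCoeff (hg : ContDiff ℝ 3 g) {L c : ℝ} (hc : c ≠ 0) :
    fderiv ℝ (scaledCoeff g L c) = fun u => L⁻¹ • fderiv ℝ g (c • u) := by
  have := fderiv_const_smul_comp_smul (hg.differentiable (by norm_num)) (L * c)⁻¹ c
  rw [mul_inv, mul_assoc, inv_mul_cancel₀ hc, mul_one] at this
  rw [← this, ← mul_inv]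
  rfl

/-- The scale c = max(1, G/L) is the least one, subject to c ≥ 1, that makes the rescaled g bounded
by 1. For c = 1 the other two bounds read D₂ ≤ L and GD₃ ≤ L²; for c = G/L they read GD₂ ≤ L² and
G²D₃ ≤ L³. These four conditions explain the form of `Lg`. -/
theorem scaling_bounds {L G D₂ D₃ : ℝ} (hL : 0 < L) (b2 : D₂ ≤ L)
    (b02 : G * D₂ ≤ L ^ 2) (b03 : G * D₃ ≤ L ^ 2) (b003 : G ^ 2 * D₃ ≤ L ^ 3) :
    (L * max 1 (G / L))⁻¹ * G ≤ 1 ∧ L⁻¹ * max 1 (G / L) * D₂ ≤ 1 ∧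
      (L * max 1 (G / L))⁻¹ * G * (L⁻¹ * max 1 (G / L) * max 1 (G / L) * D₃) ≤ 1 := by
  have hc0 : 0 < max 1 (G / L) := lt_of_lt_of_le one_pos (le_max_left _ _)
  have hcG : G / L ≤ max 1 (G / L) := le_max_right _ _
  have hcases := max_choice 1 (G / L)
  set c := max 1 (G / L)
  refine ⟨?_, ?_, ?_⟩
  · rw [inv_mul_le_iff₀ (by positivity), mul_one]
    rw [div_le_iff₀ hL] at hcG; linarith
  · rw [mul_assoc, inv_mul_le_iff₀ hL, mul_one]
    rcases hcases with h | h
    · rw [h]; linarith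
    · rw [h, div_mul_eq_mul_div, div_le_iff₀ hL]; nlinarith
  · have e : (L * c)⁻¹ * G * (L⁻¹ * c * c * D₃) = c * (G * D₃) / L ^ 2 := by
      field_simp
    rw [e, div_le_one (by positivity)]
    rcases hcases with h | h
    · rw [h]; linarith
    · rw [h, div_mul_eq_mul_div, div_le_iff₀ hL]; nlinarith

set_option maxHeartbeats 1000000 in
-- Space is divided by c and the factor L is moved into the noise. The rescaled g then meets all
-- normalised bounds, and its Dg·g is the field displayed here.
theorem normalizedCoeff_scaledCoeff (hg : IsC3b g) (hL : 0 < Lg g) :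
    NormalizedCoeff (scaledCoeff g (Lg g) (max 1 (supDeriv 0 g / Lg g)))
      (fun u => ((Lg g) ^ 2 * max 1 (supDeriv 0 g / Lg g))⁻¹ •
        (fderiv ℝ g (max 1 (supDeriv 0 g / Lg g) • u)).comp
          (g (max 1 (supDeriv 0 g / Lg g) • u))) := by
  set L := Lg g with hLdef
  set c := max 1 (supDeriv 0 g / L) with hcdef
  have hc1 : 1 ≤ c := le_max_left _ _
  have hc0 : 0 < c := by linarith
  obtain ⟨b1, b2, -, b02, b03, b003⟩ := Lg_bounds (g := g)
  rw [← hLdef] at b1 b2 b02 b03 b003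
  obtain ⟨s0, s2, s3⟩ := scaling_bounds hL b2 b02 b03 b003
  rw [← hcdef] at s0 s2 s3
  have n3 := supDeriv_nonneg (g := g) 3
  have hcd : ContDiff ℝ 3 (fun u => (L * c)⁻¹ • g (c • u)) :=
    (hg.1.comp (contDiff_id.const_smul c)).const_smul _
  have hD := norm_fderiv_three_smul_le (b := (L * c)⁻¹) (c := c) hg.1 (by positivity) hc0.le
    (fun u => (hg.norm_le u).2.1) (fun u => (hg.norm_le u).2.2.1) (fun u => (hg.norm_le u).2.2.2)
  have hbc : (L * c)⁻¹ * c = L⁻¹ := by field_simp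
  rw [hbc] at hD
  have key := normalizedCoeff_of_bounds (g := scaledCoeff g L c)
    (G := (L * c)⁻¹ * supDeriv 0 g) (D := L⁻¹ * c * c * supDeriv 3 g) hcd
    (fun u => norm_smul_le_of_nonneg (by positivity) (hg.norm_le _).1) s0
    (fun u => (hD u).1.trans (by rwa [inv_mul_le_iff₀ hL, mul_one]))
    (fun u => (hD u).2.1.trans s2) (fun u => (hD u).2.2) (by positivity) s3
  have e4 : (fun u => (fderiv ℝ (scaledCoeff g L c) u).comp (scaledCoeff g L c u)) =
      fun u => (L ^ 2 * c)⁻¹ • (fderiv ℝ g (c • u)).comp (g (c • u)) := by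
    rw [fderiv_scaledCoeff hg.1 hc0.ne']
    funext u
    refine ContinuousLinearMap.ext fun v => ContinuousLinearMap.ext fun w => ?_
    simp only [scaledCoeff, ContinuousLinearMap.comp_apply, smul_apply, map_smul, smul_smul]
    congr 2
    field_simp
  rw [e4] at key
  exact key

end Scaling

/-! ### The difference estimate in the original variables -/

section Noise

variable {d m : ℕ} {g : Vec d → Vec m →L[ℝ] Vec d} {p κ : ℝ} {n : ℕ} {x : ℕ → ℕ → Vec m}
  {X : ℕ → ℕ → Fin m → Fin m → ℝ} {V : ℕ → ℕ → ℝ}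

/-- Up to a small error, the difference of two solutions of the scheme moves with the drift. -/
theorem scheme_sub_le_of_isC3b (hp2 : 2 < p) (hp3 : p < 3) (hg : IsC3b g) (hL : 0 < Lg g)
    (hB : IsDiscreteRough p κ n (fun i j => Lg g • x i j) (fun i j => (Lg g) ^ 2 • X i j) V)
    (hκ : 0 ≤ κ) (hκs : κ * (2000 * sewConst (3 / p)) ≤ 1)
    {a φ y ψ : ℕ → Vec d} (ha : ∀ i < n, a (i + 1) = a i + φ i + g (a i) (x i (i + 1))
      + tensorApply ((fderiv ℝ g (a i)).comp (g (a i))) (X i (i + 1)))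
    (hφ : ∀ i < n, ‖φ i‖ ≤ V i (i + 1))
    (hy : ∀ i < n, y (i + 1) = y i + ψ i + g (y i) (x i (i + 1))
      + tensorApply ((fderiv ℝ g (y i)).comp (g (y i))) (X i (i + 1)))
    {θ : ℝ} (hθV : ∀ i < n, θ ≤ V i (i + 1))
    (hθn : n * θ ≤ 1 / 2) (hθ0 : 0 ≤ θ) (hψ : ∀ i < n, ‖ψ i - φ i‖ ≤ θ * ‖y i - a i‖) :
    ∀ k ≤ n, ‖y k - a k‖ ≤ 4 * ‖y 0 - a 0‖ ∧
      ‖(y k - a k) - (y 0 - a 0) - ∑ i ∈ Finset.range k, (ψ i - φ i)‖ ≤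
        κ * (2000 * sewConst (3 / p)) * ‖y 0 - a 0‖ := by
  have hN := normalizedCoeff_scaledCoeff hg hL
  set L := Lg g
  set c := max 1 (supDeriv 0 g / L)
  have hc1 : 1 ≤ c := le_max_left _ _
  have hc0 : 0 < c := by linarith
  have hci : c⁻¹ ≤ 1 := inv_le_one_of_one_le₀ hc1
  have hci0 : 0 < c⁻¹ := by positivity
  -- Dividing an orbit by c gives an orbit for the scaled coefficient, driven by Lx and L²𝕏.
  have hrec : ∀ b χ : ℕ → Vec d, (∀ i < n, b (i + 1) = b i + χ i + g (b i) (x i (i + 1))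
      + tensorApply ((fderiv ℝ g (b i)).comp (g (b i))) (X i (i + 1))) →
      ∀ i < n, c⁻¹ • b (i + 1) = c⁻¹ • b i + c⁻¹ • χ i +
        scaledCoeff g L c (c⁻¹ • b i) (L • x i (i + 1)) +
        tensorApply ((L ^ 2 * c)⁻¹ • (fderiv ℝ g (c • c⁻¹ • b i)).comp (g (c • c⁻¹ • b i)))
          (L ^ 2 • X i (i + 1)) := by
    intro b χ hb i hi
    rw [hb i hi, scaledCoeff, smul_smul, mul_inv_cancel₀ hc0.ne', one_smul]
    simp only [smul_add, smul_apply, map_smul, smul_smul, tensorApply_smul_left, tensorApply_smul]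
    have h1 : L * (L * c)⁻¹ = c⁻¹ := by field_simp
    have h2 : L ^ 2 * (L ^ 2 * c)⁻¹ = c⁻¹ := by field_simp
    rw [h1, h2]
  have hscale : ∀ v : Vec d, ‖c⁻¹ • v‖ = c⁻¹ * ‖v‖ := fun v => by
    rw [norm_smul, Real.norm_of_nonneg hci0.le]
  -- The bounds on the difference are homogeneous, so c cancels at the end. The bound on φ is not,
  -- but it survives division by c ≥ 1.
  have key := scheme_sub_le hp2 hp3 hN hB hκ hκs (a := fun i => c⁻¹ • a i) (φ := fun i => c⁻¹ • φ i)
    (y := fun i => c⁻¹ • y i) (ψ := fun i => c⁻¹ • ψ i) (hrec a φ ha)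
    (fun i hi => by
      rw [hscale]
      calc c⁻¹ * ‖φ i‖ ≤ 1 * ‖φ i‖ := by gcongr
        _ ≤ _ := by rw [one_mul]; exact hφ i hi)
    (hrec y ψ hy) hθV hθn hθ0
    (fun i hi => by
      rw [← smul_sub, ← smul_sub, hscale, hscale]
      calc c⁻¹ * ‖ψ i - φ i‖ ≤ c⁻¹ * (θ * ‖y i - a i‖) := by gcongr; exact hψ i hi
        _ = _ := by ring)
  intro k hk
  obtain ⟨k1, k2⟩ := key k hk
  simp only [← smul_sub, ← Finset.smul_sum, hscale] at k1 k2
  constructor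
  · refine le_of_mul_le_mul_left (k1.trans_eq ?_) hci0; ring
  · refine le_of_mul_le_mul_left (k2.trans_eq ?_) hci0; ring

end Noise

/-! ### Growth under the drift -/

section Drift

variable {d : ℕ} {f : Vec d → Vec d}

theorem Lf_nonneg : 0 ≤ Lf f := Real.iSup_nonneg fun _ => norm_nonneg _

theorem norm_sub_le_Lf (hf : ContDiff ℝ 1 f) (hb : BddAbove (range fun y => ‖fderiv ℝ f y‖))
    (u v : Vec d) : ‖f u - f v‖ ≤ Lf f * ‖u - v‖ :=
  norm_sub_le_of_hasFDerivAt (fun u => (hf.differentiable (by norm_num) u).hasFDerivAt)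
    (fun u => le_ciSup hb u) u v

theorem abs_quotient_le (hlip : ∀ u v, ‖f u - f v‖ ≤ Lf f * ‖u - v‖) (y z : Vec d) :
    |inner ℝ (‖z - y‖⁻¹ • (z - y)) (‖z - y‖⁻¹ • (f z - f y))| ≤ Lf f := by
  refine (abs_real_inner_le_norm _ _).trans ?_
  rw [norm_smul, norm_smul, norm_inv, norm_norm]
  rcases eq_or_ne (‖z - y‖) 0 with h | h
  · simp [h, Lf_nonneg]
  · rw [inv_mul_cancel₀ h, one_mul, inv_mul_le_iff₀ (by positivity), mul_comm]
    exact hlip z y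

theorem bddAbove_quotient (hlip : ∀ u v, ‖f u - f v‖ ≤ Lf f * ‖u - v‖) (y : Vec d) (r : ℝ) :
    BddAbove (range fun z : {z : Vec d // 0 < ‖z - y‖ ∧ ‖z - y‖ < r} =>
      inner ℝ (‖z.1 - y‖⁻¹ • (z.1 - y)) (‖z.1 - y‖⁻¹ • (f z.1 - f y))) :=
  ⟨Lf f, by rintro _ ⟨z, rfl⟩; exact (abs_le.1 (abs_quotient_le hlip y z)).2⟩

theorem abs_ellRadius_le (hlip : ∀ u v, ‖f u - f v‖ ≤ Lf f * ‖u - v‖) (y : Vec d) (r : ℝ) :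
    |ellRadius f y r| ≤ Lf f := by
  unfold ellRadius
  rcases isEmpty_or_nonempty {z : Vec d // 0 < ‖z - y‖ ∧ ‖z - y‖ < r} with h | ⟨⟨z⟩⟩
  · rw [Real.iSup_of_isEmpty, abs_zero]; exact Lf_nonneg
  · rw [abs_le]
    constructor
    · exact (abs_le.1 (abs_quotient_le hlip y z.1)).1.trans (le_ciSup (bddAbove_quotient hlip y r) z)
    · have : Nonempty {z : Vec d // 0 < ‖z - y‖ ∧ ‖z - y‖ < r} := ⟨z⟩
      exact ciSup_le fun w => (abs_le.1 (abs_quotient_le hlip y w.1)).2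

theorem inner_le_ellRadius (hlip : ∀ u v, ‖f u - f v‖ ≤ Lf f * ‖u - v‖) (y e : Vec d) {r : ℝ}
    (he : ‖e‖ < r) : inner ℝ e (f (y + e) - f y) ≤ ellRadius f y r * ‖e‖ ^ 2 := by
  rcases eq_or_ne e 0 with rfl | h0
  · simp
  · have hpos : 0 < ‖e‖ := norm_pos_iff.2 h0
    have h : inner ℝ (‖(y + e) - y‖⁻¹ • ((y + e) - y)) (‖(y + e) - y‖⁻¹ • (f (y + e) - f y)) ≤
        ellRadius f y r :=
      le_ciSup (bddAbove_quotient hlip y r) ⟨y + e, by simpa using hpos, by simpa using he⟩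
    simp only [add_sub_cancel_left, real_inner_smul_left, real_inner_smul_right] at h
    rw [← mul_assoc, ← mul_inv, inv_mul_le_iff₀ (by positivity)] at h
    linarith

/-- The logarithmic growth of a drift step of the scheme. -/
def driftRate (f : Vec d → Vec d) (Δ r : ℝ) (y : Vec d) : ℝ :=
  Δ * ellRadius f y r + 1 / 2 * Lf f ^ 2 * Δ ^ 2

/-- Expanding the square gives the factor 1 + 2Δℓ + L_f²Δ², at most the exponential of twice the
drift rate. This is the origin of the term L_f²Δ/2 in η. -/
theorem norm_drift_step_le (hlip : ∀ u v, ‖f u - f v‖ ≤ Lf f * ‖u - v‖) {Δ r : ℝ} (hΔ : 0 ≤ Δ)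
    (y e : Vec d) (he : ‖e‖ < r) :
    ‖e + Δ • (f (y + e) - f y)‖ ≤ Real.exp (driftRate f Δ r y) * ‖e‖ := by
  have h1 := inner_le_ellRadius hlip y e he
  have h2 : ‖f (y + e) - f y‖ ≤ Lf f * ‖e‖ := by simpa using hlip (y + e) y
  refine (sq_le_sq₀ (norm_nonneg _) (by positivity)).1 ?_
  rw [norm_add_sq_real, norm_smul, Real.norm_of_nonneg hΔ, real_inner_smul_right, mul_pow, mul_pow,
    ← Real.exp_nat_mul]
  have h3 : ‖f (y + e) - f y‖ ^ 2 ≤ (Lf f * ‖e‖) ^ 2 := by gcongr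
  have h4 := Real.add_one_le_exp (((2 : ℕ) : ℝ) * driftRate f Δ r y)
  calc ‖e‖ ^ 2 + 2 * (Δ * inner ℝ e (f (y + e) - f y)) + Δ ^ 2 * ‖f (y + e) - f y‖ ^ 2
      ≤ ‖e‖ ^ 2 + 2 * (Δ * (ellRadius f y r * ‖e‖ ^ 2)) + Δ ^ 2 * (Lf f * ‖e‖) ^ 2 := by gcongr
    _ = (((2 : ℕ) : ℝ) * driftRate f Δ r y + 1) * ‖e‖ ^ 2 := by
      rw [driftRate]; push_cast; ring
    _ ≤ _ := by gcongr

theorem driftRate_ge (hlip : ∀ u v, ‖f u - f v‖ ≤ Lf f * ‖u - v‖) {Δ : ℝ} (hΔ : 0 ≤ Δ) (r : ℝ)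
    (y : Vec d) : -(Δ * Lf f) ≤ driftRate f Δ r y ∧ -(1 / 2) ≤ driftRate f Δ r y := by
  have h := (abs_le.1 (abs_ellRadius_le hlip y r)).1
  have h1 : Δ * -Lf f ≤ Δ * ellRadius f y r := by gcongr
  unfold driftRate
  constructor <;> nlinarith [sq_nonneg (Lf f * Δ), sq_nonneg (Lf f * Δ - 1)]

theorem driftRate_le (hlip : ∀ u v, ‖f u - f v‖ ≤ Lf f * ‖u - v‖) {Δ : ℝ} (hΔ : 0 ≤ Δ) (r : ℝ)
    (y : Vec d) : driftRate f Δ r y ≤ Δ * Lf f + 1 / 2 * Lf f ^ 2 * Δ ^ 2 := by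
  have h := (abs_le.1 (abs_ellRadius_le hlip y r)).2
  unfold driftRate
  gcongr

/-- Growth over several steps of a perturbation of the drift dynamics. -/
theorem norm_le_of_perturbed_drift (hlip : ∀ u v, ‖f u - f v‖ ≤ Lf f * ‖u - v‖) {Δ r ε Z : ℝ}
    (hΔ : 0 ≤ Δ) (hε0 : 0 ≤ ε) (hε1 : ε ≤ 1) {n : ℕ} (hn : n * (Δ * Lf f) ≤ 1 / 2)
    {a z : ℕ → Vec d} (hZ : ‖z 0‖ = Z) (hr : 5 * Z < r) (hz : ∀ i ≤ n, ‖z i‖ ≤ 4 * Z)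
    (hnoise : ∀ i ≤ n, ‖z i - z 0 - ∑ l ∈ Finset.range i, Δ • (f (a l + z l) - f (a l))‖ ≤ ε * Z) :
    ‖z n‖ ≤ Z * Real.exp (∑ l ∈ Finset.range n, driftRate f Δ r (a l) + 3 * ε) := by
  have hZ0 : 0 ≤ Z := hZ ▸ norm_nonneg _
  have hLf := Lf_nonneg (f := f)
  let N : ℕ → Vec d := fun i => z i - z 0 - ∑ l ∈ Finset.range i, Δ • (f (a l + z l) - f (a l))
  let e : ℕ → Vec d := fun i => z 0 + ∑ l ∈ Finset.range i, Δ • (f (a l + z l) - f (a l))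
  have hze : ∀ i, z i = e i + N i := fun i => by simp only [e, N]; abel
  have hN : ∀ i ≤ n, ‖N i‖ ≤ ε * Z := hnoise
  -- The accumulated drift factor never falls below 1/2, so an additive error can be factored out of
  -- the exponential at the cost of a factor 2.
  have hH : ∀ i ≤ n, 1 / 2 ≤ Real.exp (∑ l ∈ Finset.range i, driftRate f Δ r (a l)) := by
    intro i hi
    have h1 : ∑ l ∈ Finset.range i, -(Δ * Lf f) ≤ ∑ l ∈ Finset.range i, driftRate f Δ r (a l) :=
      Finset.sum_le_sum fun l _ => (driftRate_ge hlip hΔ r (a l)).1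
    rw [Finset.sum_const, Finset.card_range, nsmul_eq_mul] at h1
    have h2 : (i : ℝ) * (Δ * Lf f) ≤ n * (Δ * Lf f) := by
      have : (i : ℝ) ≤ n := by exact_mod_cast hi
      gcongr
    have := Real.add_one_le_exp (∑ l ∈ Finset.range i, driftRate f Δ r (a l))
    linarith
  have he : ∀ i ≤ n, ‖e i‖ ≤ Real.exp (∑ l ∈ Finset.range i, driftRate f Δ r (a l)) *
      (Z * (1 + 2 * ε * (i * (Δ * Lf f)))) := by
    intro i
    induction i with
    | zero => intro _; simp [e, hZ]
    | succ i ih =>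
      intro hi
      have ih' := ih (by omega)
      -- The pure drift part e differs from z by at most Z, and ‖z‖ ≤ 4Z; hence the requirement 5Z <
      -- r.
      have hei : ‖e i‖ < r := by
        have h1 : e i = z i - N i := by rw [hze i]; abel
        rw [h1]
        have h2 := hz i (by omega)
        have h3 := hN i (by omega)
        have h4 := norm_sub_le (z i) (N i)
        nlinarith
      have hstep : e (i + 1) = (e i + Δ • (f (a i + e i) - f (a i))) +
          Δ • (f (a i + z i) - f (a i + e i)) := by
        have h1 : e (i + 1) = e i + Δ • (f (a i + z i) - f (a i)) := by
          simp only [e, Finset.sum_range_succ]; abel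
        have h2 : Δ • (f (a i + z i) - f (a i)) = Δ • (f (a i + e i) - f (a i)) +
            Δ • (f (a i + z i) - f (a i + e i)) := by
          rw [← smul_add]; congr 1; abel
        calc _ = _ := h1
          _ = e i + (Δ • (f (a i + e i) - f (a i)) + Δ • (f (a i + z i) - f (a i + e i))) := by
            rw [h2]
          _ = _ := (add_assoc _ _ _).symm
      have h1 := norm_drift_step_le hlip hΔ (a i) (e i) hei
      have h2 : ‖Δ • (f (a i + z i) - f (a i + e i))‖ ≤ Δ * (Lf f * (ε * Z)) := by
        rw [norm_smul, Real.norm_of_nonneg hΔ]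
        have h3 := hlip (a i + z i) (a i + e i)
        have h4 : a i + z i - (a i + e i) = N i := by rw [hze i]; abel
        rw [h4] at h3
        have h5 := hN i (by omega)
        calc _ ≤ Δ * (Lf f * ‖N i‖) := by gcongr
          _ ≤ _ := by gcongr
      rw [hstep]
      refine (norm_add_le_of_le h1 h2).trans ?_
      have hE := hH (i + 1) hi
      rw [Finset.sum_range_succ, Real.exp_add] at hE ⊢
      set E := Real.exp (∑ l ∈ Finset.range i, driftRate f Δ r (a l))
      set E' := Real.exp (driftRate f Δ r (a i))
      have hE' : 0 < E' := Real.exp_pos _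
      calc E' * ‖e i‖ + Δ * (Lf f * (ε * Z))
          ≤ E' * (E * (Z * (1 + 2 * ε * (i * (Δ * Lf f))))) +
            (2 * (E * E')) * (Δ * (Lf f * (ε * Z))) := by
            have hw : 0 ≤ Δ * (Lf f * (ε * Z)) := by positivity
            exact add_le_add (mul_le_mul_of_nonneg_left ih' hE'.le)
              (le_mul_of_one_le_left hw (by linarith))
        _ = _ := by push_cast; ring
  have hfin := he n le_rfl
  have hEn := hH n le_rfl
  rw [hze n, Real.exp_add]
  set E := Real.exp (∑ l ∈ Finset.range n, driftRate f Δ r (a l))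
  have h3 := Real.add_one_le_exp (3 * ε)
  -- One ε comes from the errors fed back through the drift, since n·Δ·L_f ≤ 1/2, and 2ε from the
  -- final noise term.
  calc ‖e n + N n‖ ≤ E * (Z * (1 + 2 * ε * (1 / 2))) + (2 * E) * (ε * Z) := by
        refine norm_add_le_of_le (hfin.trans (by gcongr)) ((hN n le_rfl).trans ?_)
        exact le_mul_of_one_le_left (by positivity) (by linarith)
    _ = Z * (E * (3 * ε + 1)) := by ring
    _ ≤ Z * (E * Real.exp (3 * ε)) := by gcongr

end Drift

/-! ### Growth over a single step with noise of arbitrary size -/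

section Step

variable {d m : ℕ} {f : Vec d → Vec d} {g : Vec d → Vec m →L[ℝ] Vec d}

theorem IsC3b.lip (hg : IsC3b g) (u v : Vec d) : ‖g u - g v‖ ≤ Lg g * ‖u - v‖ :=
  norm_sub_le_of_hasFDerivAt (fun u => (hg.1.differentiable (by norm_num) u).hasFDerivAt)
    (fun u => (hg.norm_le u).2.1.trans Lg_bounds.1) u v

theorem IsC3b.comp_fderiv_lip (hg : IsC3b g) (u v : Vec d) :
    ‖(fderiv ℝ g u).comp (g u) - (fderiv ℝ g v).comp (g v)‖ ≤ 2 * Lg g ^ 2 * ‖u - v‖ := by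
  have hg2 : ContDiff ℝ 2 (fderiv ℝ g) := hg.1.fderiv_right (by norm_num)
  have l1 : ‖fderiv ℝ g u - fderiv ℝ g v‖ ≤ supDeriv 2 g * ‖u - v‖ :=
    norm_sub_le_of_hasFDerivAt (fun u => (hg2.differentiable (by norm_num) u).hasFDerivAt)
      (fun u => (hg.norm_le u).2.2.1) u v
  obtain ⟨b1, b2, -, b02, -, -⟩ := Lg_bounds (g := g)
  have n0 := supDeriv_nonneg (g := g) 0
  have n1 := supDeriv_nonneg (g := g) 1
  have n2 := supDeriv_nonneg (g := g) 2
  have nL := Lg_nonneg (g := g)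
  have e : (fderiv ℝ g u).comp (g u) - (fderiv ℝ g v).comp (g v) =
      (fderiv ℝ g u - fderiv ℝ g v).comp (g u) + (fderiv ℝ g v).comp (g u - g v) :=
    ContinuousLinearMap.ext fun x => ContinuousLinearMap.ext fun y => by simp
  rw [e]
  calc _ ≤ ‖fderiv ℝ g u - fderiv ℝ g v‖ * ‖g u‖ + ‖fderiv ℝ g v‖ * ‖g u - g v‖ :=
        norm_add_le_of_le (ContinuousLinearMap.opNorm_comp_le _ _)
          (ContinuousLinearMap.opNorm_comp_le _ _)
    _ ≤ (supDeriv 2 g * ‖u - v‖) * supDeriv 0 g + Lg g * (Lg g * ‖u - v‖) := by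
        gcongr
        exacts [(hg.norm_le u).1, (hg.norm_le v).2.1.trans b1, hg.lip u v]
    _ = (supDeriv 0 g * supDeriv 2 g + Lg g ^ 2) * ‖u - v‖ := by ring
    _ ≤ (Lg g ^ 2 + Lg g ^ 2) * ‖u - v‖ := by gcongr
    _ = _ := by ring

/-- Growth over one step of the scheme. -/
theorem norm_step_le (hlip : ∀ u v, ‖f u - f v‖ ≤ Lf f * ‖u - v‖) (hg : IsC3b g) {Δ r s : ℝ}
    (hΔ : 0 ≤ Δ) (a y : Vec d) (hr : ‖y - a‖ < r) {x : Vec m} {X : Fin m → Fin m → ℝ}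
    (hx : ‖x‖ ≤ s) (hX : tensorNorm X ≤ s ^ 2) :
    ‖(y + Δ • f y + g y x + tensorApply ((fderiv ℝ g y).comp (g y)) X) -
      (a + Δ • f a + g a x + tensorApply ((fderiv ℝ g a).comp (g a)) X)‖ ≤
      ‖y - a‖ * Real.exp (driftRate f Δ r a + 4 * (Lg g * s)) := by
  have nL := Lg_nonneg (g := g)
  have hs : 0 ≤ s := (norm_nonneg _).trans hx
  have h1 := norm_drift_step_le hlip hΔ a (y - a) hr
  rw [add_sub_cancel] at h1
  have h2 : ‖(g y - g a) x‖ ≤ (Lg g * ‖y - a‖) * s :=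
    (ContinuousLinearMap.le_opNorm _ _).trans (by gcongr; exact hg.lip y a)
  have h3 : ‖tensorApply ((fderiv ℝ g y).comp (g y) - (fderiv ℝ g a).comp (g a)) X‖ ≤
      (2 * Lg g ^ 2 * ‖y - a‖) * s ^ 2 :=
    (norm_tensorApply_le _ _).trans (mul_le_mul (hg.comp_fderiv_lip y a) hX (tensorNorm_nonneg _)
      (by positivity))
  have e : (y + Δ • f y + g y x + tensorApply ((fderiv ℝ g y).comp (g y)) X) -
      (a + Δ • f a + g a x + tensorApply ((fderiv ℝ g a).comp (g a)) X) =
      ((y - a) + Δ • (f y - f a)) + (g y - g a) x +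
        tensorApply ((fderiv ℝ g y).comp (g y) - (fderiv ℝ g a).comp (g a)) X := by
    rw [tensorApply_sub_left, sub_apply, smul_sub]; abel
  rw [e]
  refine (norm_add_three_le h1 h2 h3).trans ?_
  have hE : 1 / 2 ≤ Real.exp (driftRate f Δ r a) := by
    have := Real.add_one_le_exp (driftRate f Δ r a)
    linarith [(driftRate_ge hlip hΔ r a).2]
  rw [Real.exp_add]
  set E := Real.exp (driftRate f Δ r a)
  set v := Lg g * s with hv
  have hv0 : 0 ≤ v := by positivity
  -- After the noise terms have been doubled by 1 ≤ 2E, the bracket is 1 + 2v + 4v², which is at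
  -- most this square.
  have h4 : (1 + 2 * v) ^ 2 ≤ Real.exp (4 * v) := by
    have h5 := Real.add_one_le_exp (2 * v)
    calc (1 + 2 * v) ^ 2 ≤ (Real.exp (2 * v)) ^ 2 := by gcongr; linarith
      _ = Real.exp (4 * v) := by rw [← Real.exp_nat_mul]; congr 1; push_cast; ring
  calc E * ‖y - a‖ + Lg g * ‖y - a‖ * s + 2 * Lg g ^ 2 * ‖y - a‖ * s ^ 2
      = ‖y - a‖ * (E + (v + 2 * v ^ 2)) := by rw [hv]; ring
    _ ≤ ‖y - a‖ * (E + (2 * E) * (v + 2 * v ^ 2)) := by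
        gcongr
        exact le_mul_of_one_le_left (by positivity) (by linarith)
    _ ≤ ‖y - a‖ * (E * (1 + 2 * v) ^ 2) := by
        gcongr
        nlinarith [mul_nonneg (Real.exp_pos (driftRate f Δ r a)).le hv0]
    _ ≤ _ := by gcongr

end Step

/-- The rational multiples of `Δ`. -/
def ratGrid (Δ : ℝ) : Set ℝ := range fun q : ℚ => (q : ℝ) * Δ

theorem countable_ratGrid (Δ : ℝ) : (ratGrid Δ).Countable := countable_range _

theorem countable_grid (Δ : ℝ) : (grid Δ).Countable := countable_range _

theorem grid_subset_ratGrid (Δ : ℝ) : grid Δ ⊆ ratGrid Δ := by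
  rintro _ ⟨k, rfl⟩
  exact ⟨k, by simp⟩

/-- The rough path variation along the rational multiples of `Δ`. -/
def ratVar {m : ℕ} (p Δ : ℝ) (ω : ℝ → T2 m) (s t : ℝ) : ℝ≥0∞ :=
  (xVarPow p (ratGrid Δ ∩ Icc s t) ω + areaVarPow p (ratGrid Δ ∩ Icc s t) ω) ^ (1 / p)

/-- There are `n` consecutive intervals in `[a, b]` with end points in `T` which are `bad`. -/
def HasBad (bad : ℝ → ℝ → Prop) (T : Set ℝ) (b : ℝ) : ℕ → ℝ → Prop
  | 0, _ => True
  | n + 1, a => ∃ s ∈ T, ∃ t ∈ T, a ≤ s ∧ s < t ∧ t ≤ b ∧ bad s t ∧ HasBad bad T b n t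

/-! ### Non-overlapping bad intervals and greedy counts -/

section HasBad

variable {bad bad' : ℝ → ℝ → Prop} {T : Set ℝ} {a a' b b' : ℝ} {n k : ℕ}

theorem HasBad.anti_left (h : HasBad bad T b n a) (ha : a' ≤ a) : HasBad bad T b n a' := by
  cases n with
  | zero => trivial
  | succ n =>
    obtain ⟨s, hs, t, ht, h1, h2⟩ := h
    exact ⟨s, hs, t, ht, ha.trans h1, h2⟩

theorem HasBad.imp (h : HasBad bad T b n a) (hb : ∀ s t, bad s t → bad' s t) :
    HasBad bad' T b n a := by
  induction n generalizing a with
  | zero => trivial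
  | succ n ih =>
    obtain ⟨s, hs, t, ht, h1, h2, h3, h4, h5⟩ := h
    exact ⟨s, hs, t, ht, h1, h2, h3, hb _ _ h4, ih h5⟩

theorem HasBad.append (h : HasBad bad T b n a) (h' : HasBad bad T b' k b) (hab : a ≤ b)
    (hbb : b ≤ b') : HasBad bad T b' (k + n) a := by
  induction n generalizing a with
  | zero => exact h'.anti_left hab
  | succ n ih =>
    obtain ⟨s, hs, t, ht, h1, h2, h3, h4, h5⟩ := h
    exact ⟨s, hs, t, ht, h1, h2, h3.trans hbb, h4, ih h5 h3⟩

/-- A bad interval starting at or after τᵢ ends at or after τᵢ₊₁, because the functional grows when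
its left end point decreases. Each bad interval thus uses up at most one stopping time, and the last
one starts strictly before b. -/
theorem greedyTime_lt_of_hasBad {c : ℝ → ℝ → ℝ≥0∞} {γ a₀ : ℝ}
    (hc : ∀ s s' t, s ≤ s' → c s' t ≤ c s t) (i : ℕ)
    (ha : greedyTime c γ a₀ b i ≤ a)
    (h : HasBad (fun s t => ENNReal.ofReal γ ≤ c s t) T b (n + 1) a) :
    greedyTime c γ a₀ b (i + n) < b := by
  induction n generalizing i a with
  | zero =>
    obtain ⟨s, -, t, -, h1, h2, h3, -, -⟩ := h
    exact lt_of_le_of_lt (ha.trans h1) (h2.trans_le h3)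
  | succ n ih =>
    obtain ⟨s, -, t, -, h1, h2, h3, h4, h5⟩ := h
    rw [show i + (n + 1) = i + 1 + n by ring]
    refine ih (i + 1) ?_ h5
    refine csInf_le ⟨min (greedyTime c γ a₀ b i) b, ?_⟩ (Or.inl ⟨?_, ?_⟩)
    · rintro x (hx | rfl)
      · exact (min_le_left _ _).trans hx.1.le
      · exact min_le_right _ _
    · exact lt_of_le_of_lt (ha.trans h1) h2
    · exact h4.trans (hc _ _ _ (ha.trans h1))

/-- From n + 1 bad intervals one gets τₙ < b; the additional 1 in the definition of N* makes the
counts match. -/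
theorem le_greedyCount_of_hasBad {c : ℝ → ℝ → ℝ≥0∞} {γ : ℝ}
    (hc : ∀ s s' t, s ≤ s' → c s' t ≤ c s t)
    (h : HasBad (fun s t => ENNReal.ofReal γ ≤ c s t) T b n a) :
    (n : ℝ≥0∞) ≤ greedyCount c γ a b := by
  cases n with
  | zero => simp
  | succ n =>
    have := greedyTime_lt_of_hasBad (γ := γ) (a₀ := a) hc 0 le_rfl h
    rw [zero_add] at this
    refine le_trans ?_ (le_iSup₂ (f := fun (i : ℕ) (_ : greedyTime c γ a b i < b) =>
      (i : ℝ≥0∞) + 1) n this)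
    simp

theorem one_le_greedyCount {c : ℝ → ℝ → ℝ≥0∞} {γ : ℝ} (hab : a < b) :
    1 ≤ greedyCount c γ a b := by
  refine le_trans ?_ (le_iSup₂ (f := fun (i : ℕ) (_ : greedyTime c γ a b i < b) =>
    (i : ℝ≥0∞) + 1) 0 hab)
  simp

end HasBad

/-! ### From variation bounds on the grid to discrete rough paths -/

section Controls

variable {d m : ℕ} {p : ℝ}

theorem ratVar_le_roughVar (hp : 0 < p) (Δ : ℝ) (ω : ℝ → T2 m) (s t : ℝ) :
    ratVar p Δ ω s t ≤ roughVar p ω s t :=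
  ENNReal.rpow_le_rpow (add_le_add (varPow_mono inter_subset_right)
    (varPow_mono inter_subset_right)) (by positivity)

theorem roughVar_anti (hp : 0 < p) (ω : ℝ → T2 m) (s s' t : ℝ) (h : s ≤ s') :
    roughVar p ω s' t ≤ roughVar p ω s t :=
  ENNReal.rpow_le_rpow (add_le_add (varPow_mono (Icc_subset_Icc_left h))
    (varPow_mono (Icc_subset_Icc_left h))) (by positivity)

theorem controlSum_anti (hp : 0 < p) {α Cp lam : ℝ} (f : Vec d → Vec d)
    (g : Vec d → Vec m →L[ℝ] Vec d) (Δ : ℝ) (a : PathSpace m α → Vec d) (ω : PathSpace m α)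
    (s s' t : ℝ) (h : s ≤ s') :
    controlSum p Cp lam f g Δ a ω s' t ≤ controlSum p Cp lam f g Δ a ω s t := by
  have hsub : grid Δ ∩ Icc s' t ⊆ grid Δ ∩ Icc s t :=
    inter_subset_inter_right _ (Icc_subset_Icc_left h)
  have h1 : t - s' ≤ t - s := by linarith
  have h2 : ENNReal.ofReal (Lf f * (t - s')) ≤ ENNReal.ofReal (Lf f * (t - s)) :=
    ENNReal.ofReal_le_ofReal (mul_le_mul_of_nonneg_left h1 Lf_nonneg)
  have h3 : xVarPow p (grid Δ ∩ Icc s' t) ω.1 ≤ xVarPow p (grid Δ ∩ Icc s t) ω.1 :=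
    varPow_mono hsub
  have h4 : areaVarPow p (grid Δ ∩ Icc s' t) ω.1 ≤ areaVarPow p (grid Δ ∩ Icc s t) ω.1 :=
    varPow_mono hsub
  have h5 : (⨆ u ∈ grid Δ ∩ Icc s' t, ENNReal.ofReal ‖f (a (shift u ω))‖) ≤
      ⨆ u ∈ grid Δ ∩ Icc s t, ENNReal.ofReal ‖f (a (shift u ω))‖ :=
    biSup_mono fun u hu => hsub hu
  have h6 : (0 : ℝ) ≤ 1 / p := by positivity
  have h7 : (0 : ℝ) ≤ 2 / p := by positivity
  unfold controlSum
  dsimp only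
  gcongr

theorem controlSum_self {α Cp lam : ℝ} (hp : 0 < p) (f : Vec d → Vec d)
    (g : Vec d → Vec m →L[ℝ] Vec d) (Δ : ℝ) (a : PathSpace m α → Vec d) (ω : PathSpace m α)
    (s : ℝ) : controlSum p Cp lam f g Δ a ω s s = 0 := by
  have hconst : ∀ u : ℕ → ℝ, (∀ i, u i ∈ grid Δ ∩ Icc s s) → ∀ i, u i = s := fun u hu i =>
    le_antisymm (hu i).2.2 (hu i).2.1
  have h1 : xVarPow p (grid Δ ∩ Icc s s) ω.1 = 0 := by
    refine le_antisymm (varPow_le fun n u _ hu => ?_) bot_le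
    simp [hconst u hu, incr_self, Real.zero_rpow hp.ne']
  have h2 : areaVarPow p (grid Δ ∩ Icc s s) ω.1 = 0 := by
    have h0 : (1 : T2 m).area = 0 := rfl
    refine le_antisymm (varPow_le fun n u _ hu => ?_) bot_le
    have hp2 : p / 2 ≠ 0 := by positivity
    simp [hconst u hu, incr_self, h0, tensorNorm_zero, Real.zero_rpow hp2]
  have h3 : (0 : ℝ) < 1 / p := by positivity
  have h4 : (0 : ℝ) < 2 / p := by positivity
  unfold controlSum
  dsimp only
  rw [h1, h2]
  simp [h4, ENNReal.zero_rpow_of_pos, hp]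

theorem ratVar_self (hp : 0 < p) (Δ : ℝ) (ω : ℝ → T2 m) (s : ℝ) : ratVar p Δ ω s s = 0 := by
  have hconst : ∀ u : ℕ → ℝ, (∀ i, u i ∈ ratGrid Δ ∩ Icc s s) → ∀ i, u i = s := fun u hu i =>
    le_antisymm (hu i).2.2 (hu i).2.1
  have h1 : xVarPow p (ratGrid Δ ∩ Icc s s) ω = 0 := by
    refine le_antisymm (varPow_le fun n u _ hu => ?_) bot_le
    simp [hconst u hu, incr_self, Real.zero_rpow hp.ne']
  have h2 : areaVarPow p (ratGrid Δ ∩ Icc s s) ω = 0 := by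
    have h0 : (1 : T2 m).area = 0 := rfl
    refine le_antisymm (varPow_le fun n u _ hu => ?_) bot_le
    have hp2 : p / 2 ≠ 0 := by positivity
    simp [hconst u hu, incr_self, h0, tensorNorm_zero, Real.zero_rpow hp2]
  rw [ratVar, h1, h2, add_zero, ENNReal.zero_rpow_of_pos (by positivity)]

/-- A bound on the variation over grid points yields a discrete rough path. -/
theorem exists_isDiscreteRough (hp2 : 2 < p) {ω : ℝ → T2 m} {Δ L κ : ℝ} (hΔ : 0 < Δ) (hL : 0 ≤ L)
    (hκ0 : 0 < κ) (hκ1 : κ ≤ 1) (j : ℕ) {n : ℕ}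
    (hx : xVarPow p (grid Δ ∩ Icc ((j : ℝ) * Δ) (((j + n : ℕ) : ℝ) * Δ)) ω ≠ ⊤)
    (hX : areaVarPow p (grid Δ ∩ Icc ((j : ℝ) * Δ) (((j + n : ℕ) : ℝ) * Δ)) ω ≠ ⊤)
    (hle : L ^ p * ((xVarPow p (grid Δ ∩ Icc ((j : ℝ) * Δ) (((j + n : ℕ) : ℝ) * Δ)) ω).toReal +
      (areaVarPow p (grid Δ ∩ Icc ((j : ℝ) * Δ) (((j + n : ℕ) : ℝ) * Δ)) ω).toReal) ≤ κ ^ p) :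
    ∃ V, IsDiscreteRough p κ n
      (fun i k => L • (incr ω (((j + i : ℕ) : ℝ) * Δ) (((j + k : ℕ) : ℝ) * Δ)).vec)
      (fun i k => L ^ 2 • (incr ω (((j + i : ℕ) : ℝ) * Δ) (((j + k : ℕ) : ℝ) * Δ)).area) V ∧
      ∀ i < n, 1 / (2 * (n : ℝ)) ≤ V i (i + 1) := by
  have hp : 0 < p := by linarith
  set t : ℕ → ℝ := fun i => ((j + i : ℕ) : ℝ) * Δ with ht
  have ht0 : t 0 = (j : ℝ) * Δ := by simp [ht]
  have htm : Monotone t := fun i k hik => by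
    have : ((j + i : ℕ) : ℝ) ≤ ((j + k : ℕ) : ℝ) := by exact_mod_cast Nat.add_le_add_left hik j
    exact mul_le_mul_of_nonneg_right this hΔ.le
  have htg : ∀ i, t i ∈ grid Δ := fun i => ⟨j + i, rfl⟩
  let S : ℕ → ℕ → Set ℝ := fun i k => grid Δ ∩ Icc (t i) (t k)
  have hS : ∀ i k, k ≤ n → S i k ⊆ grid Δ ∩ Icc ((j : ℝ) * Δ) (t n) := fun i k hk =>
    inter_subset_inter_right _ (Icc_subset_Icc (ht0 ▸ htm (Nat.zero_le i)) (htm hk))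
  have fx : ∀ i k, k ≤ n → xVarPow p (S i k) ω ≠ ⊤ := fun i k hk =>
    ne_top_of_le_ne_top hx (varPow_mono (hS i k hk))
  have fX : ∀ i k, k ≤ n → areaVarPow p (S i k) ω ≠ ⊤ := fun i k hk =>
    ne_top_of_le_ne_top hX (varPow_mono (hS i k hk))
  let w : ℕ → ℕ → ℝ := fun i k => (L ^ p * ((xVarPow p (S i k) ω).toReal +
    (areaVarPow p (S i k) ω).toReal)) / κ ^ p
  have hκp : 0 < κ ^ p := by positivity
  have hw0 : ∀ i k, 0 ≤ w i k := fun i k => by positivity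
  have hws : ∀ i k l, i ≤ k → k ≤ l → l ≤ n → w i k + w k l ≤ w i l := by
    intro i k l hik hkl hl
    have h1 : (xVarPow p (S i k) ω).toReal + (xVarPow p (S k l) ω).toReal ≤
        (xVarPow p (S i l) ω).toReal := by
      rw [← ENNReal.toReal_add (fx i k (hkl.trans hl)) (fx k l hl)]
      exact ENNReal.toReal_mono (fx i l hl) (varPow_inter_Icc_add_le (htm hik) (htm hkl))
    have h2 : (areaVarPow p (S i k) ω).toReal + (areaVarPow p (S k l) ω).toReal ≤
        (areaVarPow p (S i l) ω).toReal := by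
      rw [← ENNReal.toReal_add (fX i k (hkl.trans hl)) (fX k l hl)]
      exact ENNReal.toReal_mono (fX i l hl) (varPow_inter_Icc_add_le (htm hik) (htm hkl))
    simp only [w]
    rw [← add_div, ← mul_add]
    exact div_le_div_of_nonneg_right
      (mul_le_mul_of_nonneg_left (by linarith) (by positivity)) hκp.le
  have hw1 : w 0 n ≤ 1 := by
    simp only [w, S]
    rw [ht0, div_le_one hκp]
    exact hle
  have hn0 : (0 : ℝ) ≤ 1 / (2 * (n : ℝ)) := by positivity
  -- The normalised variation w has total at most 1, and the linear part has total at most 1/2. The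
  -- linear part gives each single step the share 1/(2n), which is reserved for the drift.
  let V : ℕ → ℕ → ℝ := fun i k => w i k + ((k - i : ℕ) : ℝ) * (1 / (2 * (n : ℝ)))
  have hwV : ∀ i k, w i k ≤ V i k := fun i k => le_add_of_nonneg_right (by positivity)
  have hpow : ∀ i k, κ * w i k ^ (1 / p) = (L ^ p * ((xVarPow p (S i k) ω).toReal +
      (areaVarPow p (S i k) ω).toReal)) ^ (1 / p) := by
    intro i k
    have : κ = (κ ^ p) ^ (1 / p) := by
      rw [← Real.rpow_mul hκ0.le, mul_one_div_cancel hp.ne', Real.rpow_one]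
    conv_lhs => rw [this]
    rw [← Real.mul_rpow hκp.le (hw0 i k)]
    congr 1
    simp only [w]
    field_simp
  have hLpow : L = (L ^ p) ^ (1 / p) := by
    rw [← Real.rpow_mul hL, mul_one_div_cancel hp.ne', Real.rpow_one]
  have hvec : ∀ i k, i ≤ k → k ≤ n → L * ‖(incr ω (t i) (t k)).vec‖ ≤ κ * w i k ^ (1 / p) := by
    intro i k hik hk
    rw [hpow]
    have h := le_varPow_rpow (r := p) (S := S i k) (F := fun s t => ‖(incr ω s t).vec‖) hp
      (norm_nonneg _) ⟨htg i, left_mem_Icc.2 (htm hik)⟩ ⟨htg k, right_mem_Icc.2 (htm hik)⟩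
      (htm hik) (fx i k hk)
    calc L * ‖(incr ω (t i) (t k)).vec‖
        ≤ (L ^ p) ^ (1 / p) * (xVarPow p (S i k) ω).toReal ^ (1 / p) := by
          rw [← hLpow]
          exact mul_le_mul_of_nonneg_left h hL
      _ = (L ^ p * (xVarPow p (S i k) ω).toReal) ^ (1 / p) :=
          (Real.mul_rpow (by positivity) ENNReal.toReal_nonneg).symm
      _ ≤ _ := by
          refine Real.rpow_le_rpow (by positivity) ?_ (by positivity)
          gcongr
          exact le_add_of_nonneg_right ENNReal.toReal_nonneg
  have hsq : ∀ v : ℝ, 0 ≤ v → v ^ (2 / p) = (v ^ (1 / p)) ^ 2 := fun v hv => by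
    rw [← Real.rpow_natCast, ← Real.rpow_mul hv]; congr 1; push_cast; ring
  have harea : ∀ i k, i ≤ k → k ≤ n → L ^ 2 * tensorNorm (incr ω (t i) (t k)).area ≤
      κ * w i k ^ (2 / p) := by
    intro i k hik hk
    have h := le_varPow_rpow (r := p / 2) (S := S i k)
      (F := fun s t => tensorNorm (incr ω s t).area) (by positivity)
      (tensorNorm_nonneg _) ⟨htg i, left_mem_Icc.2 (htm hik)⟩ ⟨htg k, right_mem_Icc.2 (htm hik)⟩
      (htm hik) (fX i k hk)
    rw [show 1 / (p / 2) = 2 / p by field_simp] at h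
    calc L ^ 2 * tensorNorm (incr ω (t i) (t k)).area
        ≤ (L ^ p) ^ (2 / p) * (areaVarPow p (S i k) ω).toReal ^ (2 / p) := by
          rw [hsq (L ^ p) (by positivity), ← hLpow]
          exact mul_le_mul_of_nonneg_left h (by positivity)
      _ = (L ^ p * (areaVarPow p (S i k) ω).toReal) ^ (2 / p) :=
          (Real.mul_rpow (by positivity) ENNReal.toReal_nonneg).symm
      _ ≤ (L ^ p * ((xVarPow p (S i k) ω).toReal +
          (areaVarPow p (S i k) ω).toReal)) ^ (2 / p) := by
          refine Real.rpow_le_rpow (by positivity) ?_ (by positivity)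
          gcongr
          exact le_add_of_nonneg_left ENNReal.toReal_nonneg
      _ = (κ * w i k ^ (1 / p)) ^ 2 := by rw [hsq _ (by positivity), hpow]
      _ = κ ^ 2 * w i k ^ (2 / p) := by rw [hsq _ (hw0 i k)]; ring
      _ ≤ κ * w i k ^ (2 / p) := by
          have := hw0 i k
          gcongr
          nlinarith
  refine ⟨V, ⟨fun i k => add_nonneg (hw0 i k) (by positivity), fun i k l hik hkl hl => ?_, ?_,
    fun i k l _ _ _ => ?_, fun i k l _ _ _ => ?_, fun i k hik hk => ?_, fun i k hik hk => ?_⟩,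
    fun i hi => ?_⟩
  · have h1 := hws i k l hik hkl hl
    have h2 : ((l - i : ℕ) : ℝ) = ((k - i : ℕ) : ℝ) + ((l - k : ℕ) : ℝ) := by
      rw [← Nat.cast_add]; congr 1; omega
    simp only [V, h2]
    linarith
  · simp only [V, Nat.sub_zero]
    have : (n : ℝ) * (1 / (2 * (n : ℝ))) ≤ 1 := by
      rcases Nat.eq_zero_or_pos n with rfl | hn
      · simp
      · have : (0 : ℝ) < n := by exact_mod_cast hn
        field_simp; norm_num
    linarith
  · rw [← smul_add, ← incr_vec_chen]
  · rw [incr_area_chen ω _ (((j + k : ℕ) : ℝ) * Δ) _]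
    ext a b
    simp only [Pi.smul_apply, Pi.add_apply, smul_eq_mul, PiLp.smul_apply]
    ring
  · rw [norm_smul, Real.norm_of_nonneg hL]
    refine (hvec i k hik hk).trans ?_
    have := hw0 i k
    have := hwV i k
    gcongr
  · refine (tensorNorm_smul_le _ _).trans ?_
    rw [abs_of_nonneg (by positivity)]
    refine (harea i k hik hk).trans ?_
    have := hw0 i k
    have := hwV i k
    gcongr
  · have := hw0 i (i + 1)
    simp only [V]
    rw [Nat.add_sub_cancel_left, Nat.cast_one, one_mul]
    linarith

end Controls

/-- `y` is an orbit of the discretization scheme driven by `ω`. -/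
def IsSchemeOrbit {d m : ℕ} (f : Vec d → Vec d) (g : Vec d → Vec m →L[ℝ] Vec d) (Δ : ℝ)
    (ω : ℝ → T2 m) (y : ℕ → Vec d) : Prop :=
  ∀ k : ℕ, y (k + 1) = y k + Δ • f (y k)
    + g (y k) (incr ω ((k : ℝ) * Δ) (((k + 1 : ℕ) : ℝ) * Δ)).vec
    + tensorApply ((fderiv ℝ g (y k)).comp (g (y k)))
        (incr ω ((k : ℝ) * Δ) (((k + 1 : ℕ) : ℝ) * Δ)).area

/-! ### Stretches of small control, and the size of single steps -/

section Blocks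

variable {d m : ℕ} {p Cp lam γ Δ r : ℝ} {f : Vec d → Vec d} {g : Vec d → Vec m →L[ℝ] Vec d}
  {a : PathSpace m (1 / p) → Vec d} {ω : PathSpace m (1 / p)} {b y : ℕ → Vec d}

theorem PathSpace.isHolderOn {α : ℝ} (ω : PathSpace m α) (s t : ℝ) : IsHolderOn α s t ω.1 := by
  have hT : 0 < |s| + |t| + 1 := by positivity
  obtain ⟨C, hC⟩ := (ω.2.2 _ hT).1
  refine ⟨C, fun u v hu huv hv => hC u v ?_ huv ?_⟩
  · have := neg_abs_le s; have := abs_nonneg t; linarith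
  · have := le_abs_self t; have := abs_nonneg s; linarith

/-- Each of the four summands is below lam < 1/2. In the last one lam cancels, so the drift of the
stationary orbit over the stretch is at most 1/2. -/
theorem control_terms_le (hp : 0 < p) (hCp : 0 ≤ Cp) (hlam0 : 0 < lam) (hlam : lam < 1 / 2)
    {s t : ℝ} (hst : s ≤ t) (hS : controlSum p Cp lam f g Δ a ω s t < ENNReal.ofReal lam) :
    Lf f * (t - s) < 1 / 2 ∧
    ((4 * Cp + 1) * Lg g) ^ p * (xVarPow p (grid Δ ∩ Icc s t) ω.1).toReal ≤ 1 ∧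
    ((4 * Cp + 1) * Lg g) ^ p * (areaVarPow p (grid Δ ∩ Icc s t) ω.1).toReal ≤ 1 ∧
    ∀ u ∈ grid Δ ∩ Icc s t, ‖f (a (shift u ω))‖ * (t - s) ≤ 1 / 2 := by
  have nL := Lg_nonneg (g := g)
  have hts : 0 ≤ t - s := by linarith
  have hlam1 : ENNReal.ofReal lam ≤ 1 := by
    rw [← ENNReal.ofReal_one]; exact ENNReal.ofReal_le_ofReal (by linarith)
  unfold controlSum at hS
  dsimp only at hS
  have h1 := lt_of_le_of_lt (le_self_add.trans (le_self_add.trans le_self_add)) hS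
  have h2 := lt_of_le_of_lt (le_add_self.trans (le_self_add.trans le_self_add)) hS
  have h3 := lt_of_le_of_lt (le_add_self.trans le_self_add) hS
  have h4 := lt_of_le_of_lt le_add_self hS
  rw [← Real.mul_rpow (by linarith) nL] at h2 h3
  have key : ∀ (v : ℝ≥0∞) (e : ℝ), 0 < e →
      (ENNReal.ofReal (((4 * Cp + 1) * Lg g) ^ p) * v) ^ e < ENNReal.ofReal lam →
      ((4 * Cp + 1) * Lg g) ^ p * v.toReal ≤ 1 := by
    intro v e he hv
    have h5 : (ENNReal.ofReal (((4 * Cp + 1) * Lg g) ^ p) * v) ≤ 1 := by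
      have : (ENNReal.ofReal (((4 * Cp + 1) * Lg g) ^ p) * v) ^ e ≤ 1 ^ e := by
        rw [ENNReal.one_rpow]; exact hv.le.trans hlam1
      exact (ENNReal.rpow_le_rpow_iff he).1 this
    have h6 := ENNReal.toReal_mono ENNReal.one_ne_top h5
    rwa [ENNReal.toReal_mul, ENNReal.toReal_ofReal (by positivity), ENNReal.toReal_one] at h6
  refine ⟨?_, key _ _ (by positivity) h2, key _ _ (by positivity) h3, fun u hu => ?_⟩
  · exact ((ENNReal.ofReal_lt_ofReal_iff hlam0).1 h1).trans hlam
  · have h5 : ENNReal.ofReal (2 * lam * ‖f (a (shift u ω))‖ * (t - s)) < ENNReal.ofReal lam := by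
      rw [ENNReal.ofReal_mul (by positivity), ENNReal.ofReal_mul (by positivity)]
      refine lt_of_le_of_lt ?_ h4
      gcongr
      exact le_iSup₂ (f := fun u _ => ENNReal.ofReal ‖f (a (shift u ω))‖) u hu
    have h6 := (ENNReal.ofReal_lt_ofReal_iff hlam0).1 h5
    by_contra h
    push Not at h
    nlinarith

theorem var_le_of_ratVar_lt (hp : 0 < p) (hγ0 : 0 < γ) {s t : ℝ} {S : Set ℝ}
    (hS : S ⊆ ratGrid Δ ∩ Icc s t) (h : ratVar p Δ ω.1 s t < ENNReal.ofReal γ) :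
    xVarPow p S ω.1 ≠ ⊤ ∧ areaVarPow p S ω.1 ≠ ⊤ ∧
      (xVarPow p S ω.1).toReal + (areaVarPow p S ω.1).toReal ≤ γ ^ p := by
  have hx : xVarPow p S ω.1 ≠ ⊤ :=
    (xVarPow_lt_top hp (ω.isHolderOn s t) (hS.trans inter_subset_right)).ne
  have hX : areaVarPow p S ω.1 ≠ ⊤ :=
    (areaVarPow_lt_top hp (ω.isHolderOn s t) (hS.trans inter_subset_right)).ne
  refine ⟨hx, hX, ?_⟩
  rw [← ENNReal.toReal_add hx hX]
  refine ENNReal.toReal_le_of_le_ofReal (by positivity) ?_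
  rw [← ENNReal.ofReal_rpow_of_pos hγ0]
  have h1 : xVarPow p S ω.1 + areaVarPow p S ω.1 ≤
      xVarPow p (ratGrid Δ ∩ Icc s t) ω.1 + areaVarPow p (ratGrid Δ ∩ Icc s t) ω.1 :=
    add_le_add (varPow_mono hS) (varPow_mono hS)
  refine h1.trans ?_
  have h2 := ENNReal.rpow_le_rpow h.le hp.le
  rwa [ratVar, ← ENNReal.rpow_mul, one_div_mul_cancel hp.ne', ENNReal.rpow_one] at h2

/-- Growth of the difference of two orbits over a block of small control. -/
theorem good_block_le (hp2 : 2 < p) (hp3 : p < 3) (hlip : ∀ u v, ‖f u - f v‖ ≤ Lf f * ‖u - v‖)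
    (hg : IsC3b g) (hL : 0 < Lg g) (hCp : 1000 * sewConst (3 / p) ≤ Cp) (hlam0 : 0 < lam)
    (hlam : lam < 1 / 2) (hγ0 : 0 < γ) (hΔ : 0 < Δ) (j n : ℕ)
    (hS : controlSum p Cp lam f g Δ a ω ((j : ℝ) * Δ) (((j + n : ℕ) : ℝ) * Δ) < ENNReal.ofReal lam)
    (hγ : ratVar p Δ ω.1 ((j : ℝ) * Δ) (((j + n : ℕ) : ℝ) * Δ) < ENNReal.ofReal γ)
    (hb : ∀ k : ℕ, a (shift ((k : ℝ) * Δ) ω) = b k) (hbs : IsSchemeOrbit f g Δ ω.1 b)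
    (hys : IsSchemeOrbit f g Δ ω.1 y) (hr : 5 * ‖y j - b j‖ < r) :
    ‖y (j + n) - b (j + n)‖ ≤ ‖y j - b j‖ * Real.exp
      (∑ i ∈ Finset.range n, driftRate f Δ r (b (j + i)) +
        6000 * sewConst (3 / p) * (Lg g * γ)) := by
  have hp : 0 < p := by linarith
  have hθ : 1 < 3 / p := by rw [lt_div_iff₀ hp]; linarith
  have hsew := two_le_sewConst hθ
  set sC := sewConst (3 / p)
  have hCp0 : 0 ≤ Cp := by linarith
  have hLf := Lf_nonneg (f := f)
  have htn : ((j : ℝ) * Δ) ≤ (((j + n : ℕ) : ℝ) * Δ) := by push_cast; nlinarith [Nat.cast_nonneg (α := ℝ) n]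
  have htd : (((j + n : ℕ) : ℝ) * Δ) - ((j : ℝ) * Δ) = n * Δ := by push_cast; ring
  obtain ⟨c1, c2, c3, c4⟩ := control_terms_le hp hCp0 hlam0 hlam htn hS
  obtain ⟨fx, fX, hv⟩ := var_le_of_ratVar_lt hp hγ0
    (inter_subset_inter_left _ (grid_subset_ratGrid Δ)) hγ
  rw [htd] at c1 c4
  set X := (xVarPow p (grid Δ ∩ Icc ((j : ℝ) * Δ) (((j + n : ℕ) : ℝ) * Δ)) ω.1).toReal
  set A := (areaVarPow p (grid Δ ∩ Icc ((j : ℝ) * Δ) (((j + n : ℕ) : ℝ) * Δ)) ω.1).toReal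
  -- The first entry makes the cost proportional to `Lg g` γ; the second makes κ small enough for
  -- the a priori bounds, whatever γ is. The 2 accounts for the sum of path and area variation, each
  -- normalised to at most 1.
  set κ := min (Lg g * γ) (2 / (4 * Cp + 1)) with hκdef
  have hκ0 : 0 < κ := lt_min (by positivity) (by positivity)
  have hκ2 : κ ≤ 2 / (4 * Cp + 1) := min_le_right _ _
  have hκs : κ * (2000 * sC) ≤ 1 := by
    calc κ * (2000 * sC) ≤ 2 / (4 * Cp + 1) * (2000 * sC) := by gcongr
      _ ≤ 1 := by rw [div_mul_eq_mul_div, div_le_one (by positivity)]; linarith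
  have hκ1 : κ ≤ 1 := by nlinarith
  have hle : Lg g ^ p * (X + A) ≤ κ ^ p := by
    rcases min_choice (Lg g * γ) (2 / (4 * Cp + 1)) with h | h
    · rw [hκdef, h, Real.mul_rpow hL.le hγ0.le]
      gcongr
    · rw [hκdef, h, Real.div_rpow (by norm_num) (by positivity), le_div_iff₀ (by positivity)]
      rw [Real.mul_rpow (by positivity) hL.le] at c2 c3
      have h2 : (2 : ℝ) ≤ 2 ^ p := by
        conv_lhs => rw [← Real.rpow_one 2]
        exact Real.rpow_le_rpow_of_exponent_le (by norm_num) (by linarith)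
      calc Lg g ^ p * (X + A) * (4 * Cp + 1) ^ p
          = (4 * Cp + 1) ^ p * Lg g ^ p * X + (4 * Cp + 1) ^ p * Lg g ^ p * A := by ring
        _ ≤ 2 ^ p := by linarith
  obtain ⟨V, hV, hVn⟩ := exists_isDiscreteRough hp2 hΔ hL.le hκ0 hκ1 j fx fX hle
  have hnθ : (n : ℝ) * (Δ * Lf f) ≤ 1 / 2 := by nlinarith
  -- A rate whose total over the stretch is at most 1/2 contributes at most 1/(2n) per step, which
  -- is the share reserved in V.
  have hn : ∀ i < n, ∀ v : ℝ, v * (n * Δ) ≤ 1 / 2 → Δ * v ≤ V i (i + 1) := by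
    intro i hi v hv
    refine le_trans ?_ (hVn i hi)
    have : (0 : ℝ) < n := by exact_mod_cast (Nat.zero_le i).trans_lt hi
    rw [le_div_iff₀ (by positivity)]
    linarith
  have hdrift : ∀ i, ‖Δ • f (y (j + i)) - Δ • f (b (j + i))‖ ≤
      Δ * Lf f * ‖y (j + i) - b (j + i)‖ := by
    intro i
    rw [← smul_sub, norm_smul, Real.norm_of_nonneg hΔ.le, mul_assoc]
    gcongr
    exact hlip _ _
  have hest := scheme_sub_le_of_isC3b hp2 hp3 hg hL hV hκ0.le hκs
    (a := fun i => b (j + i)) (φ := fun i => Δ • f (b (j + i)))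
    (y := fun i => y (j + i)) (ψ := fun i => Δ • f (y (j + i))) (θ := Δ * Lf f)
    (fun i _ => hbs (j + i)) (fun i hi => ?_) (fun i _ => hys (j + i))
    (fun i hi => hn i hi _ c1.le) hnθ (by positivity) fun i _ => hdrift i
  · have hfin := norm_le_of_perturbed_drift hlip (r := r) hΔ.le (ε := κ * (2000 * sC))
      (by positivity) hκs hnθ (a := fun i => b (j + i)) (z := fun i => y (j + i) - b (j + i))
      rfl hr (fun i hi => (hest i hi).1) fun i hi => by
        simpa [smul_sub] using (hest i hi).2
    refine hfin.trans ?_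
    simp only [add_zero]
    have h1 : κ ≤ Lg g * γ := min_le_left _ _
    refine mul_le_mul_of_nonneg_left (Real.exp_le_exp.2 (add_le_add_right ?_ _)) (norm_nonneg _)
    nlinarith
  · rw [norm_smul, Real.norm_of_nonneg hΔ.le]
    refine hn i hi _ ?_
    rw [← hb]
    refine c4 _ ⟨⟨j + i, rfl⟩, ?_, ?_⟩
    · push_cast; nlinarith [Nat.cast_nonneg (α := ℝ) i]
    · have : ((j + i : ℕ) : ℝ) ≤ ((j + n : ℕ) : ℝ) := by exact_mod_cast by omega
      exact mul_le_mul_of_nonneg_right this hΔ.le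

theorem HasBad.mono_right {bad : ℝ → ℝ → Prop} {T : Set ℝ} {s t t' : ℝ} {n : ℕ}
    (h : HasBad bad T t n s) (ht : t ≤ t') : HasBad bad T t' n s := by
  induction n generalizing s with
  | zero => trivial
  | succ n ih =>
    obtain ⟨u, hu, v, hv, h1, h2, h3, h4, h5⟩ := h
    exact ⟨u, hu, v, hv, h1, h2, h3.trans ht, h4, ih h5⟩

/-- The homogeneous size, σ for the path and σ² for the area, is subadditive under Chen's relation
since σ² + σσ' + σ'² ≤ (σ + σ')². -/
theorem incr_size_add {ω : ℝ → T2 m} {s t u σ σ' : ℝ} (h1 : ‖(incr ω s t).vec‖ ≤ σ)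
    (h2 : tensorNorm (incr ω s t).area ≤ σ ^ 2) (h1' : ‖(incr ω t u).vec‖ ≤ σ')
    (h2' : tensorNorm (incr ω t u).area ≤ σ' ^ 2) :
    ‖(incr ω s u).vec‖ ≤ σ + σ' ∧ tensorNorm (incr ω s u).area ≤ (σ + σ') ^ 2 := by
  have hσ : 0 ≤ σ := (norm_nonneg _).trans h1
  have hσ' : 0 ≤ σ' := (norm_nonneg _).trans h1'
  constructor
  · rw [incr_vec_chen ω s t u]
    exact (norm_add_le _ _).trans (add_le_add h1 h1')
  · rw [incr_area_chen ω s t u]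
    have e1 := tensorNorm_add_le ((fun i j => (incr ω s t).vec i * (incr ω t u).vec j)
      + (incr ω s t).area) (incr ω t u).area
    have e2 := tensorNorm_add_le (fun i j => (incr ω s t).vec i * (incr ω t u).vec j)
      (incr ω s t).area
    have e3 := tensorNorm_outer_le (incr ω s t).vec (incr ω t u).vec
    have e4 : ‖(incr ω s t).vec‖ * ‖(incr ω t u).vec‖ ≤ σ * σ' := by gcongr
    nlinarith [mul_nonneg hσ hσ']

theorem incr_size_of_ratVar_lt (hp : 0 < p) (hγ0 : 0 < γ) {s t : ℝ} (hs : s ∈ ratGrid Δ)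
    (ht : t ∈ ratGrid Δ) (hst : s ≤ t) (h : ratVar p Δ ω.1 s t < ENNReal.ofReal γ) :
    ‖(incr ω.1 s t).vec‖ ≤ γ ∧ tensorNorm (incr ω.1 s t).area ≤ γ ^ 2 := by
  obtain ⟨fx, fX, hv⟩ := var_le_of_ratVar_lt hp hγ0 Subset.rfl h
  have hs' : s ∈ ratGrid Δ ∩ Icc s t := ⟨hs, left_mem_Icc.2 hst⟩
  have ht' : t ∈ ratGrid Δ ∩ Icc s t := ⟨ht, right_mem_Icc.2 hst⟩
  have h1 := le_varPow_rpow (F := fun s t => ‖(incr ω.1 s t).vec‖) hp (norm_nonneg _) hs' ht' hst fx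
  have h2 := le_varPow_rpow (r := p / 2) (F := fun s t => tensorNorm (incr ω.1 s t).area)
    (by positivity) (tensorNorm_nonneg _) hs' ht' hst fX
  constructor
  · refine h1.trans ?_
    calc _ ≤ (γ ^ p) ^ (1 / p) := Real.rpow_le_rpow ENNReal.toReal_nonneg
          ((le_add_of_nonneg_right ENNReal.toReal_nonneg).trans hv) (by positivity)
      _ = γ := by rw [← Real.rpow_mul hγ0.le, mul_one_div_cancel hp.ne', Real.rpow_one]
  · refine h2.trans ?_
    calc _ ≤ (γ ^ p) ^ (1 / (p / 2)) := Real.rpow_le_rpow ENNReal.toReal_nonneg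
          ((le_add_of_nonneg_left ENNReal.toReal_nonneg).trans hv) (by positivity)
      _ = γ ^ 2 := by
        rw [← Real.rpow_mul hγ0.le, ← Real.rpow_natCast]; congr 1; field_simp; norm_num

/-- The partition is cut greedily. Each cut consists of a piece of variation below γ, hence of size
at most γ, and of one fine step of size at most γ; together they form a bad interval of size at most
2γ. The last piece adds γ. -/
theorem exists_hasBad_of_fine (hp : 0 < p) (hγ0 : 0 < γ) {u : ℕ → ℝ} (hu : Monotone u)
    (huT : ∀ i, u i ∈ ratGrid Δ) {N : ℕ}
    (hstep : ∀ i < N, ‖(incr ω.1 (u i) (u (i + 1))).vec‖ ≤ γ ∧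
      tensorNorm (incr ω.1 (u i) (u (i + 1))).area ≤ γ ^ 2) (i j : ℕ) (hij : i + j = N) :
    ∃ n : ℕ, HasBad (fun s t => ENNReal.ofReal γ ≤ ratVar p Δ ω.1 s t) (ratGrid Δ) (u N) n (u j) ∧
      ‖(incr ω.1 (u j) (u N)).vec‖ ≤ γ * (2 * n + 1) ∧
      tensorNorm (incr ω.1 (u j) (u N)).area ≤ (γ * (2 * n + 1)) ^ 2 := by
  induction i using Nat.strong_induction_on generalizing j with
  | _ i ih =>
    rcases exists_switch (P := fun k => ratVar p Δ ω.1 (u j) (u k) < ENNReal.ofReal γ)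
      (j := j) (M := N) (by simp [ratVar_self hp, hγ0]) (by omega) with h | ⟨k, h1, h2, h3, h4⟩
    · refine ⟨0, trivial, ?_⟩
      simpa using incr_size_of_ratVar_lt hp hγ0 (huT j) (huT N) (hu (by omega)) h
    · obtain ⟨n, hn, hx, hX⟩ := ih (N - (k + 1)) (by omega) (k + 1) (by omega)
      obtain ⟨gx, gX⟩ := incr_size_of_ratVar_lt hp hγ0 (huT j) (huT k) (hu h1) h3
      obtain ⟨sx, sX⟩ := hstep k h2
      obtain ⟨ax, aX⟩ := incr_size_add gx gX sx sX
      obtain ⟨bx, bX⟩ := incr_size_add ax aX hx hX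
      have e : γ + γ + γ * (2 * n + 1) = γ * (2 * ((n + 1 : ℕ) : ℝ) + 1) := by push_cast; ring
      rw [e] at bx bX
      refine ⟨n + 1, ⟨u j, huT j, u (k + 1), huT _, le_rfl, ?_, hu (by omega), not_lt.1 h4, hn⟩,
        bx, bX⟩
      -- The bad interval is nondegenerate, since the variation over a single point is 0 < γ.
      refine lt_of_le_of_ne (hu (by omega)) fun he => h4 ?_
      rw [← he, ratVar_self hp]
      simpa using hγ0

/-- The increment over one grid step is controlled by the number of bad intervals in it. -/
theorem exists_hasBad_step (hp : 0 < p) (hγ0 : 0 < γ) (hΔ : 0 < Δ) (k : ℕ) :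
    ∃ n : ℕ, HasBad (fun s t => ENNReal.ofReal γ ≤ ratVar p Δ ω.1 s t) (ratGrid Δ)
        (((k + 1 : ℕ) : ℝ) * Δ) n ((k : ℝ) * Δ) ∧
      ‖(incr ω.1 ((k : ℝ) * Δ) (((k + 1 : ℕ) : ℝ) * Δ)).vec‖ ≤ γ * (2 * n + 1) ∧
      tensorNorm (incr ω.1 ((k : ℝ) * Δ) (((k + 1 : ℕ) : ℝ) * Δ)).area ≤
        (γ * (2 * n + 1)) ^ 2 := by
  obtain ⟨C, hC⟩ := ω.isHolderOn ((k : ℝ) * Δ) (((k + 1 : ℕ) : ℝ) * Δ)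
  have ht : ∀ e : ℝ, 0 < e → Tendsto (fun N : ℕ => C * (Δ / ((N : ℝ) + 1)) ^ e) atTop (𝓝 0) := by
    intro e he
    have h1 : Tendsto (fun N : ℕ => Δ / ((N : ℝ) + 1)) atTop (𝓝 0) := by
      have := (tendsto_one_div_add_atTop_nhds_zero_nat (𝕜 := ℝ)).const_mul Δ
      simpa [div_eq_mul_inv] using this
    have h2 := (h1.rpow_const (p := e) (Or.inr he.le)).const_mul C
    simpa [Real.zero_rpow he.ne'] using h2
  have e1 := (ht (1 / p) (by positivity)).eventually_le_const hγ0
  have e2 := (ht (2 * (1 / p)) (by positivity)).eventually_le_const (pow_pos hγ0 2)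
  -- Hölder continuity makes the increments small on a sufficiently fine subdivision of the grid
  -- step. Its points are rational multiples of Δ.
  obtain ⟨N, h1, h2⟩ := (e1.and e2).exists
  have hN : (0 : ℝ) < (N : ℝ) + 1 := by positivity
  let u : ℕ → ℝ := fun i => ((k : ℝ) + i / ((N : ℝ) + 1)) * Δ
  have hum : Monotone u := fun i j hij => by
    have : (i : ℝ) ≤ j := by exact_mod_cast hij
    simp only [u]
    gcongr
  have hu0 : u 0 = (k : ℝ) * Δ := by simp [u]
  have huN : u (N + 1) = ((k + 1 : ℕ) : ℝ) * Δ := by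
    simp only [u]; push_cast; rw [div_self hN.ne']
  have hud : ∀ i, u (i + 1) - u i = Δ / ((N : ℝ) + 1) := fun i => by
    simp only [u]; push_cast; field_simp; ring
  have := exists_hasBad_of_fine (ω := ω) (Δ := Δ) (N := N + 1) hp hγ0 hum
    (fun i => ⟨k + i / ((N : ℚ) + 1), by simp [u]⟩) (fun i hi => ?_) (N + 1) 0 (by omega)
  · rwa [hu0, huN] at this
  · have hlt : u i < u (i + 1) := by
      have := hud i
      have h0 : 0 < Δ / ((N : ℝ) + 1) := by positivity
      linarith
    obtain ⟨c1, c2⟩ := hC (u i) (u (i + 1)) (hu0 ▸ hum (Nat.zero_le i)) hlt (huN ▸ hum (by omega))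
    rw [hud] at c1 c2
    exact ⟨c1.trans h1, c2.trans h2⟩

end Blocks

/-! ### Growth over a block of length at most one -/

section BlockGrowth

variable {d m : ℕ} {p Cp lam γ Δ r : ℝ} {f : Vec d → Vec d} {g : Vec d → Vec m →L[ℝ] Vec d}
  {a : PathSpace m (1 / p) → Vec d} {ω : PathSpace m (1 / p)} {b y : ℕ → Vec d}

/-- Growth over one step of the scheme, in terms of the number of bad intervals. -/
theorem single_step_le (hlip : ∀ u v, ‖f u - f v‖ ≤ Lf f * ‖u - v‖) (hg : IsC3b g) (hΔ : 0 < Δ)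
    {s : ℝ} {k : ℕ} (hx : ‖(incr ω.1 ((k : ℝ) * Δ) (((k + 1 : ℕ) : ℝ) * Δ)).vec‖ ≤ s)
    (hX : tensorNorm (incr ω.1 ((k : ℝ) * Δ) (((k + 1 : ℕ) : ℝ) * Δ)).area ≤ s ^ 2)
    (hbs : IsSchemeOrbit f g Δ ω.1 b) (hys : IsSchemeOrbit f g Δ ω.1 y) (hr : ‖y k - b k‖ < r) :
    ‖y (k + 1) - b (k + 1)‖ ≤
      ‖y k - b k‖ * Real.exp (driftRate f Δ r (b k) + 4 * (Lg g * s)) := by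
  rw [hys k, hbs k]
  exact norm_step_le hlip hg hΔ.le _ _ hr hx hX

/-- The cost constant of a bad interval. -/
def badCost (p : ℝ) : ℝ := 6000 * sewConst (3 / p) + 12

/-- Let k be a step across which one of the two functionals reaches its level. The stretch up to k
and the step after it together cost `6000 * sewConst (3 / p) + 4 * (2 * n' + 1)`, in units of `Lg g`
γ, where n' counts bad intervals inside that step. If n' ≥ 1, they pay for it. If n' = 0, the whole
stretch including the step is itself a bad interval for one of the functionals and pays. Charging to
only one kind keeps the intervals non-overlapping. The 1 in the count pays for the last, incomplete
stretch. -/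
theorem block_le_of_drop (hp2 : 2 < p) (hp3 : p < 3)
    (hlip : ∀ u v, ‖f u - f v‖ ≤ Lf f * ‖u - v‖)
    (hg : IsC3b g) (hL : 0 < Lg g) (hCp : 1000 * sewConst (3 / p) ≤ Cp) (hlam0 : 0 < lam)
    (hlam : lam < 1 / 2) (hγ0 : 0 < γ) (hΔ : 0 < Δ)
    (hb : ∀ k : ℕ, a (shift ((k : ℝ) * Δ) ω) = b k) (hbs : IsSchemeOrbit f g Δ ω.1 b)
    (hys : IsSchemeOrbit f g Δ ω.1 y) (M : ℕ) (i j : ℕ) (hij : j + i = M)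
    (hr : ∀ k < M, 5 * ‖y k - b k‖ < r) :
    ∃ nS nγ : ℕ,
      HasBad (fun s t => ENNReal.ofReal lam ≤ controlSum p Cp lam f g Δ a ω s t) (ratGrid Δ)
        ((M : ℝ) * Δ) nS ((j : ℝ) * Δ) ∧
      HasBad (fun s t => ENNReal.ofReal γ ≤ ratVar p Δ ω.1 s t) (ratGrid Δ)
        ((M : ℝ) * Δ) nγ ((j : ℝ) * Δ) ∧
      ‖y M - b M‖ ≤ ‖y j - b j‖ * Real.exp (∑ l ∈ Finset.Ico j M, driftRate f Δ r (b l) +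
        badCost p * (Lg g * γ) * (1 + nS + nγ)) := by
  have hp : 0 < p := by linarith
  have hsew := two_le_sewConst (θ := 3 / p) (by rw [lt_div_iff₀ hp]; linarith)
  have hC0 : 0 ≤ badCost p := by unfold badCost; linarith
  have hLγ : 0 < Lg g * γ := by positivity
  have hmem : ∀ k : ℕ, (k : ℝ) * Δ ∈ ratGrid Δ := fun k => grid_subset_ratGrid Δ ⟨k, rfl⟩
  have hmono : ∀ k l : ℕ, k ≤ l → (k : ℝ) * Δ ≤ (l : ℝ) * Δ := fun k l h => by
    have : (k : ℝ) ≤ l := by exact_mod_cast h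
    gcongr
  induction i using Nat.strong_induction_on generalizing j with
  | _ i ih =>
    rcases Nat.eq_zero_or_pos i with rfl | hi
    · obtain rfl : j = M := by omega
      refine ⟨0, 0, trivial, trivial, ?_⟩
      simp only [Finset.Ico_self, Finset.sum_empty, zero_add]
      refine le_mul_of_one_le_right (norm_nonneg _) (Real.one_le_exp ?_)
      positivity
    have hgood : ∀ n, controlSum p Cp lam f g Δ a ω ((j : ℝ) * Δ) (((j + n : ℕ) : ℝ) * Δ) <
        ENNReal.ofReal lam → ratVar p Δ ω.1 ((j : ℝ) * Δ) (((j + n : ℕ) : ℝ) * Δ) <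
        ENNReal.ofReal γ → ‖y (j + n) - b (j + n)‖ ≤ ‖y j - b j‖ * Real.exp
          (∑ l ∈ Finset.Ico j (j + n), driftRate f Δ r (b l) +
          6000 * sewConst (3 / p) * (Lg g * γ)) := by
      intro n h1 h2
      rw [Finset.sum_Ico_eq_sum_range, Nat.add_sub_cancel_left]
      exact good_block_le hp2 hp3 hlip hg hL hCp hlam0 hlam hγ0 hΔ j n h1 h2 hb hbs hys
        (hr j (by omega))
    rcases exists_switch (P := fun k =>
      controlSum p Cp lam f g Δ a ω ((j : ℝ) * Δ) ((k : ℝ) * Δ) < ENNReal.ofReal lam ∧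
        ratVar p Δ ω.1 ((j : ℝ) * Δ) ((k : ℝ) * Δ) < ENNReal.ofReal γ) (j := j) (M := M)
      (by rw [controlSum_self hp, ratVar_self hp]; simp [hlam0, hγ0]) (by omega) with
      h | ⟨k, h1, h2, h3, h4⟩
    · refine ⟨0, 0, trivial, trivial, ?_⟩
      have h5 := hgood i (by rw [hij]; exact h.1) (by rw [hij]; exact h.2)
      rw [hij] at h5
      refine h5.trans ?_
      refine mul_le_mul_of_nonneg_left (Real.exp_le_exp.2 (add_le_add_right ?_ _)) (norm_nonneg _)
      unfold badCost
      push_cast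
      nlinarith
    · obtain ⟨n, rfl⟩ := Nat.exists_eq_add_of_le h1
      have e1 := hgood n h3.1 h3.2
      obtain ⟨n', hn', hx, hX⟩ := exists_hasBad_step (ω := ω) hp hγ0 hΔ (j + n)
      have hrk : ‖y (j + n) - b (j + n)‖ < r := by
        have := hr (j + n) h2
        linarith [norm_nonneg (y (j + n) - b (j + n))]
      have e2 := single_step_le hlip hg hΔ hx hX hbs hys hrk
      obtain ⟨nS, nγ, hS, hγ, e3⟩ := ih (M - (j + n + 1)) (by omega) (j + n + 1) (by omega)
      have hlt : (j : ℝ) * Δ < ((j + n + 1 : ℕ) : ℝ) * Δ := by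
        push_cast
        nlinarith [Nat.cast_nonneg (α := ℝ) n]
      have hle : ((j + n + 1 : ℕ) : ℝ) * Δ ≤ (M : ℝ) * Δ := hmono _ _ (by omega)
      have hsum : ∑ l ∈ Finset.Ico j M, driftRate f Δ r (b l) =
          ∑ l ∈ Finset.Ico j (j + n), driftRate f Δ r (b l) + driftRate f Δ r (b (j + n)) +
          ∑ l ∈ Finset.Ico (j + n + 1) M, driftRate f Δ r (b l) := by
        rw [← Finset.sum_Ico_succ_top (by omega),
          Finset.sum_Ico_consecutive _ (by omega) (by omega)]
      have hfin : ∀ kS kγ : ℕ, 6000 * sewConst (3 / p) + 4 * (2 * (n' : ℝ) + 1) ≤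
          badCost p * ((kS : ℝ) + kγ) → ‖y M - b M‖ ≤ ‖y j - b j‖ * Real.exp
            (∑ l ∈ Finset.Ico j M, driftRate f Δ r (b l) +
            badCost p * (Lg g * γ) * (1 + ((nS + kS : ℕ) : ℝ) + ((nγ + kγ : ℕ) : ℝ))) := by
        intro kS kγ hk
        refine e3.trans ((mul_le_mul_of_nonneg_right (e2.trans
          (mul_le_mul_of_nonneg_right e1 (Real.exp_pos _).le)) (Real.exp_pos _).le).trans ?_)
        rw [mul_assoc, mul_assoc, ← Real.exp_add, ← Real.exp_add]
        refine mul_le_mul_of_nonneg_left (Real.exp_le_exp.2 ?_) (norm_nonneg _)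
        rw [hsum]
        have := mul_le_mul_of_nonneg_left hk hLγ.le
        push_cast
        linarith
      rcases Nat.eq_zero_or_pos n' with rfl | hpos
      · rw [not_and_or, not_lt, not_lt] at h4
        rcases h4 with h4 | h4
        · refine ⟨nS + 1, nγ + 0, ⟨_, hmem j, _, hmem (j + n + 1), le_rfl, hlt, hle, h4, hS⟩,
            hγ.anti_left hlt.le, hfin 1 0 ?_⟩
          unfold badCost; push_cast; linarith
        · refine ⟨nS + 0, nγ + 1, hS.anti_left hlt.le,
            ⟨_, hmem j, _, hmem (j + n + 1), le_rfl, hlt, hle, h4, hγ⟩, hfin 0 1 ?_⟩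
          unfold badCost; push_cast; linarith
      · refine ⟨nS + 0, nγ + n', hS.anti_left hlt.le,
          (hn'.append hγ (hmono _ _ (by omega)) hle).anti_left (hmono _ _ (by omega)),
          hfin 0 n' ?_⟩
        have : (1 : ℝ) ≤ n' := by exact_mod_cast hpos
        unfold badCost; push_cast; nlinarith

/-- Growth of the difference of two orbits over a block of steps of total length at most one. -/
theorem block_le (hp2 : 2 < p) (hp3 : p < 3) (hlip : ∀ u v, ‖f u - f v‖ ≤ Lf f * ‖u - v‖)
    (hg : IsC3b g) (hCp : 1000 * sewConst (3 / p) ≤ Cp) (hlam0 : 0 < lam)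
    (hlam : lam < 1 / 2) (hγ0 : 0 < γ) (hΔ : 0 < Δ)
    (hb : ∀ k : ℕ, a (shift ((k : ℝ) * Δ) ω) = b k) (hbs : IsSchemeOrbit f g Δ ω.1 b)
    (hys : IsSchemeOrbit f g Δ ω.1 y) (M : ℕ) (hM : (M : ℝ) * Δ ≤ 1)
    (hr : ∀ k < M, 5 * ‖y k - b k‖ < r) :
    ∃ nS nγ : ℕ,
      HasBad (fun s t => ENNReal.ofReal lam ≤ controlSum p Cp lam f g Δ a ω s t) (ratGrid Δ)
        1 nS 0 ∧
      HasBad (fun s t => ENNReal.ofReal γ ≤ ratVar p Δ ω.1 s t) (ratGrid Δ) 1 nγ 0 ∧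
      ‖y M - b M‖ ≤ ‖y 0 - b 0‖ * Real.exp (∑ l ∈ Finset.range M, driftRate f Δ r (b l) +
        badCost p * (Lg g * γ) * (1 + nS + nγ)) := by
  rcases (Lg_nonneg (g := g)).eq_or_lt with h0 | hL
  -- When `Lg g` = 0 the noise cancels in the difference of the orbits, and pure drift steps
  -- suffice.
  · refine ⟨0, 0, trivial, trivial, ?_⟩
    rw [← h0, zero_mul, mul_zero, zero_mul, add_zero]
    induction M with
    | zero => simp
    | succ M ih =>
      have e1 := ih (by push_cast at hM; linarith) fun k hk => hr k (by omega)
      set e := incr ω.1 ((M : ℝ) * Δ) (((M + 1 : ℕ) : ℝ) * Δ)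
      have hrk : ‖y M - b M‖ < r := by
        have := hr M (by omega)
        linarith [norm_nonneg (y M - b M)]
      have nx := norm_nonneg e.vec
      have nX := tensorNorm_nonneg e.area
      -- Any admissible size of the increment will do, as it is multiplied by `Lg g` = 0.
      have e2 := single_step_le (ω := ω) (s := ‖e.vec‖ + tensorNorm e.area + 1) hlip hg hΔ
        (by linarith) (by nlinarith) hbs hys hrk
      rw [← h0, zero_mul, mul_zero, add_zero] at e2
      refine (e2.trans (mul_le_mul_of_nonneg_right e1 (Real.exp_pos _).le)).trans_eq ?_
      rw [mul_assoc, ← Real.exp_add, Finset.sum_range_succ]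
  · obtain ⟨nS, nγ, hS, hγ, h⟩ := block_le_of_drop hp2 hp3 hlip hg hL hCp hlam0 hlam hγ0 hΔ hb hbs
      hys M M 0 (by omega) hr
    rw [Nat.cast_zero, zero_mul] at hS hγ
    rw [← Finset.range_eq_Ico] at h
    exact ⟨nS, nγ, hS.mono_right hM, hγ.mono_right hM, h⟩

end BlockGrowth

/-! ### Orbits and the Wiener shift -/

section Shift

variable {d m : ℕ} {α Δ : ℝ} {f : Vec d → Vec d} {g : Vec d → Vec m →L[ℝ] Vec d}

theorem isSchemeOrbit_scheme (ω : ℝ → T2 m) (y₀ : Vec d) :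
    IsSchemeOrbit f g Δ ω (scheme f g Δ ω y₀) := fun _ => rfl

theorem incr_shift_path (t : ℝ) (ω : PathSpace m α) (s u : ℝ) :
    incr (shift t ω).1 s u = incr ω.1 (t + s) (t + u) :=
  incr_shift ω.1 t s u

theorem shift_shift (s t : ℝ) (ω : PathSpace m α) : shift s (shift t ω) = shift (t + s) ω := by
  refine Subtype.ext (funext fun u => ?_)
  change ((ω.1 t)⁻¹ * ω.1 (t + s))⁻¹ * ((ω.1 t)⁻¹ * ω.1 (t + (s + u))) =
    (ω.1 (t + s))⁻¹ * ω.1 (t + s + u)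
  rw [add_assoc]
  group

theorem iterate_shift (k : ℕ) (ω : PathSpace m α) : (shift Δ)^[k] ω = shift ((k : ℝ) * Δ) ω := by
  induction k with
  | zero =>
    refine Subtype.ext (funext fun u => ?_)
    change ω.1 u = (ω.1 (((0 : ℕ) : ℝ) * Δ))⁻¹ * ω.1 (((0 : ℕ) : ℝ) * Δ + u)
    simp [ω.2.1]
  | succ k ih =>
    rw [Function.iterate_succ_apply', ih, shift_shift]
    congr 1
    push_cast; ring

theorem IsSchemeOrbit.shift {ω : PathSpace m α} {y : ℕ → Vec d} (h : IsSchemeOrbit f g Δ ω.1 y)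
    (k : ℕ) : IsSchemeOrbit f g Δ (shift ((k : ℝ) * Δ) ω).1 fun l => y (k + l) := by
  intro l
  have := h (k + l)
  rw [incr_shift_path]
  rwa [show (k : ℝ) * Δ + (l : ℝ) * Δ = ((k + l : ℕ) : ℝ) * Δ by push_cast; ring,
    show (k : ℝ) * Δ + ((l + 1 : ℕ) : ℝ) * Δ = ((k + l + 1 : ℕ) : ℝ) * Δ by push_cast; ring]

end Shift

/-! ### Birkhoff sums of negative mean -/

section Ergodic

variable {Ω : Type*} {T : Ω → Ω} {φ : Ω → ℝ}

/-- The maximum of `0` and the first `n` Birkhoff sums. -/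
def maxBirkhoff (T : Ω → Ω) (φ : Ω → ℝ) : ℕ → Ω → ℝ
  | 0 => fun _ => 0
  | n + 1 => fun ω => max 0 (φ ω + maxBirkhoff T φ n (T ω))

theorem maxBirkhoff_nonneg (n : ℕ) (ω : Ω) : 0 ≤ maxBirkhoff T φ n ω := by
  cases n with
  | zero => exact le_rfl
  | succ n => exact le_max_left _ _

theorem maxBirkhoff_le_succ (n : ℕ) (ω : Ω) :
    maxBirkhoff T φ n ω ≤ maxBirkhoff T φ (n + 1) ω := by
  induction n generalizing ω with
  | zero => exact maxBirkhoff_nonneg _ _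
  | succ n ih => exact max_le_max le_rfl (by gcongr; exact ih _)

theorem birkhoffSum_le_maxBirkhoff (n : ℕ) (ω : Ω) :
    birkhoffSum T φ n ω ≤ maxBirkhoff T φ n ω := by
  induction n generalizing ω with
  | zero => simp [maxBirkhoff]
  | succ n ih =>
    rw [birkhoffSum_succ']
    exact le_trans (by gcongr; exact ih _) (le_max_right _ _)

variable [MeasurableSpace Ω] {μ : Measure Ω}

theorem measurable_maxBirkhoff (hT : Measurable T) (hφ : Measurable φ) (n : ℕ) :
    Measurable (maxBirkhoff T φ n) := by
  induction n with
  | zero => exact measurable_const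
  | succ n ih => exact measurable_const.max (hφ.add (ih.comp hT))

theorem integrable_maxBirkhoff (hT : MeasurePreserving T μ μ) (hφi : Integrable φ μ) (n : ℕ) :
    Integrable (maxBirkhoff T φ n) μ := by
  induction n with
  | zero => exact integrable_zero _ _ _
  | succ n ih => exact (integrable_zero _ _ _).sup (hφi.add (hT.integrable_comp_of_integrable ih))

/-- Birkhoff sums of a function of negative mean are almost surely bounded above. -/
theorem bddAbove_birkhoffSum [IsProbabilityMeasure μ] (hT : Ergodic T μ) (hφ : Measurable φ)
    (hφi : Integrable φ μ) (hneg : ∫ ω, φ ω ∂μ < 0) :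
    ∀ᵐ ω ∂μ, BddAbove (range fun n => birkhoffSum T φ n ω) := by
  have hTm := hT.toMeasurePreserving
  -- Boundedness of the running maxima is invariant under T, so it holds almost surely or almost
  -- never.
  let B : Set Ω := {ω | BddAbove (range fun n => maxBirkhoff T φ n ω)}
  have hB : MeasurableSet B :=
    measurableSet_bddAbove_range fun n => measurable_maxBirkhoff hTm.measurable hφ n
  have hinv : T ⁻¹' B = B := by
    ext ω
    constructor
    · rintro ⟨C, hC⟩
      refine ⟨max 0 (φ ω + C), ?_⟩
      rintro _ ⟨n, rfl⟩
      cases n with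
      | zero => exact le_max_left _ _
      | succ n => exact max_le_max le_rfl (by gcongr; exact hC ⟨n, rfl⟩)
    · rintro ⟨C, hC⟩
      refine ⟨C - φ ω, ?_⟩
      rintro _ ⟨n, rfl⟩
      have := (le_max_right _ _).trans (hC ⟨n + 1, rfl⟩)
      dsimp only
      linarith
  rcases hT.toPreErgodic.ae_mem_or_ae_notMem hB hinv with h | h
  · filter_upwards [h] with ω ⟨C, hC⟩
    refine ⟨C, ?_⟩
    rintro _ ⟨n, rfl⟩
    exact (birkhoffSum_le_maxBirkhoff n ω).trans (hC ⟨n, rfl⟩)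
  -- If Mₙ ↑ ∞ almost surely, then Mₙ₊₁ - Mₙ∘T = max(-Mₙ∘T, φ) converges to φ and is dominated by
  -- |φ|. Its integral is that of Mₙ₊₁ - Mₙ ≥ 0, so φ would have nonnegative mean.
  · exfalso
    have hi := integrable_maxBirkhoff hTm hφi
    have hiT : ∀ n, Integrable (fun ω => maxBirkhoff T φ n (T ω)) μ := fun n =>
      hTm.integrable_comp_of_integrable (hi n)
    have hlim : Tendsto (fun n => ∫ ω, (maxBirkhoff T φ (n + 1) ω - maxBirkhoff T φ n (T ω)) ∂μ)
        atTop (𝓝 (∫ ω, φ ω ∂μ)) := by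
      refine tendsto_integral_of_dominated_convergence (fun ω => |φ ω|)
        (fun n => ((hi (n + 1)).sub (hiT n)).aestronglyMeasurable) hφi.abs (fun n => ?_) ?_
      · refine Eventually.of_forall fun ω => ?_
        have h0 := maxBirkhoff_nonneg (T := T) (φ := φ) n (T ω)
        have e : maxBirkhoff T φ (n + 1) ω - maxBirkhoff T φ n (T ω) =
            max (-maxBirkhoff T φ n (T ω)) (φ ω) := by
          rw [maxBirkhoff, ← max_sub_sub_right]; simp
        rw [e, Real.norm_eq_abs, abs_le]
        exact ⟨(neg_abs_le _).trans (le_max_right _ _),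
          max_le (by linarith [abs_nonneg (φ ω)]) (le_abs_self _)⟩
      · filter_upwards [h] with ω hω
        have hω' : ¬ BddAbove (range fun n => maxBirkhoff T φ n (T ω)) := by
          intro hb
          have : ω ∈ T ⁻¹' B := hb
          rw [hinv] at this
          exact hω this
        have ht := tendsto_atTop_atTop_of_monotone'
          (monotone_nat_of_le_succ fun n => maxBirkhoff_le_succ n (T ω)) hω'
        refine tendsto_const_nhds.congr' ?_
        filter_upwards [ht.eventually_ge_atTop (-φ ω)] with n hn
        have h0 := maxBirkhoff_nonneg (T := T) (φ := φ) n (T ω)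
        change φ ω = max 0 (φ ω + maxBirkhoff T φ n (T ω)) - maxBirkhoff T φ n (T ω)
        rw [max_eq_right (by linarith), add_sub_cancel_right]
    refine absurd (ge_of_tendsto' hlim fun n => ?_) (not_le.2 hneg)
    have e : ∫ ω, maxBirkhoff T φ n (T ω) ∂μ = ∫ ω, maxBirkhoff T φ n ω ∂μ := by
      have hm := measurable_maxBirkhoff hTm.measurable hφ n
      conv_rhs => rw [← hTm.map_eq]
      rw [integral_map hTm.measurable.aemeasurable hm.aestronglyMeasurable]
    rw [integral_sub (hi _) (hiT n), e, ← integral_sub (hi _) (hi n)]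
    exact integral_nonneg fun ω => sub_nonneg.2 (maxBirkhoff_le_succ n ω)

/-- An integrable function grows sublinearly along almost every orbit. -/
theorem exists_sublinear_bound [IsProbabilityMeasure μ] (hT : Ergodic T μ) (hφ : Measurable φ)
    (hφi : Integrable φ μ) {ε : ℝ} (hε : 0 < ε) :
    ∀ᵐ ω ∂μ, ∃ C : ℝ, ∀ n : ℕ, φ (T^[n] ω) ≤ C + ε * n := by
  set E := ∫ ω, φ ω ∂μ
  -- The value at time n is a difference of two consecutive Birkhoff sums. Recentring φ and -φ
  -- bounds both sums with an error ε/2 per step.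
  have h1 := bddAbove_birkhoffSum (φ := fun ω => φ ω - (E + ε / 2)) hT (hφ.sub_const (E + ε / 2)) (hφi.sub (integrable_const _)) (by
    rw [integral_sub hφi (integrable_const _)]
    simp only [integral_const, probReal_univ, one_smul]
    linarith)
  have h2 := bddAbove_birkhoffSum (φ := fun ω => E - ε / 2 - φ ω) hT (measurable_const.sub hφ)
    ((integrable_const (E - ε / 2)).sub hφi) (by
    rw [integral_sub (integrable_const _) hφi]
    simp only [integral_const, probReal_univ, one_smul]
    linarith)
  filter_upwards [h1, h2] with ω ⟨C, hC⟩ ⟨C', hC'⟩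
  refine ⟨C + C' + E + ε / 2, fun n => ?_⟩
  have e1 := hC ⟨n + 1, rfl⟩
  have e2 := hC' ⟨n, rfl⟩
  simp only [birkhoffSum, Finset.sum_sub_distrib, Finset.sum_const, Finset.card_range,
    nsmul_eq_mul, Finset.sum_range_succ] at e1 e2
  push_cast at e1
  linarith

end Ergodic

/-! ### Averaging over the offsets of the blocks -/

section Average

/-- Geometric averaging of a growth bound over blocks of length `M`. -/
theorem le_mul_exp_average {M : ℕ} (hM : 0 < M) {u F G : ℕ → ℝ} (hu : ∀ k, 0 ≤ u k) (n : ℕ)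
    (hF : ∀ k, k < n → u (k + M) ≤ u k * Real.exp (F k))
    (hG : ∀ k i, i ≤ M → k + i ≤ n + M → u (k + i) ≤ u k * Real.exp (G k)) :
    u (n + M) ≤ u 0 * Real.exp (G 0 + (∑ k ∈ Finset.range n, F k +
      ∑ i ∈ Finset.range M, G (n + i)) / M) := by
  -- Logarithms need positive values. If the final value is positive, so are all earlier ones,
  -- because a zero would propagate forward.
  by_cases hz : u (n + M) = 0
  · rw [hz]; have := hu 0; positivity
  have hpos : ∀ k, k ≤ n + M → 0 < u k := by
    intro k hk
    induction hk using Nat.decreasingInduction with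
    | self => exact lt_of_le_of_ne (hu _) (Ne.symm hz)
    | of_succ k hk ih =>
      refine lt_of_le_of_ne (hu _) fun h => ?_
      have := hG k 1 hM (by omega)
      rw [← h, zero_mul] at this
      linarith
  have hlog : ∀ {x y z : ℝ}, 0 < x → 0 < y → x ≤ y * Real.exp z →
      Real.log x ≤ Real.log y + z := fun {x y z} hx hy h => by
    have := Real.log_le_log hx h
    rwa [Real.log_mul hy.ne' (Real.exp_pos _).ne', Real.log_exp] at this
  have hM0 : (0 : ℝ) < M := by exact_mod_cast hM
  -- Moving a window of M consecutive logarithms by one replaces log u(k) by log u(k + M), which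
  -- costs F(k). All offsets are thus treated at once, and the sum of F runs over every k.
  have hΛ : ∀ k, k ≤ n → ∑ i ∈ Finset.range M, Real.log (u (k + i)) ≤
      ∑ i ∈ Finset.range M, Real.log (u i) + ∑ l ∈ Finset.range k, F l := by
    intro k hk
    induction k with
    | zero => simp
    | succ k ih =>
      have h1 := ih (by omega)
      have h2 := hlog (hpos (k + M) (by omega)) (hpos k (by omega)) (hF k (by omega))
      have h3 : ∑ i ∈ Finset.range M, Real.log (u (k + 1 + i)) + Real.log (u k) =
          ∑ i ∈ Finset.range M, Real.log (u (k + i)) + Real.log (u (k + M)) := by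
        rw [← Finset.sum_range_succ (fun i => Real.log (u (k + i))), Finset.sum_range_succ']
        simp only [add_zero, add_assoc, add_comm 1]
      rw [Finset.sum_range_succ]
      linarith
  have h0 : ∑ i ∈ Finset.range M, Real.log (u i) ≤ M * (Real.log (u 0) + G 0) := by
    have : ∀ i ∈ Finset.range M, Real.log (u i) ≤ Real.log (u 0) + G 0 := fun i hi => by
      have hi := Finset.mem_range.1 hi
      have := hG 0 i hi.le (by omega)
      rw [zero_add] at this
      exact hlog (hpos i (by omega)) (hpos 0 (by omega)) this
    simpa [mul_add] using Finset.sum_le_sum this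
  have h1 : M * Real.log (u (n + M)) ≤ ∑ i ∈ Finset.range M, Real.log (u (n + i)) +
      ∑ i ∈ Finset.range M, G (n + i) := by
    rw [← Finset.sum_add_distrib]
    have : ∀ i ∈ Finset.range M, Real.log (u (n + M)) ≤ Real.log (u (n + i)) + G (n + i) :=
      fun i hi => by
      have hi := Finset.mem_range.1 hi
      have := hG (n + i) (M - i) (by omega) (by omega)
      rw [show n + i + (M - i) = n + M by omega] at this
      exact hlog (hpos _ le_rfl) (hpos _ (by omega)) this
    simpa using Finset.sum_le_sum this
  have h2 := hΛ n le_rfl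
  have h3 : Real.log (u (n + M)) ≤ Real.log (u 0) + (G 0 + (∑ k ∈ Finset.range n, F k +
      ∑ i ∈ Finset.range M, G (n + i)) / M) := by
    rw [← sub_nonneg]
    have : 0 ≤ ((M * (Real.log (u 0) + G 0) + (∑ k ∈ Finset.range n, F k +
      ∑ i ∈ Finset.range M, G (n + i))) - M * Real.log (u (n + M))) / M := by
      apply div_nonneg _ hM0.le; linarith
    convert this using 1
    field_simp
    ring
  have h4 := Real.exp_le_exp.2 h3
  rwa [Real.exp_log (hpos _ le_rfl), Real.exp_add, Real.exp_log (hpos 0 (by omega))] at h4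

end Average

/-! ### The local one-sided Lipschitz rate -/

section LocalRate

variable {d : ℕ} {f : Vec d → Vec d}

theorem continuous_of_lip (hlip : ∀ u v, ‖f u - f v‖ ≤ Lf f * ‖u - v‖) : Continuous f := by
  refine (LipschitzWith.of_dist_le_mul (K := (Lf f).toNNReal) fun u v => ?_).continuous
  rw [dist_eq_norm, dist_eq_norm, Real.coe_toNNReal _ Lf_nonneg]
  exact hlip u v

theorem ellRadius_eq_iSup (y : Vec d) (r : ℝ) :
    ellRadius f y r = ⨆ h : {h : Vec d // 0 < ‖h‖ ∧ ‖h‖ < r},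
      inner ℝ (‖h.1‖⁻¹ • h.1) (‖h.1‖⁻¹ • (f (y + h.1) - f y)) := by
  let e : {h : Vec d // 0 < ‖h‖ ∧ ‖h‖ < r} ≃ {z : Vec d // 0 < ‖z - y‖ ∧ ‖z - y‖ < r} :=
    ⟨fun h => ⟨y + h.1, by simpa using h.2⟩, fun z => ⟨z.1 - y, z.2⟩,
      fun h => Subtype.ext (by simp), fun z => Subtype.ext (by simp)⟩
  rw [ellRadius, ← e.iSup_comp]
  simp [e]

/-- After translation the index set no longer depends on y, and a supremum of continuous functions
is lower semicontinuous. -/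
theorem measurable_ellRadius (hlip : ∀ u v, ‖f u - f v‖ ≤ Lf f * ‖u - v‖) (r : ℝ) :
    Measurable fun y => ellRadius f y r := by
  have hf := continuous_of_lip hlip
  simp_rw [ellRadius_eq_iSup]
  refine LowerSemicontinuous.measurable (lowerSemicontinuous_ciSup (fun y => ?_) fun h => ?_)
  · refine ⟨Lf f, ?_⟩
    rintro _ ⟨h, rfl⟩
    have := (abs_le.1 (abs_quotient_le hlip y (y + h.1))).2
    simpa using this
  · refine Continuous.lowerSemicontinuous ?_
    fun_prop

theorem tendsto_ellRadius (hlip : ∀ u v, ‖f u - f v‖ ≤ Lf f * ‖u - v‖) (y : Vec d) :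
    Tendsto (ellRadius f y) (𝓝[>] 0) (𝓝 (ell f y)) := by
  refine tendsto_nhds_limUnder ⟨_, MonotoneOn.tendsto_nhdsGT (fun r hr s hs hrs => ?_)
    ⟨-Lf f, ?_⟩⟩
  · have hsub : ∀ z : Vec d, 0 < ‖z - y‖ ∧ ‖z - y‖ < r → 0 < ‖z - y‖ ∧ ‖z - y‖ < s :=
      fun z hz => ⟨hz.1, hz.2.trans_le hrs⟩
    by_cases hne : Nonempty {z : Vec d // 0 < ‖z - y‖ ∧ ‖z - y‖ < r}
    · exact ciSup_le fun z => le_ciSup (bddAbove_quotient hlip y s) ⟨z.1, hsub _ z.2⟩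
    · have he : IsEmpty {z : Vec d // 0 < ‖z - y‖ ∧ ‖z - y‖ < r} := not_nonempty_iff.1 hne
      -- A supremum over an empty set is 0 by convention, which could break monotonicity; but a
      -- nonempty punctured ball can be shrunk, so both index sets are empty together.
      have he' : IsEmpty {z : Vec d // 0 < ‖z - y‖ ∧ ‖z - y‖ < s} := by
        refine ⟨fun z => he.elim ⟨y + (r / (2 * s)) • (z.1 - y), ?_⟩⟩
        obtain ⟨h1, h2⟩ := z.2
        have hr0 : 0 < r := hr
        have hs0 : 0 < s := hs
        rw [add_sub_cancel_left, norm_smul, Real.norm_of_nonneg (by positivity)]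
        refine ⟨by positivity, ?_⟩
        rw [div_mul_eq_mul_div, div_lt_iff₀ (by positivity)]
        nlinarith
      rw [ellRadius, ellRadius, Real.iSup_of_isEmpty, Real.iSup_of_isEmpty]
  · rintro _ ⟨r, -, rfl⟩
    exact (abs_le.1 (abs_ellRadius_le hlip y r)).1

/-- Dominated convergence along the radii 1/(n+1), with the constant L_f as majorant. -/
theorem exists_integral_ellRadius_lt {Ω : Type*} [MeasurableSpace Ω] {P : Measure Ω}
    [IsProbabilityMeasure P] (hlip : ∀ u v, ‖f u - f v‖ ≤ Lf f * ‖u - v‖) {a : Ω → Vec d}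
    (ha : Measurable a) {c : ℝ} (hc : ∫ ω, ell f (a ω) ∂P < c) :
    ∃ r : ℝ, 0 < r ∧ ∫ ω, ellRadius f (a ω) r ∂P < c := by
  have h0 : Tendsto (fun n : ℕ => 1 / ((n : ℝ) + 1)) atTop (𝓝[>] 0) :=
    tendsto_nhdsWithin_iff.2 ⟨tendsto_one_div_add_atTop_nhds_zero_nat,
      Eventually.of_forall fun n => by simp only [mem_Ioi]; positivity⟩
  have h1 : Tendsto (fun n : ℕ => ∫ ω, ellRadius f (a ω) (1 / ((n : ℝ) + 1)) ∂P) atTop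
      (𝓝 (∫ ω, ell f (a ω) ∂P)) := by
    refine tendsto_integral_of_dominated_convergence (fun _ => Lf f)
      (fun n => ((measurable_ellRadius hlip _).comp ha).aestronglyMeasurable)
      (integrable_const _) (fun n => Eventually.of_forall fun ω => abs_ellRadius_le hlip _ _)
      (Eventually.of_forall fun ω => (tendsto_ellRadius hlip (a ω)).comp h0)
  obtain ⟨n, hn⟩ := (h1.eventually_lt_const hc).exists
  exact ⟨_, by positivity, hn⟩

end LocalRate

/-! ### Measurability of the number of bad intervals -/

section BadCount

variable {Ω : Type*} {bad : Ω → ℝ → ℝ → Prop} {T : Set ℝ}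

/-- The largest number of consecutive bad intervals in `[0, 1]` with end points in `T`. -/
def badCount (bad : Ω → ℝ → ℝ → Prop) (T : Set ℝ) (ω : Ω) : ℝ≥0∞ :=
  ⨆ (n : ℕ) (_ : HasBad (bad ω) T 1 n 0), (n : ℝ≥0∞)

theorem HasBad.le_badCount {ω : Ω} {n : ℕ} (h : HasBad (bad ω) T 1 n 0) :
    (n : ℝ≥0∞) ≤ badCount bad T ω :=
  le_iSup₂ (f := fun (n : ℕ) (_ : HasBad (bad ω) T 1 n 0) => (n : ℝ≥0∞)) n h

variable [MeasurableSpace Ω]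

theorem measurableSet_hasBad (hT : T.Countable) (hbad : ∀ s t, MeasurableSet {ω | bad ω s t})
    (b : ℝ) (n : ℕ) (x : ℝ) : MeasurableSet {ω | HasBad (bad ω) T b n x} := by
  induction n generalizing x with
  | zero => simp [HasBad]
  | succ n ih =>
    have : {ω | HasBad (bad ω) T b (n + 1) x} = ⋃ s ∈ T, ⋃ t ∈ T,
        {ω | x ≤ s ∧ s < t ∧ t ≤ b} ∩ ({ω | bad ω s t} ∩ {ω | HasBad (bad ω) T b n t}) := by
      ext ω
      simp only [HasBad, mem_ofPred_eq, mem_iUnion, mem_inter_iff, exists_prop, and_assoc]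
    rw [this]
    exact MeasurableSet.biUnion hT fun s _ => MeasurableSet.biUnion hT fun t _ =>
      (MeasurableSet.const _).inter ((hbad s t).inter (ih t))

/-- End points from a countable set make this count measurable. The greedy counts enter only as
upper bounds through `lintegral_mono`, which asks for no measurability. -/
theorem measurable_badCount (hT : T.Countable) (hbad : ∀ s t, MeasurableSet {ω | bad ω s t}) :
    Measurable (badCount bad T) := by
  have : badCount bad T =
      fun ω => ⨆ n : ℕ, {ω | HasBad (bad ω) T 1 n 0}.indicator (fun _ => (n : ℝ≥0∞)) ω := by
    funext ω
    refine iSup_congr fun n => ?_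
    by_cases h : HasBad (bad ω) T 1 n 0 <;> simp [h, indicator]
  rw [this]
  exact Measurable.iSup fun n => measurable_const.indicator (measurableSet_hasBad hT hbad 1 n 0)

end BadCount

/-! ### Measurability of the noise functionals -/

section Measurability

variable {d m : ℕ} {p α : ℝ} {S : Set ℝ}

theorem measurable_eval (t : ℝ) :
    Measurable fun ω : PathSpace m α => ((ω.1 t).vec, (ω.1 t).area) := by
  have h : Measurable fun (ω : PathSpace m α) (t : ℝ) => ((ω.1 t).vec, (ω.1 t).area) :=
    comap_measurable _
  exact (measurable_pi_apply t).comp h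

theorem measurable_incr_vec (s t : ℝ) : Measurable fun ω : PathSpace m α => (incr ω.1 s t).vec :=
  ((measurable_eval s).fst.neg).add (measurable_eval t).fst

theorem measurable_incr_area (s t : ℝ) :
    Measurable fun ω : PathSpace m α => (incr ω.1 s t).area := by
  have hv : ∀ (t : ℝ) (i : Fin m), Measurable fun ω : PathSpace m α => (ω.1 t).vec i :=
    fun t i => (by fun_prop : Measurable fun v : Vec m => v i).comp (measurable_eval t).fst
  have ha : ∀ (t : ℝ) (i j : Fin m), Measurable fun ω : PathSpace m α => (ω.1 t).area i j :=
    fun t i j => (measurable_pi_apply j).comp ((measurable_pi_apply i).comp (measurable_eval t).snd)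
  refine measurable_pi_lambda _ fun i => measurable_pi_lambda _ fun j => ?_
  simp only [incr, T2.mul_area, T2.inv_area, T2.inv_vec, PiLp.neg_apply]
  exact (((hv s i).neg.mul (hv t j)).add (((hv s i).mul (hv s j)).sub (ha s i j))).add (ha t i j)

theorem measurable_xVarPow (hS : S.Countable) :
    Measurable fun ω : PathSpace m α => xVarPow p S ω.1 :=
  measurable_varPow hS fun s t => (measurable_incr_vec s t).norm

theorem measurable_areaVarPow (hS : S.Countable) :
    Measurable fun ω : PathSpace m α => areaVarPow p S ω.1 :=
  measurable_varPow hS fun s t => continuous_tensorNorm.measurable.comp (measurable_incr_area s t)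

theorem measurable_ratVar (Δ s t : ℝ) :
    Measurable fun ω : PathSpace m α => ratVar p Δ ω.1 s t :=
  ((measurable_xVarPow ((countable_ratGrid Δ).mono inter_subset_left)).add
    (measurable_areaVarPow ((countable_ratGrid Δ).mono inter_subset_left))).pow_const _

theorem measurable_controlSum {Cp lam Δ : ℝ} {f : Vec d → Vec d} {g : Vec d → Vec m →L[ℝ] Vec d}
    {a : PathSpace m α → Vec d} (hf : Continuous f) (ha : Measurable a)
    (hshift : ∀ t, Measurable (shift t : PathSpace m α → PathSpace m α)) (s t : ℝ) :
    Measurable fun ω => controlSum p Cp lam f g Δ a ω s t := by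
  have hS : (grid Δ ∩ Icc s t).Countable := (countable_grid Δ).mono inter_subset_left
  unfold controlSum
  dsimp only
  refine ((measurable_const.add (((measurable_xVarPow hS).const_mul _).pow_const _)).add
    (((measurable_areaVarPow hS).const_mul _).pow_const _)).add
    (((Measurable.biSup _ hS fun u _ => ?_).const_mul _).mul_const _)
  exact (hf.measurable.comp (ha.comp (hshift u))).norm.ennreal_ofReal

end Measurability

/-- Exponential decay from a local growth bound along blocks of length `M`. -/
theorem orbit_decay {M : ℕ} (hM : 0 < M) {u h N : ℕ → ℝ} {hmax r B μ : ℝ} (hu : ∀ k, 0 ≤ u k)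
    (hh : ∀ k, h k ≤ hmax) (hmax0 : 0 ≤ hmax) (hN : ∀ k, 0 ≤ N k) (hμ : 0 ≤ μ)
    (hblock : ∀ k i, i ≤ M → (∀ l < i, 5 * u (k + l) < r) →
      u (k + i) ≤ u k * Real.exp (∑ l ∈ Finset.range i, h (k + l) + N k))
    (hB : ∀ n : ℕ, (M * hmax + N 0) +
      (∑ k ∈ Finset.range n, (∑ l ∈ Finset.range M, h (k + l) + N k) +
        ∑ i ∈ Finset.range M, (M * hmax + N (n + i))) / M + μ * (n + M) ≤ B)
    (hr : 5 * (u 0 * Real.exp B) < r) (j : ℕ) : u j ≤ u 0 * Real.exp (B - μ * j) := by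
  have hsum : ∀ k i, i ≤ M → ∑ l ∈ Finset.range i, h (k + l) ≤ M * hmax := by
    intro k i hi
    have h1 : ∑ l ∈ Finset.range i, h (k + l) ≤ ∑ l ∈ Finset.range i, hmax :=
      Finset.sum_le_sum fun l _ => hh _
    rw [Finset.sum_const, Finset.card_range, nsmul_eq_mul] at h1
    have h2 : (i : ℝ) ≤ M := by exact_mod_cast hi
    nlinarith
  induction j using Nat.strong_induction_on with
  | _ j ih =>
    -- By the decay already proved, all earlier values lie inside the radius on which the block
    -- estimate is valid.
    have hreg : ∀ l < j, 5 * u l < r := by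
      intro l hl
      refine lt_of_le_of_lt ?_ hr
      have h1 := ih l hl
      have h2 : Real.exp (B - μ * l) ≤ Real.exp B := Real.exp_le_exp.2 (by
        have : 0 ≤ μ * l := by positivity
        linarith)
      have := mul_le_mul_of_nonneg_left h2 (hu 0)
      linarith
    have hG : ∀ k i, i ≤ M → k + i ≤ j → u (k + i) ≤ u k * Real.exp (M * hmax + N k) := by
      intro k i hi hk
      refine (hblock k i hi fun l hl => hreg _ (by omega)).trans ?_
      have := hu k
      have := hsum k i hi
      gcongr
    -- Times before M are too short for averaging; there the crude growth bound and the case n = 0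
    -- of the budget suffice.
    rcases lt_or_ge j M with hj | hj
    · have h1 := hG 0 j hj.le (by omega)
      rw [zero_add] at h1
      refine h1.trans (mul_le_mul_of_nonneg_left (Real.exp_le_exp.2 ?_) (hu 0))
      have h2 := hB 0
      have h3 : 0 ≤ (∑ i ∈ Finset.range M, (M * hmax + N (0 + i))) / M :=
        div_nonneg (Finset.sum_nonneg fun i _ => add_nonneg (by positivity) (hN _)) (by positivity)
      rw [Finset.sum_range_zero, zero_add] at h2
      have h4 : (j : ℝ) ≤ M := by exact_mod_cast hj.le
      push_cast at h2
      nlinarith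
    · obtain ⟨n, rfl⟩ := Nat.exists_eq_add_of_le' hj
      refine (le_mul_exp_average hM hu n (fun k hk => hblock k M le_rfl fun l hl =>
        hreg _ (by omega)) hG).trans (mul_le_mul_of_nonneg_left (Real.exp_le_exp.2 ?_) (hu 0))
      have := hB n
      push_cast
      linarith

/-- A pointwise supremum of countably many measurable functions is measurable. It is a genuine bound
almost surely: the sums of F decrease linearly, while G grows sublinearly along orbits. -/
theorem exists_measurable_bound {Ω : Type*} [MeasurableSpace Ω] {P : Measure Ω}
    [IsProbabilityMeasure P] {T : Ω → Ω} (hT : Ergodic T P) {F G : Ω → ℝ} (hF : Measurable F)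
    (hG : Measurable G) (hFi : Integrable F P) (hGi : Integrable G P) (hneg : ∫ ω, F ω ∂P < 0)
    {M : ℕ} (hM : 0 < M) :
    ∃ μ : ℝ, 0 < μ ∧ ∃ B : Ω → ℝ, Measurable B ∧ ∀ᵐ ω ∂P, ∀ n : ℕ,
      G ω + (∑ k ∈ Finset.range n, F (T^[k] ω) + ∑ i ∈ Finset.range M, G (T^[n + i] ω)) / M
        + μ * (n + M) ≤ B ω := by
  have hM0 : (0 : ℝ) < M := by exact_mod_cast hM
  set e := -∫ ω, F ω ∂P
  have he : 0 < e := neg_pos.2 hneg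
  have hTi : ∀ k, Measurable (T^[k]) := fun k => hT.toMeasurePreserving.measurable.iterate k
  refine ⟨e / (8 * M), by positivity, fun ω => ⨆ n : ℕ, (G ω + (∑ k ∈ Finset.range n, F (T^[k] ω) +
    ∑ i ∈ Finset.range M, G (T^[n + i] ω)) / M + e / (8 * M) * (n + M)), ?_, ?_⟩
  · refine Measurable.iSup fun n => ?_
    refine (hG.add (((Finset.measurable_fun_sum _ fun k _ => hF.comp (hTi k)).add
      (Finset.measurable_fun_sum _ fun i _ => hG.comp (hTi (n + i)))).div_const _)).add_const _
  · have h1 := bddAbove_birkhoffSum (φ := fun ω => F ω + e / 2) hT (hF.add_const _)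
      (hFi.add (integrable_const _)) (by
        rw [integral_add hFi (integrable_const _)]
        simp only [integral_const, probReal_univ, one_smul]
        linarith)
    have h2 := exists_sublinear_bound hT hG hGi (ε := e / (8 * M)) (by positivity)
    filter_upwards [h1, h2] with ω ⟨C, hC⟩ ⟨C', hC'⟩ n
    refine le_ciSup (f := fun n : ℕ => (G ω + (∑ k ∈ Finset.range n, F (T^[k] ω) +
      ∑ i ∈ Finset.range M, G (T^[n + i] ω)) / M + e / (8 * M) * (n + M)))
      ⟨G ω + (C + M * C' + e / 4 * M) / M, ?_⟩ n
    rintro _ ⟨n, rfl⟩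
    have e1 := hC ⟨n, rfl⟩
    simp only [birkhoffSum, Finset.sum_add_distrib, Finset.sum_const, Finset.card_range,
      nsmul_eq_mul] at e1
    have e2 : ∑ i ∈ Finset.range M, G (T^[n + i] ω) ≤ M * (C' + e / (8 * M) * (n + M)) := by
      have : ∀ i ∈ Finset.range M, G (T^[n + i] ω) ≤ C' + e / (8 * M) * (n + M) := fun i hi => by
        have hi : (i : ℝ) ≤ M := by exact_mod_cast (Finset.mem_range.1 hi).le
        refine (hC' (n + i)).trans ?_
        push_cast
        gcongr
      refine (Finset.sum_le_sum this).trans_eq ?_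
      rw [Finset.sum_const, Finset.card_range, nsmul_eq_mul]
    have e3 : M * (C' + e / (8 * M) * (n + M)) = M * C' + e / 8 * (n + M) := by field_simp
    have e4 : e / (8 * M) * (n + M) = (e / 8 * (n + M)) / M := by field_simp
    dsimp only
    rw [e4, add_assoc, ← add_div]
    -- Per unit of n, F gains e/2, while G and the rate μ cost e/8 each, before division by M.
    refine add_le_add le_rfl (div_le_div_of_nonneg_right ?_ hM0.le)
    have : 0 ≤ e * n := by positivity
    linarith

/-! ### From pathwise decay to stability, and the comparison of constants -/

section Main

variable {d m : ℕ} {p Cp lam γ Δ : ℝ} {f : Vec d → Vec d} {g : Vec d → Vec m →L[ℝ] Vec d}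
  {P : Measure (PathSpace m (1 / p))} {a : PathSpace m (1 / p) → Vec d}

theorem isExponentiallyStable_of_decay {α r μ : ℝ} {P : Measure (PathSpace m α)}
    {a : PathSpace m α → Vec d} {B : PathSpace m α → ℝ} (hr : 0 < r) (hμ : 0 < μ) (hΔ : 0 < Δ)
    (hB : Measurable B)
    (h : ∀ᵐ ω ∂P, ∀ y₀ : Vec d, 5 * (‖y₀ - a ω‖ * Real.exp (B ω)) < r → ∀ k : ℕ,
      ‖scheme f g Δ ω.1 y₀ k - a (shift ((k : ℝ) * Δ) ω)‖ ≤
        ‖y₀ - a ω‖ * Real.exp (B ω - μ * k)) :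
    IsExponentiallyStable P f g Δ a := by
  have hmeas : ∀ c : ℝ, Measurable fun ω => c / Real.exp (B ω) := fun c =>
    measurable_const.div (Real.measurable_exp.comp hB)
  constructor
  · intro ε hε
    have hmin : 0 < min ε r := lt_min hε hr
    refine ⟨fun ω => min ε r / 10 / Real.exp (B ω), hmeas _, fun ω => by positivity, ?_⟩
    filter_upwards [h] with ω hω y₀ hy
    rw [lt_div_iff₀ (Real.exp_pos _)] at hy
    have hy1 := min_le_left ε r
    have hy2 := min_le_right ε r
    refine lt_of_le_of_lt (iSup_le fun k => ENNReal.ofReal_le_ofReal (q := ε / 2) ?_)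
      ((ENNReal.ofReal_lt_ofReal_iff hε).2 (by linarith))
    refine (hω y₀ (by linarith) k).trans ?_
    have h1 : Real.exp (B ω - μ * k) ≤ Real.exp (B ω) := Real.exp_le_exp.2 (by
      have : 0 ≤ μ * k := by positivity
      linarith)
    have := mul_le_mul_of_nonneg_left h1 (norm_nonneg (y₀ - a ω))
    linarith
  -- The rate μ per step becomes μ/Δ per unit of time. On this ball ‖y₀ - a‖e^B is below r/10, so
  -- the prefactor can be the constant r.
  · refine ⟨fun ω => r / 10 / Real.exp (B ω), fun _ => r, μ / Δ, hmeas _, fun ω => by positivity,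
      measurable_const, fun _ => hr, by positivity, ?_⟩
    filter_upwards [h] with ω hω y₀ hy k
    rw [lt_div_iff₀ (Real.exp_pos _)] at hy
    refine (hω y₀ (by linarith) k).trans ?_
    rw [sub_eq_add_neg (B ω), Real.exp_add, ← mul_assoc,
      show -(μ * (k : ℝ)) = -(μ / Δ) * ((k : ℝ) * Δ) by field_simp]
    gcongr
    linarith

/-- The first entry of the maximum suffices: it is quadratic in Cp ≥ 1000·`sewConst (3 / p)`, while
the cost of a bad interval is affine in that sewing constant. -/
theorem badCost_le_Kconst (hp2 : 2 < p) (hp3 : p < 3) (hCp : 1000 * sewConst (3 / p) ≤ Cp)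
    (hlam0 : 0 < lam) (L : ℝ) : 4 * badCost p ≤ Kconst Cp lam L Δ := by
  have hsew := two_le_sewConst (θ := 3 / p) (by rw [lt_div_iff₀ (by linarith)]; linarith)
  have h1 : 1 ≤ Real.exp (12 * lam + 2 * lam ^ 2) := Real.one_le_exp (by positivity)
  have h2 : 5 * (1 + 2 * Cp) ^ 2 ≤ 5 * (1 + lam) * (1 + 2 * Cp) ^ 2 := by
    have := sq_nonneg (1 + 2 * Cp)
    nlinarith
  refine le_trans ?_ (le_max_left _ _)
  have h3 : 5 * (1 + 2 * Cp) ^ 2 ≤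
      5 * (1 + lam) * (1 + 2 * Cp) ^ 2 * Real.exp (12 * lam + 2 * lam ^ 2) :=
    h2.trans (le_mul_of_one_le_right (by positivity) h1)
  refine le_trans ?_ h3
  unfold badCost
  nlinarith

theorem badCount_control_le (hp : 0 < p) (ω : PathSpace m (1 / p)) :
    badCount (fun ω s t => ENNReal.ofReal lam ≤ controlSum p Cp lam f g Δ a ω s t) (ratGrid Δ) ω ≤
      greedyCount (controlSum p Cp lam f g Δ a ω) lam 0 1 :=
  iSup₂_le fun _ h => le_greedyCount_of_hasBad (controlSum_anti hp f g Δ a ω) h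

theorem badCount_ratVar_le {α : ℝ} (hp : 0 < p) (ω : PathSpace m α) :
    badCount (fun ω s t => ENNReal.ofReal γ ≤ ratVar p Δ ω.1 s t) (ratGrid Δ) ω ≤
      greedyCount (roughVar p ω.1) γ 0 1 :=
  iSup₂_le fun _ h => le_greedyCount_of_hasBad (roughVar_anti hp ω.1)
    (h.imp fun s t h => h.trans (ratVar_le_roughVar hp Δ ω.1 s t))

theorem toReal_integral_bound {Ω : Type*} [MeasurableSpace Ω] {P : Measure Ω}
    {D : Ω → ℝ≥0∞} (hD : Measurable D) {A : ℝ≥0∞} (hA : A ≠ ⊤) (hle : ∫⁻ ω, D ω ∂P ≤ A) :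
    (∀ᵐ ω ∂P, D ω ≠ ⊤) ∧ Integrable (fun ω => (D ω).toReal) P ∧
      ∫ ω, (D ω).toReal ∂P ≤ A.toReal := by
  have hne := ne_top_of_le_ne_top hA hle
  have hae := ae_lt_top hD hne
  refine ⟨hae.mono fun ω h => h.ne, integrable_toReal_of_lintegral_ne_top hD.aemeasurable hne, ?_⟩
  rw [integral_toReal hD.aemeasurable hae]
  exact ENNReal.toReal_mono hA hle

end Main

/-! ### Negativity of the mean growth exponent and conclusion -/

section Stability

variable {d m : ℕ} {p Cp lam γ Δ : ℝ} {f : Vec d → Vec d} {g : Vec d → Vec m →L[ℝ] Vec d}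
  {P : Measure (PathSpace m (1 / p))} {a : PathSpace m (1 / p) → Vec d}

/-- The expected cost of the bad intervals is less than half of the drift gap. -/
theorem badCost_integral_lt (hp2 : 2 < p) (hp3 : p < 3) [IsProbabilityMeasure P]
    (hCp : 1000 * sewConst (3 / p) ≤ Cp) (hlam0 : 0 < lam) (hγ0 : 0 < γ) {L η : ℝ} (hη : 0 < η)
    {DS Dγ : PathSpace m (1 / p) → ℝ≥0∞} (hDS : Measurable DS) (hDγ : Measurable Dγ)
    {NS Nγ : PathSpace m (1 / p) → ℝ≥0∞} (hS : ∀ ω, DS ω ≤ NS ω) (hγ : ∀ ω, Dγ ω ≤ Nγ ω)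
    (hN : ∀ ω, 1 ≤ Nγ ω)
    (hgap : ENNReal.ofReal (Kconst Cp lam L Δ * Lg g * γ) *
      ((∫⁻ ω, Nγ ω ∂P) + 2 * ∫⁻ ω, NS ω ∂P) < ENNReal.ofReal η) :
    (∀ᵐ ω ∂P, badCost p * (Lg g * γ) = 0 ∨ DS ω ≠ ⊤ ∧ Dγ ω ≠ ⊤) ∧
      Integrable (fun ω => badCost p * (Lg g * γ) * (1 + (DS ω).toReal + (Dγ ω).toReal)) P ∧
      ∫ ω, badCost p * (Lg g * γ) * (1 + (DS ω).toReal + (Dγ ω).toReal) ∂P < η / 2 := by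
  have hK := badCost_le_Kconst (Δ := Δ) hp2 hp3 hCp hlam0 L
  have hsew := two_le_sewConst (θ := 3 / p) (by rw [lt_div_iff₀ (by linarith)]; linarith)
  have hb : 0 < badCost p := by unfold badCost; linarith
  rcases (Lg_nonneg (g := g)).eq_or_lt with h0 | hL
  -- When `Lg g` = 0 the gap hypothesis carries no information on the counts, as 0·∞ = 0; they may
  -- be infinite but have weight zero.
  · have h0' : badCost p * (Lg g * γ) = 0 := by rw [← h0]; ring
    simp only [h0', zero_mul, true_or, integral_zero, true_and, eventually_true]
    exact ⟨integrable_zero _ _ _, by linarith⟩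
  · set K := Kconst Cp lam L Δ
    have hc : 0 < K * Lg g * γ := by
      have : 0 < K := by linarith
      positivity
    set A := ∫⁻ ω, Nγ ω ∂P
    set B := ∫⁻ ω, NS ω ∂P
    have hfin : A + 2 * B ≠ ⊤ := by
      intro h
      rw [h, ENNReal.mul_top (by simpa using hc)] at hgap
      exact absurd hgap (by simp)
    have hA : A ≠ ⊤ := (ENNReal.add_ne_top.1 hfin).1
    have hB2 : 2 * B ≠ ⊤ := (ENNReal.add_ne_top.1 hfin).2
    have hB : B ≠ ⊤ := fun h => hB2 (by rw [h]; simp)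
    have hA1 : 1 ≤ A.toReal := by
      have h1 : (1 : ℝ≥0∞) ≤ A := by
        calc (1 : ℝ≥0∞) = ∫⁻ _, 1 ∂P := by simp
          _ ≤ A := lintegral_mono hN
      simpa using ENNReal.toReal_mono hA h1
    have hgap' : K * Lg g * γ * (A.toReal + 2 * B.toReal) < η := by
      rw [← ENNReal.ofReal_toReal hfin, ← ENNReal.ofReal_mul hc.le,
        ENNReal.ofReal_lt_ofReal_iff hη, ENNReal.toReal_add hA hB2, ENNReal.toReal_mul] at hgap
      simpa using hgap
    obtain ⟨s1, s2, s3⟩ := toReal_integral_bound hDS hB (lintegral_mono hS)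
    obtain ⟨g1, g2, g3⟩ := toReal_integral_bound hDγ hA (lintegral_mono hγ)
    have s4 : Integrable (fun ω => 1 + (DS ω).toReal) P := (integrable_const _).add s2
    refine ⟨(s1.and g1).mono fun ω h => Or.inr h, (s4.add g2).const_mul _, ?_⟩
    rw [integral_const_mul, integral_add s4 g2,
      integral_add (integrable_const _) s2]
    simp only [integral_const, probReal_univ, one_smul]
    have hB0 : 0 ≤ B.toReal := ENNReal.toReal_nonneg
    have hLγ : 0 < Lg g * γ := by positivity
    -- The constant 1 is absorbed using N* ≥ 1. This factor 2, and the 2 in η/2, account for the 4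
    -- in `badCost_le_Kconst`.
    calc badCost p * (Lg g * γ) * (1 + ∫ ω, (DS ω).toReal ∂P + ∫ ω, (Dγ ω).toReal ∂P)
        ≤ badCost p * (Lg g * γ) * (2 * (A.toReal + 2 * B.toReal)) := by
          refine mul_le_mul_of_nonneg_left ?_ (by positivity)
          linarith
      _ = (Lg g * γ * (A.toReal + 2 * B.toReal)) * (4 * badCost p) / 2 := by ring
      _ ≤ (Lg g * γ * (A.toReal + 2 * B.toReal)) * K / 2 := by gcongr
      _ < η / 2 := by linarith

theorem isExponentiallyStable_of_gap (hp2 : 2 < p) (hp3 : p < 3)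
    (hCp : 1000 * sewConst (3 / p) ≤ Cp) (hf : ContDiff ℝ 1 f)
    (hfb : BddAbove (range fun y => ‖fderiv ℝ f y‖)) (hg : IsC3b g) (hΔ : 0 < Δ) (hΔ1 : Δ ≤ 1)
    [IsProbabilityMeasure P] (hstat : ∀ t : ℝ, MeasurePreserving (shift t) P P)
    (herg : Ergodic (shift Δ) P) (ha : IsStationarySolution P f g Δ a) {η : ℝ}
    (hη : -η = (∫ ω, ell f (a ω) ∂P) + 1 / 2 * Lf f ^ 2 * Δ) (hη0 : -η < 0)
    (hlam0 : 0 < lam) (hlam : lam < 1 / 2) (hγ0 : 0 < γ)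
    (hgap : ENNReal.ofReal (Kconst Cp lam (Lf f) Δ * Lg g * γ) *
      ((∫⁻ ω, greedyCount (roughVar p ω.1) γ 0 1 ∂P)
        + 2 * ∫⁻ ω, greedyCount (controlSum p Cp lam f g Δ a ω) lam 0 1 ∂P) < ENNReal.ofReal η) :
    IsExponentiallyStable P f g Δ a := by
  have hp : 0 < p := by linarith
  have hη' : 0 < η := by linarith
  have hlip := norm_sub_le_Lf hf hfb
  have hLf := Lf_nonneg (f := f)
  obtain ⟨ham, hsol⟩ := ha
  set DS := badCount (fun (ω : PathSpace m (1 / p)) s t =>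
    ENNReal.ofReal lam ≤ controlSum p Cp lam f g Δ a ω s t) (ratGrid Δ)
  set Dγ := badCount (fun (ω : PathSpace m (1 / p)) s t =>
    ENNReal.ofReal γ ≤ ratVar p Δ ω.1 s t) (ratGrid Δ)
  have hDS : Measurable DS := measurable_badCount (countable_ratGrid Δ) fun s t =>
    measurableSet_le measurable_const (measurable_controlSum hf.continuous ham
      (fun t => (hstat t).measurable) s t)
  have hDγ : Measurable Dγ := measurable_badCount (countable_ratGrid Δ) fun s t =>
    measurableSet_le measurable_const (measurable_ratVar Δ s t)
  obtain ⟨hDfin, hNi, hNint⟩ := badCost_integral_lt (Δ := Δ) hp2 hp3 hCp hlam0 hγ0 hη' hDS hDγ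
    (badCount_control_le hp) (badCount_ratVar_le hp) (fun ω => one_le_greedyCount zero_lt_one) hgap
  set c₀ := badCost p * (Lg g * γ)
  have hc₀ : 0 ≤ c₀ := by
    have hsew := two_le_sewConst (θ := 3 / p) (by rw [lt_div_iff₀ hp]; linarith)
    have := Lg_nonneg (g := g)
    have : 0 ≤ badCost p := by unfold badCost; linarith
    positivity
  let N : PathSpace m (1 / p) → ℝ := fun ω => c₀ * (1 + (DS ω).toReal + (Dγ ω).toReal)
  have hN0 : ∀ ω, 0 ≤ N ω := fun ω => by positivity
  have hNm : Measurable N :=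
    ((measurable_const.add hDS.ennreal_toReal).add hDγ.ennreal_toReal).const_mul _
  obtain ⟨I, hI⟩ : ∃ I, I = ∫ ω, N ω ∂P := ⟨_, rfl⟩
  have hI0 : 0 ≤ I := hI ▸ integral_nonneg hN0
  have hI1 : I < η / 2 := hI ▸ hNint
  -- With M the integer part of 1/Δ a block fits into [0, 1], where the counts are taken, and is at
  -- least 1/2 long.
  obtain ⟨M, hM, hM1, hM2⟩ : ∃ M : ℕ, 0 < M ∧ (M : ℝ) * Δ ≤ 1 ∧ 1 / 2 ≤ (M : ℝ) * Δ := by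
    have h1 : 1 ≤ 1 / Δ := by rw [le_div_iff₀ hΔ]; linarith
    have h2 : (⌊1 / Δ⌋₊ : ℝ) ≤ 1 / Δ := Nat.floor_le (by positivity)
    have h3 : 1 / Δ < ⌊1 / Δ⌋₊ + 1 := Nat.lt_floor_add_one _
    have h4 : 1 ≤ ⌊1 / Δ⌋₊ := Nat.one_le_floor_iff _ |>.2 h1
    have h5 : (1 : ℝ) ≤ ⌊1 / Δ⌋₊ := by exact_mod_cast h4
    rw [le_div_iff₀ hΔ] at h2
    rw [div_lt_iff₀ hΔ] at h3
    exact ⟨⌊1 / Δ⌋₊, h4, h2, by nlinarith⟩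
  -- Let I be the mean cost per block. The radius is chosen so that linearisation uses up at most
  -- half of the margin η - 2I.
  obtain ⟨r, hr, hrint⟩ := exists_integral_ellRadius_lt (P := P) (c := ∫ ω, ell f (a ω) ∂P +
    (η - 2 * I) / 2) hlip ham (by linarith)
  let h : PathSpace m (1 / p) → ℝ := fun ω => driftRate f Δ r (a ω)
  have hem : Measurable fun ω => ellRadius f (a ω) r := (measurable_ellRadius hlip r).comp ham
  have hei : Integrable (fun ω => ellRadius f (a ω) r) P :=
    Integrable.of_bound hem.aestronglyMeasurable (Lf f)
      (Eventually.of_forall fun ω => abs_ellRadius_le hlip _ _)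
  have hm : Measurable h := (hem.const_mul Δ).add_const _
  have hi : Integrable h P := (hei.const_mul Δ).add (integrable_const _)
  have hint : ∫ ω, h ω ∂P < Δ * (-η + (η - 2 * I) / 2) := by
    simp only [h, driftRate]
    rw [integral_add (hei.const_mul Δ) (integrable_const _), integral_const_mul]
    simp only [integral_const, probReal_univ, one_smul]
    nlinarith
  let F : PathSpace m (1 / p) → ℝ := fun ω => ∑ l ∈ Finset.range M, h ((shift Δ)^[l] ω) + N ω
  have hTl : ∀ l : ℕ, MeasurePreserving ((shift Δ)^[l]) P P := fun l =>
    herg.toMeasurePreserving.iterate l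
  have hhl : ∀ l : ℕ, Integrable (fun ω => h ((shift Δ)^[l] ω)) P := fun l =>
    (hTl l).integrable_comp_of_integrable hi
  have hFm : Measurable F :=
    (Finset.measurable_fun_sum _ fun l _ => hm.comp (hTl l).measurable).add hNm
  have hFi : Integrable F P := (integrable_finsetSum _ fun l _ => hhl l).add hNi
  -- The mean is below -MΔ(η/2 + I) + I, and MΔ ≥ 1/2 makes this at most (I - η/2)/2 < 0.
  have hFneg : ∫ ω, F ω ∂P < 0 := by
    simp only [F]
    rw [integral_add (integrable_finsetSum _ fun l _ => hhl l) hNi,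
      integral_finsetSum _ fun l _ => hhl l]
    have e : ∀ l ∈ Finset.range M, ∫ ω, h ((shift Δ)^[l] ω) ∂P = ∫ ω, h ω ∂P := fun l _ => by
      conv_rhs => rw [← (hTl l).map_eq]
      rw [integral_map (hTl l).measurable.aemeasurable hm.aestronglyMeasurable]
    rw [Finset.sum_congr rfl e, Finset.sum_const, Finset.card_range, nsmul_eq_mul]
    have hM0 : (0 : ℝ) < M := by exact_mod_cast hM
    have h1 := mul_lt_mul_of_pos_left hint hM0
    rw [← hI]
    nlinarith
  set hmax := Δ * Lf f + 1 / 2 * Lf f ^ 2 * Δ ^ 2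
  have hmax0 : 0 ≤ hmax := by positivity
  obtain ⟨μ, hμ, B, hBm, hB⟩ := exists_measurable_bound herg (G := fun ω => M * hmax + N ω) hFm
    (measurable_const.add hNm) hFi ((integrable_const _).add hNi) hFneg hM
  -- Invariance of the law transfers almost sure finiteness to every time of the orbit; otherwise
  -- `toReal` would send an infinite count to 0.
  have hfin : ∀ᵐ ω ∂P, ∀ k : ℕ, c₀ = 0 ∨
      DS (shift ((k : ℝ) * Δ) ω) ≠ ⊤ ∧ Dγ (shift ((k : ℝ) * Δ) ω) ≠ ⊤ :=
    ae_all_iff.2 fun k => (hstat _).quasiMeasurePreserving.ae hDfin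
  refine isExponentiallyStable_of_decay hr hμ hΔ hBm ?_
  filter_upwards [hB, hfin, hsol] with ω hBω hfinω hsolω y₀ hy k
  set b : ℕ → Vec d := fun k => a (shift ((k : ℝ) * Δ) ω)
  have hb0 : b 0 = a ω := hsolω 0
  have hbs : IsSchemeOrbit f g Δ ω.1 b := by
    have : b = scheme f g Δ ω.1 (a ω) := funext hsolω
    rw [this]
    exact isSchemeOrbit_scheme _ _
  set y := scheme f g Δ ω.1 y₀
  have hys : IsSchemeOrbit f g Δ ω.1 y := isSchemeOrbit_scheme _ _
  have hy0 : y 0 = y₀ := rfl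
  have hsh : ∀ k l : ℕ, shift ((l : ℝ) * Δ) (shift ((k : ℝ) * Δ) ω) =
      shift (((k + l : ℕ) : ℝ) * Δ) ω := fun k l => by
    rw [shift_shift]; congr 1; push_cast; ring
  have hblock : ∀ k i, i ≤ M → (∀ l < i, 5 * ‖y (k + l) - b (k + l)‖ < r) →
      ‖y (k + i) - b (k + i)‖ ≤ ‖y k - b k‖ * Real.exp
        (∑ l ∈ Finset.range i, driftRate f Δ r (b (k + l)) + N (shift ((k : ℝ) * Δ) ω)) := by
    intro k i hiM hreg
    have hiΔ : (i : ℝ) * Δ ≤ 1 := by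
      have : (i : ℝ) ≤ M := by exact_mod_cast hiM
      nlinarith
    obtain ⟨nS, nγ, h1, h2, h3⟩ := block_le (a := a) (ω := shift ((k : ℝ) * Δ) ω)
      (b := fun l => b (k + l)) (y := fun l => y (k + l)) hp2 hp3 hlip hg hCp hlam0 hlam hγ0 hΔ
      (fun l => by rw [hsh]) (hbs.shift k) (hys.shift k) i hiΔ hreg
    refine h3.trans ?_
    simp only [add_zero]
    refine mul_le_mul_of_nonneg_left (Real.exp_le_exp.2 (add_le_add_right ?_ _)) (norm_nonneg _)
    rcases hfinω k with h0 | ⟨f1, f2⟩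
    · change c₀ * _ ≤ c₀ * _
      rw [h0, zero_mul, zero_mul]
    · have e1 : (nS : ℝ) ≤ (DS (shift ((k : ℝ) * Δ) ω)).toReal := by
        simpa using ENNReal.toReal_mono f1 (HasBad.le_badCount (ω := shift ((k : ℝ) * Δ) ω)
          (bad := fun (ω : PathSpace m (1 / p)) s t =>
            ENNReal.ofReal lam ≤ controlSum p Cp lam f g Δ a ω s t) h1)
      have e2 : (nγ : ℝ) ≤ (Dγ (shift ((k : ℝ) * Δ) ω)).toReal := by
        simpa using ENNReal.toReal_mono f2 (HasBad.le_badCount (ω := shift ((k : ℝ) * Δ) ω)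
          (bad := fun (ω : PathSpace m (1 / p)) s t =>
            ENNReal.ofReal γ ≤ ratVar p Δ ω.1 s t) h2)
      exact mul_le_mul_of_nonneg_left (by linarith) hc₀
  have hdecay := orbit_decay hM (u := fun k => ‖y k - b k‖) (h := fun k => driftRate f Δ r (b k))
    (N := fun k => N (shift ((k : ℝ) * Δ) ω)) (hmax := hmax) (r := r) (B := B ω) (μ := μ)
    (fun k => norm_nonneg _) (fun k => driftRate_le hlip hΔ.le r _) hmax0 (fun k => hN0 _) hμ.le
    hblock (fun n => ?_) (by simpa only [hb0, hy0] using hy) k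
  · simpa only [hb0, hy0] using hdecay
  · have eF : ∀ k : ℕ, F (shift ((k : ℝ) * Δ) ω) = ∑ l ∈ Finset.range M, driftRate f Δ r (b (k + l)) +
        N (shift ((k : ℝ) * Δ) ω) := fun k => by
      simp only [F, h]
      congr 1
      exact Finset.sum_congr rfl fun l _ => by rw [iterate_shift, hsh]
    have e0 : N (shift (((0 : ℕ) : ℝ) * Δ) ω) = N ω := by rw [← iterate_shift]; rfl
    have := hBω n
    simp only [iterate_shift, eF] at this
    rwa [e0]

end Stability

end

theorem mainTheorem2 (p : ℝ) (hp2 : 2 < p) (hp3 : p < 3) :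
    ∃ C₀ : ℝ, 1 < C₀ ∧ ∀ Cp : ℝ, C₀ ≤ Cp → IsRoughIntegralConstant p Cp ∧
      ∀ (d m : ℕ) (ν : ℝ), 1 / p < ν → ν ≤ 1 / 2 →
      ∀ (f : Vec d → Vec d), ContDiff ℝ 1 f →
        BddAbove (Set.range fun y => ‖fderiv ℝ f y‖) →
      ∀ (g : Vec d → Vec m →L[ℝ] Vec d), IsC3b g →
      ∀ (Δ : ℝ), 0 < Δ → Δ ≤ 1 →
      ∀ (P : Measure (PathSpace m (1 / p))), IsNoiseLaw p ν P → Ergodic (shift Δ) P →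
      ∀ (a : PathSpace m (1 / p) → Vec d), IsStationarySolution P f g Δ a →
        MemLp a (ENNReal.ofReal p) P →
      ∀ (η : ℝ), -η = (∫ ω, ell f (a ω) ∂P) + 1 / 2 * Lf f ^ 2 * Δ → -η < 0 →
      ∀ (lam γ : ℝ), 0 < lam → lam < 1 / 2 → 0 < γ → γ < 1 →
        ENNReal.ofReal (Kconst Cp lam (Lf f) Δ * Lg g * γ) *
            ((∫⁻ ω, greedyCount (roughVar p ω.1) γ 0 1 ∂P)
              + 2 * ∫⁻ ω, greedyCount (controlSum p Cp lam f g Δ a ω) lam 0 1 ∂P)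
          < ENNReal.ofReal η →
        IsExponentiallyStable P f g Δ a := by
  have hsew := two_le_sewConst (θ := 3 / p) (by rw [lt_div_iff₀ (by linarith)]; linarith)
  -- One threshold serves both claims: the integral estimate needs 8 sewing constants, the smallness
  -- of κ needs 1000.
  refine ⟨1000 * sewConst (3 / p), by linarith, fun Cp hCp =>
    ⟨isRoughIntegralConstant_of_le hp2 hp3 (by linarith), ?_⟩⟩
  intro d m ν _ _ f hf hfb g hg Δ hΔ hΔ1 P hP herg a ha _ η hη hη0 lam γ hlam0 hlam hγ0 _ hgap
  have := hP.isProbability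
  exact isExponentiallyStable_of_gap hp2 hp3 hCp hf hfb hg hΔ hΔ1 hP.stationary herg ha hη hη0
    hlam0 hlam hγ0 hgap
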